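/- **Definitions.** A *hypergraph* is a pair $H=(V(H),E(H))$ of a finite set $V(H)$ and a set $E(H)$ of nonempty subsets of $V(H)$; write $|H|=|V(H)|$. A *homomorphism* from $H$ to $G$ is a map $\varphi\colon V(H)\to V(G)$ with $\varphi(e)\in E(G)$ for all $e\in E(H)$; $\#\mathrm{Hom}(H,G)$ is the number of homomorphisms. For a finitely supported function $\gamma$ from isomorphism types of hypergraphs to $\mathbb{Q}$, let $\zeta_\gamma(G)=\sum_F\gamma(F)\cdot\#\mathrm{Hom}(F,G)$ (a *hypergraph motif parameter*). For a family $\Gamma$ of such functions let $\mathcal{H}_\Gamma=\bigcup_{\gamma\in\Gamma}\operatorname{supp}(\gamma)$. The family $\Gamma$ is recursively enumerable if the set of descriptions (finite lists of the hypergraphs in the support with their coefficients) of its members is; families of hypergraphs are closed under isomorphism. For a family $\mathcal{H}$ of hypergraphs, $\#\mathrm{Hom}(\mathcal{H})$ is the parametrised problem with input a pair $(H,G)$ of hypergraphs, $H\in\mathcal{H}$, output $\#\mathrm{Hom}(H,G)$ and parameter $|H|$. $\mathrm{HyperME}(\Gamma)$ is the parametrised problem with input (a description of) some $\gamma\in\Gamma$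 and a hypergraph $G$, output $\zeta_\gamma(G)$ and parameter $\lVert\gamma\rVert$, the length of the description of $\gamma$. Both are promise problems: only the inputs just described are admissible. For parametrised problems $(P_1,\kappa_1)$, $(P_2,\kappa_2)$, a *parametrised Turing reduction with bounds* $f,g\colon\mathbb{N}\to\mathbb{N}$ is one deterministic algorithm with oracle access to $P_2$ that, for a constant $c$ and for every admissible input $x$, computes $P_1(x)$ in time at most $f(\kappa_1(x))\cdot|x|^{c}$ and asks only admissible queries $y$ with $\kappa_2(y)\le g(\kappa_1(x))$. Write $P_1\le_{\mathrm{FPT}}P_2$ if such a reduction exists with computable $f$ and $g$, and $P_1\le_{\mathrm{uFPT}}P_2$ if one exists with arbitrary functions $f$ and $g$ (the algorithm and $c$ are still the same for all inputs). **Theorem (Complexity monotonicity).** Let $\Gamma$ be a recursively enumerable family of hypergraph motif parameters. Then: 1. $\#\mathrm{Hom}(\mathcal{H}_\Gamma)\le_{\mathrm{uFPT}}\mathrm{HyperME}(\Gamma)$. 2. $\#\mathrm{Hom}(\mathcal{H})\le_{\mathrm{FPT}}\mathrm{HyperME}(\Gamma)$ for every decidable family $\mathcal{H}\subseteq\mathcal{H}_\Gamma$.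 In particular, $\#\mathrm{Hom}(\mathcal{H}_\Gamma)\le_{\mathrm{FPT}}\mathrm{HyperME}(\Gamma)$ whenever $\mathcal{H}_\Gamma$ is decidable, and $\#\mathrm{Hom}(\{H\})\le_{\mathrm{FPT}}\mathrm{HyperME}(\Gamma)$ for every $H\in\mathcal{H}_\Gamma$. 3. Conversely, $\mathrm{HyperME}(\Gamma)\le_{\mathrm{FPT}}\#\mathrm{Hom}(\mathcal{H}_\Gamma)$. -/

import Mathlib

namespace HyperMotif

/-! ### Finite hypergraphs, homomorphisms, isomorphism types -/

/-- A hypergraph in the sense used here: a finite vertex set (of natural numbers) and a set of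
nonempty subsets of it.  Every finite hypergraph is isomorphic to one of these. -/
structure FiniteHypergraph extends Hypergraph ℕ where
  finite_vertexSet : vertexSet.Finite
  nonempty_of_mem : ∀ e ∈ edgeSet, e.Nonempty

/-- The image `φ(e)` of a set of vertices under a map of vertex sets. -/
def imageSet {H G : FiniteHypergraph} (φ : H.vertexSet → G.vertexSet) (e : Set ℕ) : Set ℕ :=
  {w | ∃ v : H.vertexSet, (v : ℕ) ∈ e ∧ (φ v : ℕ) = w}

/-- Homomorphisms map every edge onto an edge. -/
def IsHom {H G : FiniteHypergraph} (φ : H.vertexSet → G.vertexSet) : Prop :=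
  ∀ e ∈ H.edgeSet, imageSet φ e ∈ G.edgeSet

/-- The number of homomorphisms from `H` to `G`. -/
noncomputable def homCount (H G : FiniteHypergraph) : ℕ :=
  Nat.card {φ : H.vertexSet → G.vertexSet // IsHom φ}

/-- `σ` is an isomorphism: a bijection that preserves edges and non-edges. -/
def IsIso {H G : FiniteHypergraph} (σ : H.vertexSet ≃ G.vertexSet) : Prop :=
  ∀ S ⊆ H.vertexSet, S ∈ H.edgeSet ↔ imageSet σ S ∈ G.edgeSet

theorem imageSet_comp {H G F : FiniteHypergraph} (φ : H.vertexSet → G.vertexSet)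
    (ψ : G.vertexSet → F.vertexSet) (e : Set ℕ) :
    imageSet ψ (imageSet φ e) = imageSet (ψ ∘ φ) e := by
  ext w
  constructor
  · rintro ⟨v, ⟨u, hu, huv⟩, hv⟩
    have : φ u = v := Subtype.ext huv
    exact ⟨u, hu, by simpa [this] using hv⟩
  · rintro ⟨u, hu, huw⟩
    exact ⟨φ u, ⟨u, hu, rfl⟩, huw⟩

theorem imageSet_id {H : FiniteHypergraph} (e : Set ℕ) (he : e ⊆ H.vertexSet) :
    imageSet (id : H.vertexSet → H.vertexSet) e = e := by
  ext w
  constructor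
  · rintro ⟨v, hv, rfl⟩
    exact hv
  · intro hw
    exact ⟨⟨w, he hw⟩, hw, rfl⟩

theorem imageSet_subset {H G : FiniteHypergraph} (φ : H.vertexSet → G.vertexSet) (e : Set ℕ) :
    imageSet φ e ⊆ G.vertexSet := by
  rintro w ⟨v, -, rfl⟩
  exact (φ v).2

theorem IsIso.refl (H : FiniteHypergraph) : IsIso (Equiv.refl H.vertexSet) := by
  intro S hS
  have := imageSet_id S hS
  simp only [Equiv.coe_refl, this]

theorem IsIso.symm {H G : FiniteHypergraph} {σ : H.vertexSet ≃ G.vertexSet} (h : IsIso σ) :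
    IsIso σ.symm := by
  intro S hS
  rw [h _ (imageSet_subset _ _), imageSet_comp]
  have : (σ ∘ σ.symm : G.vertexSet → G.vertexSet) = id := by funext x; simp
  rw [this, imageSet_id S hS]

theorem IsIso.trans {H G F : FiniteHypergraph} {σ : H.vertexSet ≃ G.vertexSet}
    {τ : G.vertexSet ≃ F.vertexSet} (h : IsIso σ) (h' : IsIso τ) : IsIso (σ.trans τ) := by
  intro S hS
  rw [h S hS, h' _ (imageSet_subset _ _), imageSet_comp]
  rfl

theorem IsIso.isHom {H G : FiniteHypergraph} {σ : H.vertexSet ≃ G.vertexSet} (h : IsIso σ) :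
    IsHom σ :=
  fun e he => (h e (H.subset_vertexSet_of_mem_edgeSet' he)).1 he

theorem IsHom.comp {H G F : FiniteHypergraph} {φ : H.vertexSet → G.vertexSet}
    {ψ : G.vertexSet → F.vertexSet} (hψ : IsHom ψ) (hφ : IsHom φ) : IsHom (ψ ∘ φ) := by
  intro e he
  rw [← imageSet_comp]
  exact hψ _ (hφ e he)

/-- Being isomorphic. -/
instance isoSetoid : Setoid FiniteHypergraph where
  r H G := ∃ σ : H.vertexSet ≃ G.vertexSet, IsIso σ
  iseqv :=
    { refl := fun H => ⟨_, IsIso.refl H⟩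
      symm := fun ⟨_, h⟩ => ⟨_, h.symm⟩
      trans := fun ⟨_, h⟩ ⟨_, h'⟩ => ⟨_, h.trans h'⟩ }

/-- Isomorphism types of (finite) hypergraphs. -/
abbrev HypergraphType : Type := Quotient isoSetoid

theorem homCount_congr (H H' : FiniteHypergraph) (h : H ≈ H') (G : FiniteHypergraph) :
    homCount H G = homCount H' G := by
  obtain ⟨σ, hσ⟩ := h
  refine Nat.card_congr
    { toFun := fun φ => ⟨φ.1 ∘ σ.symm, φ.2.comp hσ.symm.isHom⟩
      invFun := fun φ => ⟨φ.1 ∘ σ, φ.2.comp hσ.isHom⟩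
      left_inv := fun φ => by ext v; simp
      right_inv := fun φ => by ext v; simp }

/-- The number of homomorphisms from an isomorphism type to `G`. -/
noncomputable def HypergraphType.homCount (F : HypergraphType) (G : FiniteHypergraph) : ℕ :=
  Quotient.lift (fun H => HyperMotif.homCount H G) (fun H H' h => homCount_congr H H' h G) F

/-! ### Hypergraph motif parameters -/

/-- Finitely supported functions `γ` from (isomorphism types of) hypergraphs to `ℚ`. -/
abbrev MotifFunction : Type := HypergraphType →₀ ℚ

/-- The hypergraph motif parameter `ζ_γ(G) = ∑_F γ(F) · #Hom(F, G)`. -/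
noncomputable def zeta (γ : MotifFunction) (G : FiniteHypergraph) : ℚ :=
  γ.sum fun F a => a * (F.homCount G : ℚ)

/-- The family `⋃_{γ ∈ Γ} supp γ` of hypergraphs (up to isomorphism). -/
def supports (Γ : Set MotifFunction) : Set HypergraphType :=
  {F | ∃ γ ∈ Γ, F ∈ γ.support}

/-! ### Finite descriptions of hypergraphs and of motif parameters -/

/-- `(n, L)` describes the hypergraph with vertices `0, …, n - 1` whose edges are listed in `L`,
each edge being given by the list of its vertices. -/
abbrev HypergraphCode : Type := ℕ × List (List ℕ)

/-- The listed edges are nonempty sets of vertices, no vertex is listed twice in an edge, and no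
edge is listed twice. -/
def HypergraphCode.Valid (c : HypergraphCode) : Prop :=
  (∀ l ∈ c.2, l ≠ [] ∧ l.Nodup ∧ ∀ v ∈ l, v < c.1) ∧
    c.2.Pairwise fun l l' => ¬ ∀ v, v ∈ l ↔ v ∈ l'

/-- The hypergraph described by a code (list entries that do not describe an edge are ignored;
valid codes have none). -/
def HypergraphCode.toHypergraph (c : HypergraphCode) : FiniteHypergraph where
  vertexSet := {v | v < c.1}
  edgeSet := {e | e.Nonempty ∧ e ⊆ {v | v < c.1} ∧ ∃ l ∈ c.2, e = {v | v ∈ l}}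
  subset_vertexSet_of_mem_edgeSet' := fun _ he => he.2.1
  finite_vertexSet := Set.finite_lt_nat c.1
  nonempty_of_mem := fun _ he => he.1

/-- The isomorphism type of the hypergraph described by a code. -/
def HypergraphCode.type (c : HypergraphCode) : HypergraphType := ⟦c.toHypergraph⟧

/-- A motif function is described by a list of the hypergraphs in its support together with their
coefficients. -/
abbrev MotifCode : Type := List (HypergraphCode × ℚ)

/-- The listed hypergraphs are pairwise non-isomorphic, their coefficients are nonzero. -/
def MotifCode.Valid (d : MotifCode) : Prop :=
  (∀ p ∈ d, p.1.Valid ∧ p.2 ≠ 0) ∧ (d.map fun p => p.1.type).Nodup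

/-- The motif function described by a list. -/
noncomputable def MotifCode.toMotif (d : MotifCode) : MotifFunction :=
  (d.map fun p => Finsupp.single p.1.type p.2).sum

/-- `Γ` is recursively enumerable: so is the set of all descriptions of its members.  For this
purpose a rational coefficient is given by naturals `a, b, c` as the fraction `(a - b) / c`. -/
def RecursivelyEnumerable (Γ : Set MotifFunction) : Prop :=
  REPred fun l : List (HypergraphCode × ℕ × ℕ × ℕ) =>
    let d : MotifCode := l.map fun p =>
      (p.1, (((p.2.1 : ℚ) - (p.2.2.1 : ℚ)) / (p.2.2.2 : ℚ) : ℚ))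
    d.Valid ∧ d.toMotif ∈ Γ

/-- A family of hypergraphs (up to isomorphism) is decidable: it is decidable whether a list
describes one of its members. -/
def DecidableFamily (𝓗 : Set HypergraphType) : Prop :=
  ComputablePred fun c : HypergraphCode => c.Valid ∧ c.type ∈ 𝓗

/-! ### Data and oracle programs with logarithmic cost

Words over a finite alphabet are presented as binary trees whose leaves are rational numbers,
written in binary as reduced fractions. -/

/-- Binary trees with rational leaves. -/
inductive Data : Type
  | rat (q : ℚ) : Data
  | pair (a b : Data) : Data

namespace Data

/-- The length of a datum when it is written down in binary, up to a constant factor. -/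
def size : Data → ℕ
  | rat q => Nat.size q.num.natAbs + Nat.size q.den + 1
  | pair a b => size a + size b + 1

/-- The list with entries `a₁, …, a_k` is `(a₁, (a₂, … (a_k, 0)))`. -/
def ofList : List Data → Data
  | [] => rat 0
  | a :: l => pair a (ofList l)

/-- A natural number as a leaf. -/
def ofNat (n : ℕ) : Data := rat (n : ℚ)

/-- The list of the vertices followed by the list of the edges. -/
def ofHypergraph (c : HypergraphCode) : Data :=
  pair (ofList ((List.range c.1).map ofNat))
    (ofList (c.2.map fun l => ofList (l.map ofNat)))

/-- The list of pairs (hypergraph in the support, coefficient). -/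
def ofMotif (d : MotifCode) : Data :=
  ofList (d.map fun p => pair (ofHypergraph p.1) (rat p.2))

/-- Apply a binary operation to the two leaves of a pair of leaves; `0` on other data. -/
def arith (op : ℚ → ℚ → ℚ) : Data → Data
  | pair (rat a) (rat b) => rat (op a b)
  | _ => rat 0

end Data

/-- Basic instructions. -/
inductive Instr : Type
  | id
  | const (d : Data)
  | fst
  | snd
  | isPair
  | add
  | sub
  | mul
  | div
  | le
  | floor

/-- The effect of a basic instruction.  Truth values are `1` and `0`. -/
def Instr.eval : Instr → Data → Data
  | .id, x => x
  | .const d, _ => d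
  | .fst, .pair a _ => a
  | .fst, .rat _ => .rat 0
  | .snd, .pair _ b => b
  | .snd, .rat _ => .rat 0
  | .isPair, .pair _ _ => .rat 1
  | .isPair, .rat _ => .rat 0
  | .add, x => x.arith (· + ·)
  | .sub, x => x.arith (· - ·)
  | .mul, x => x.arith (· * ·)
  | .div, x => x.arith (· / ·)
  | .le, x => x.arith fun a b => if a ≤ b then 1 else 0
  | .floor, .rat q => .rat (⌊q⌋ : ℤ)
  | .floor, .pair _ _ => .rat 0

/-- Deterministic programs with oracle calls. Each program transforms one datum. -/
inductive Prog : Type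
  | basic (i : Instr)
  /-- first `p`, then `q` -/
  | seq (p q : Prog)
  /-- run `p` and `q` on the same input and pair their results -/
  | both (p q : Prog)
  /-- if the result of `c` is not `0` then `p` else `q` -/
  | ite (c p q : Prog)
  /-- as long as the result of `c` is not `0`, apply `p` -/
  | while (c p : Prog)
  /-- replace the current datum by the answer of the oracle to it -/
  | query

/-- `Run O p x y t`: with the oracle `O` (where `O u v` means that `v` is the answer to `u`), the
program `p` halts on input `x` with output `y` after time `t`.  The time is logarithmic: each basic
instruction, and each oracle call, costs the total binary length of its argument and its result.
A run that asks a question to which the oracle has no answer gets stuck.  Since each basic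
instruction takes polynomial time on a Turing machine and a run never handles data that are longer
than its cost, this time agrees with oracle Turing machine time up to a polynomial. -/
inductive Run (O : Data → Data → Prop) : Prog → Data → Data → ℕ → Prop
  | basic (i : Instr) (x : Data) :
      Run O (.basic i) x (i.eval x) (x.size + (i.eval x).size + 1)
  | seq {p q : Prog} {x y z : Data} {s t : ℕ} :
      Run O p x y s → Run O q y z t → Run O (.seq p q) x z (s + t + 1)
  | both {p q : Prog} {x y z : Data} {s t : ℕ} :
      Run O p x y s → Run O q x z t → Run O (.both p q) x (.pair y z) (s + t + 1)
  | iteTrue {c p q : Prog} {x b y : Data} {s t : ℕ} :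
      Run O c x b s → b ≠ .rat 0 → Run O p x y t → Run O (.ite c p q) x y (s + t + 1)
  | iteFalse {c p q : Prog} {x y : Data} {s t : ℕ} :
      Run O c x (.rat 0) s → Run O q x y t → Run O (.ite c p q) x y (s + t + 1)
  | whileStop {c p : Prog} {x : Data} {s : ℕ} :
      Run O c x (.rat 0) s → Run O (.while c p) x x (s + 1)
  | whileStep {c p : Prog} {x b y z : Data} {s t u : ℕ} :
      Run O c x b s → b ≠ .rat 0 → Run O p x y t → Run O (.while c p) y z u →
      Run O (.while c p) x z (s + t + u + 1)
  | query {x y : Data} : O x y → Run O .query x y (x.size + y.size + 1)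

/-! ### Parametrised problems and parametrised Turing reductions -/

/-- A parametrised counting problem: a set of (admissible) instances, encoded as data, each with a
rational value to be computed and a parameter. -/
structure ParamProblem where
  Inst : Type
  enc : Inst → Data
  enc_injective : Function.Injective enc
  value : Inst → ℚ
  param : Inst → ℕ

/-- The oracle for a problem that answers exactly the instances with parameter at most `B`. -/
def ParamProblem.oracle (P : ParamProblem) (B : ℕ) (u v : Data) : Prop :=
  ∃ y : P.Inst, P.param y ≤ B ∧ u = P.enc y ∧ v = .rat (P.value y)

/-- With oracle access to `Q`, the program `M` computes the value of each instance `x` of `P` in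
time at most `f(κ(x)) · |x| ^ c`, and all its queries are instances of `Q` with parameter at most
`g(κ(x))`. -/
def IsParamReduction (P Q : ParamProblem) (M : Prog) (f g : ℕ → ℕ) (c : ℕ) : Prop :=
  ∀ x : P.Inst, ∃ t : ℕ, t ≤ f (P.param x) * (P.enc x).size ^ c ∧
    Run (Q.oracle (g (P.param x))) M (P.enc x) (.rat (P.value x)) t

/-- `P ≤_FPT Q`: there is a parametrised Turing reduction from `P` to `Q`; the bounds `f` and `g`
are computable. -/
def FPTReducible (P Q : ParamProblem) : Prop :=
  ∃ (M : Prog) (f g : ℕ → ℕ) (c : ℕ),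
    Computable f ∧ Computable g ∧ IsParamReduction P Q M f g c

/-- The variant of `P ≤_FPT Q` (uniform fixed-parameter tractability): still one program and one
exponent for all instances, but `f` and `g` are arbitrary functions of the parameter. -/
def UniformlyFPTReducible (P Q : ParamProblem) : Prop :=
  ∃ (M : Prog) (f g : ℕ → ℕ) (c : ℕ), IsParamReduction P Q M f g c

/-! ### Injectivity of the encodings -/

theorem Data.ofList_injective : Function.Injective Data.ofList := by
  intro l
  induction l with
  | nil =>
    intro l' h
    cases l' with
    | nil => rfl
    | cons b l' => simp [Data.ofList] at h
  | cons a l ih =>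
    intro l' h
    cases l' with
    | nil => simp [Data.ofList] at h
    | cons b l' =>
      simp only [Data.ofList, Data.pair.injEq] at h
      rw [h.1, ih h.2]

theorem Data.ofNat_injective : Function.Injective Data.ofNat := by
  intro m n h
  simpa [Data.ofNat] using h

theorem Data.ofHypergraph_injective : Function.Injective Data.ofHypergraph := by
  rintro ⟨n, L⟩ ⟨n', L'⟩ h
  simp only [Data.ofHypergraph, Data.pair.injEq] at h
  have h1 := congrArg List.length (Data.ofList_injective h.1)
  have h2 := List.map_injective_iff.2
    (Data.ofList_injective.comp (List.map_injective_iff.2 Data.ofNat_injective))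
    (Data.ofList_injective h.2)
  simp only [List.length_map, List.length_range] at h1
  rw [h1, h2]

theorem Data.ofMotif_injective : Function.Injective Data.ofMotif := by
  refine Data.ofList_injective.comp (List.map_injective_iff.2 ?_)
  rintro ⟨c, q⟩ ⟨c', q'⟩ h
  simp only [Data.pair.injEq, Data.rat.injEq] at h
  rw [Data.ofHypergraph_injective h.1, h.2]

/-! ### The two problems -/

/-- `#Hom(𝓗)`: the input is a pair of hypergraphs `H ∈ 𝓗` and `G`, the output is the number of
homomorphisms from `H` to `G`, the parameter is the number `|H|` of vertices of `H`. -/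
noncomputable def homProblem (𝓗 : Set HypergraphType) : ParamProblem where
  Inst := {x : HypergraphCode × HypergraphCode // x.1.Valid ∧ x.1.type ∈ 𝓗 ∧ x.2.Valid}
  enc x := .pair (Data.ofHypergraph x.1.1) (Data.ofHypergraph x.1.2)
  enc_injective := by
    rintro ⟨⟨a, b⟩, _⟩ ⟨⟨a', b'⟩, _⟩ h
    simp only [Data.pair.injEq] at h
    exact Subtype.ext (Prod.ext (Data.ofHypergraph_injective h.1) (Data.ofHypergraph_injective h.2))
  value x := (homCount x.1.1.toHypergraph x.1.2.toHypergraph : ℚ)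
  param x := x.1.1.1

/-- `HyperME(Γ)`: the input is a description of some `γ ∈ Γ` and a hypergraph `G`, the output is
`ζ_γ(G)`, the parameter is the length of the description of `γ`. -/
noncomputable def hyperME (Γ : Set MotifFunction) : ParamProblem where
  Inst := {x : MotifCode × HypergraphCode // x.1.Valid ∧ x.1.toMotif ∈ Γ ∧ x.2.Valid}
  enc x := .pair (Data.ofMotif x.1.1) (Data.ofHypergraph x.1.2)
  enc_injective := by
    rintro ⟨⟨a, b⟩, _⟩ ⟨⟨a', b'⟩, _⟩ h
    simp only [Data.pair.injEq] at h
    exact Subtype.ext (Prod.ext (Data.ofMotif_injective h.1) (Data.ofHypergraph_injective h.2))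
  value x := zeta x.1.1.toMotif x.1.2.toHypergraph
  param x := (Data.ofMotif x.1.1).size

end HyperMotif

/-! The engine is the product `G × K` on `V(G) × V(K)` whose edges are the sets that project onto an
edge of `G` and onto an edge of `K`. A map into it is a homomorphism exactly when both components
are, so `#Hom(F, G × K) = #Hom(F, G) · #Hom(F, K)` (`homCount_gadget_prod`) and `ζ_γ(G × K) = ∑_F
γ(F) · #Hom(F, K) · #Hom(F, G)`. If rationals `α_K` satisfy `∑_K α_K · #Hom(F, K) = [F = H]` for all
`F` in the support of `γ`, then `∑_K α_K · ζ_γ(G × K) = γ(H) · #Hom(H, G)`, and division by `γ(H) ≠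
0` gives the wanted count (`value_separatingScheme`).

Such `α_K` exist (`exists_separating`). By Lovász's argument the counts `#Hom(F, ·)` determine `F`
up to isomorphism (`equiv_of_homCount_eq`). By multiplicativity they are characters of a monoid of
hypergraphs, so for pairwise non-isomorphic `F` they are linearly independent by Dedekind's theorem,
and any right-hand side can be attained.

The reduction must find `γ` and the `α_K` from `H` alone. A witness for `H` consists of a
description, an entry isomorphic to `H`, a separating combination, and a number of steps after which
the enumeration of `Γ` accepts the description. Being a witness is primitive recursive and every `H
∈ 𝓗_Γ` has one (`exists_isWitness`), so blind search succeeds after a time that depends only on `H`.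
The remaining work is polynomial in `G` and the data found. Only edges of `G` with at most `k`
vertices are used in products, where `k` bounds the orders of the hypergraphs in the support: longer
edges cannot be images of edges, and without this cut a single edge of `G` could have exponentially
many edges over it.

There are finitely many valid codes with `n` vertices, so adding up the costs over them bounds time
and query parameters in terms of `n` (`exists_reduction_of_primrecPred`). The bound is computable if
it can be decided for which codes the search is known to end, that is, if the family is decidable;
otherwise it is merely a function. The converse reduction evaluates the defining sum of `ζ_γ` term
by term (`hyperME_fptReducible`).

All of this is carried out for explicit oracle programs. `PB` and `PT` express polynomial bounds
uniform over an indexed family of runs; `exists_primrecTime` compiles primitive recursive functions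
to programs, and a small stack machine (`primrecTime_build`) turns their numerical output into data.
-/

namespace HyperMotif

/-! ### Sizes of data -/

theorem Data.size_pair (a b : Data) : (Data.pair a b).size = a.size + b.size + 1 := rfl

theorem Data.size_pos (x : Data) : 0 < x.size := by
  cases x <;> simp [Data.size]

theorem Nat_size_add_le (a b : ℕ) : Nat.size (a + b) ≤ Nat.size a + Nat.size b := by
  rcases Nat.eq_zero_or_pos a with rfl | ha
  · simp
  rcases Nat.eq_zero_or_pos b with rfl | hb
  · simp
  rw [Nat.size_le]
  have h1 := Nat.lt_size_self a
  have h2 := Nat.lt_size_self b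
  have h3 : 2 ≤ 2 ^ Nat.size a := Nat.le_self_pow (Nat.size_pos.2 ha).ne' 2
  have h4 : 2 ≤ 2 ^ Nat.size b := Nat.le_self_pow (Nat.size_pos.2 hb).ne' 2
  rw [pow_add]
  nlinarith

theorem Nat_size_mul_le (a b : ℕ) : Nat.size (a * b) ≤ Nat.size a + Nat.size b := by
  rw [Nat.size_le, pow_add]
  exact Nat.mul_lt_mul'' (Nat.lt_size_self a) (Nat.lt_size_self b)

theorem Nat_size_le_self (n : ℕ) : Nat.size n ≤ n :=
  Nat.size_le.2 n.lt_two_pow_self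

theorem Nat_size_one : Nat.size 1 = 1 := by simp

/-- Cancelling only shortens a fraction, since the reduced numerator and denominator divide the
given ones. Lengths can thus be estimated on any convenient representation. -/
theorem Data.size_rat_le {q : ℚ} {n d : ℤ} (hd : d ≠ 0) (h : q = n / d) :
    (Data.rat q).size ≤ Nat.size n.natAbs + Nat.size d.natAbs + 1 := by
  rw [← Rat.divInt_eq_div] at h
  have h1 : q.num ∣ n := h ▸ Rat.num_dvd n hd
  have h2 : (q.den : ℤ) ∣ d := h ▸ Rat.den_dvd n d
  have h3 : Nat.size q.den ≤ Nat.size d.natAbs :=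
    Nat.size_le_size (Nat.le_of_dvd (Int.natAbs_pos.2 hd) (by simpa using Int.natAbs_dvd_natAbs.2 h2))
  have h4 : Nat.size q.num.natAbs ≤ Nat.size n.natAbs := by
    rcases eq_or_ne n 0 with rfl | hn
    · have : q = 0 := by rw [h]; simp
      simp [this]
    · exact Nat.size_le_size (Nat.le_of_dvd (Int.natAbs_pos.2 hn) (Int.natAbs_dvd_natAbs.2 h1))
  simp only [Data.size]
  omega

theorem Data.size_ofNat (n : ℕ) : (Data.ofNat n).size = Nat.size n + 2 := by
  simp [Data.ofNat, Data.size]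

theorem Data.size_ofNat_le (n : ℕ) : (Data.ofNat n).size ≤ n + 2 := by
  have := Nat_size_le_self n
  rw [Data.size_ofNat]; omega

/-- Both denominators occur twice, in the cross-multiplied numerator and in the common denominator;
hence the factor 2. -/
theorem size_add_le (a b : ℚ) :
    (Data.rat (a + b)).size ≤ 2 * ((Data.rat a).size + (Data.rat b).size) := by
  have h := Data.size_rat_le (q := a + b) (n := a.num * b.den + b.num * a.den) (d := a.den * b.den)
    (by simp) (by
      have := a.num_div_den; have := b.num_div_den
      push_cast
      have h1 : (a.den : ℚ) ≠ 0 := by simp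
      have h2 : (b.den : ℚ) ≠ 0 := by simp
      rw [add_div, mul_div_mul_right _ _ h2, mul_comm (a.den : ℚ), mul_div_mul_right _ _ h1]
      simp [Rat.num_div_den])
  refine h.trans ?_
  have h1 : Nat.size (a.num * b.den + b.num * a.den).natAbs ≤
      Nat.size a.num.natAbs + Nat.size b.den + (Nat.size b.num.natAbs + Nat.size a.den) := by
    refine (Nat.size_le_size (Int.natAbs_add_le _ _)).trans ((Nat_size_add_le _ _).trans ?_)
    rw [Int.natAbs_mul, Int.natAbs_mul]
    exact Nat.add_le_add (Nat_size_mul_le _ _) (Nat_size_mul_le _ _)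
  have h2 : Nat.size ((a.den * b.den : ℤ)).natAbs ≤ Nat.size a.den + Nat.size b.den := by
    rw [Int.natAbs_mul]
    exact Nat_size_mul_le _ _
  simp only [Data.size]
  omega

theorem size_neg (a : ℚ) : (Data.rat (-a)).size = (Data.rat a).size := by
  simp [Data.size]

theorem size_mul_le (a b : ℚ) :
    (Data.rat (a * b)).size ≤ (Data.rat a).size + (Data.rat b).size := by
  have h := Data.size_rat_le (q := a * b) (n := a.num * b.num) (d := a.den * b.den)
    (by simp) (by
      push_cast
      rw [mul_div_mul_comm]
      simp [Rat.num_div_den])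
  refine h.trans ?_
  rw [Int.natAbs_mul, Int.natAbs_mul]
  have h1 := Nat_size_mul_le a.num.natAbs b.num.natAbs
  have h2 := Nat_size_mul_le a.den b.den
  simp only [Data.size, Int.natAbs_natCast]
  omega

theorem size_inv (a : ℚ) : (Data.rat a⁻¹).size ≤ (Data.rat a).size + 1 := by
  rcases eq_or_ne a 0 with rfl | ha
  · simp
  have h := Data.size_rat_le (q := a⁻¹) (n := a.den) (d := a.num) (by simpa using ha) (by
      rw [← inv_div]; push_cast; rw [Rat.num_div_den])
  simp only [Data.size, Int.natAbs_natCast] at h ⊢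
  omega

theorem size_floor_le (a : ℚ) : (Data.rat (⌊a⌋ : ℤ)).size ≤ (Data.rat a).size + 1 := by
  have h : (⌊a⌋).natAbs ≤ a.num.natAbs := by
    rw [show ⌊a⌋ = a.num / a.den from Rat.floor_def']
    exact Int.natAbs_ediv_le_natAbs _ _
  have := Nat.size_le_size h
  simp only [Data.size, Rat.num_intCast, Rat.den_intCast, Nat_size_one]
  omega

/-- The output of a basic instruction is at most linearly longer than its input. -/
theorem Instr.size_eval_le (i : Instr) : ∃ C, ∀ x, (i.eval x).size ≤ C * x.size := by
  have arith (op : ℚ → ℚ → ℚ)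
      (h : ∀ a b, (Data.rat (op a b)).size ≤ 4 * ((Data.rat a).size + (Data.rat b).size)) :
      ∀ x : Data, (x.arith op).size ≤ 4 * x.size := by
    intro x
    have h0 : (Data.rat 0).size ≤ 4 * x.size := by
      have := x.size_pos
      simp [Data.size]; omega
    rcases x with q | ⟨a | _, b | _⟩
    · exact h0
    · exact (h _ _).trans (by simp only [Data.size]; omega)
    all_goals exact h0
  have rat0 : (Data.rat 0).size = 2 := by simp [Data.size]
  have rat1 : (Data.rat 1).size = 3 := by simp [Data.size]
  cases i with
  | id => exact ⟨1, fun x => by simp [Instr.eval]⟩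
  | const d => exact ⟨d.size, fun x => Nat.le_mul_of_pos_right _ x.size_pos⟩
  | fst =>
    refine ⟨2, fun x => ?_⟩
    have := x.size_pos
    rcases x with q | ⟨a, b⟩ <;> simp only [Instr.eval, rat0] <;> simp only [Data.size] at * <;> omega
  | snd =>
    refine ⟨2, fun x => ?_⟩
    have := x.size_pos
    rcases x with q | ⟨a, b⟩ <;> simp only [Instr.eval, rat0] <;> simp only [Data.size] at * <;> omega
  | isPair =>
    refine ⟨3, fun x => ?_⟩
    have := x.size_pos
    rcases x with q | ⟨a, b⟩ <;> simp only [Instr.eval, rat0, rat1] <;> omega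
  | add => exact ⟨4, arith _ fun a b => (size_add_le a b).trans (by omega)⟩
  | sub =>
    refine ⟨4, arith _ fun a b => ?_⟩
    rw [sub_eq_add_neg]
    refine (size_add_le _ _).trans ?_
    rw [size_neg]; omega
  | mul => exact ⟨4, arith _ fun a b => (size_mul_le a b).trans (by omega)⟩
  | div =>
    refine ⟨4, arith _ fun a b => ?_⟩
    rw [div_eq_mul_inv]
    refine (size_mul_le _ _).trans ?_
    have := size_inv b
    have := (Data.rat b).size_pos
    omega
  | le =>
    refine ⟨4, arith _ fun a b => ?_⟩
    have := (Data.rat b).size_pos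
    have := (Data.rat a).size_pos
    split_ifs <;> simp only [rat0, rat1] <;> omega
  | floor =>
    refine ⟨2, fun x => ?_⟩
    rcases x with q | ⟨a, b⟩
    · have := (Data.rat q).size_pos
      exact (size_floor_le q).trans (by omega)
    · simp only [Instr.eval, rat0, Data.size]; omega

/-! ### Evaluation rules for basic instructions -/

section

variable (x y d : Data) (q a b : ℚ)

@[simp] theorem Instr.eval_id : Instr.id.eval x = x := rfl
@[simp] theorem Instr.eval_const : (Instr.const d).eval x = d := rfl
@[simp] theorem Instr.eval_fst_pair : Instr.fst.eval (.pair x y) = x := rfl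
@[simp] theorem Instr.eval_snd_pair : Instr.snd.eval (.pair x y) = y := rfl
@[simp] theorem Instr.eval_fst_rat : Instr.fst.eval (.rat q) = .rat 0 := rfl
@[simp] theorem Instr.eval_snd_rat : Instr.snd.eval (.rat q) = .rat 0 := rfl
@[simp] theorem Instr.eval_isPair_pair : Instr.isPair.eval (.pair x y) = .rat 1 := rfl
@[simp] theorem Instr.eval_isPair_rat : Instr.isPair.eval (.rat q) = .rat 0 := rfl
@[simp] theorem Instr.eval_add : Instr.add.eval (.pair (.rat a) (.rat b)) = .rat (a + b) := rfl
@[simp] theorem Instr.eval_sub : Instr.sub.eval (.pair (.rat a) (.rat b)) = .rat (a - b) := rfl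
@[simp] theorem Instr.eval_mul : Instr.mul.eval (.pair (.rat a) (.rat b)) = .rat (a * b) := rfl
@[simp] theorem Instr.eval_div : Instr.div.eval (.pair (.rat a) (.rat b)) = .rat (a / b) := rfl
@[simp] theorem Instr.eval_le :
    Instr.le.eval (.pair (.rat a) (.rat b)) = .rat (if a ≤ b then 1 else 0) := rfl

end

/-! ### Loop-free programs -/

/-- Programs without loops and oracle calls. -/
def Prog.Straight : Prog → Prop
  | .basic _ => True
  | .seq p q => p.Straight ∧ q.Straight
  | .both p q => p.Straight ∧ q.Straight
  | .ite c p q => c.Straight ∧ p.Straight ∧ q.Straight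
  | .while _ _ => False
  | .query => False

open Classical in
/-- The result of a loop-free program. -/
noncomputable def Prog.eval : Prog → Data → Data
  | .basic i, x => i.eval x
  | .seq p q, x => q.eval (p.eval x)
  | .both p q, x => .pair (p.eval x) (q.eval x)
  | .ite c p q, x => if c.eval x = .rat 0 then q.eval x else p.eval x
  | .while _ _, x => x
  | .query, x => x

attribute [simp] Prog.Straight Prog.eval

/-- Without loops the number of instructions is fixed, and each lengthens its argument by at most a
constant factor. Hence time and output length are linear, with a constant that depends only on the
program and not on the oracle. This reduces the analysis of a loop-free program to computing
`Prog.eval`. -/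
theorem Prog.Straight.run {p : Prog} (hp : p.Straight) :
    ∃ C, ∀ O x, (p.eval x).size ≤ C * x.size ∧ ∃ t ≤ C * x.size, Run O p x (p.eval x) t := by
  induction p with
  | basic i =>
    obtain ⟨C, hC⟩ := i.size_eval_le
    refine ⟨C + 2, fun O x => ?_⟩
    have h1 := hC x
    have h2 := x.size_pos
    refine ⟨?_, _, ?_, Run.basic i x⟩
    · simp only [Prog.eval]; nlinarith
    · nlinarith
  | seq p q ihp ihq =>
    obtain ⟨C, hC⟩ := ihp hp.1
    obtain ⟨D, hD⟩ := ihq hp.2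
    refine ⟨C + D * C + 1, fun O x => ?_⟩
    obtain ⟨h1, s, hs, r1⟩ := hC O x
    obtain ⟨h2, t, ht, r2⟩ := hD O (p.eval x)
    have h3 := x.size_pos
    have h4 := Nat.mul_le_mul_left D h1
    refine ⟨?_, _, ?_, Run.seq r1 r2⟩
    · simp only [Prog.eval]; nlinarith
    · nlinarith
  | both p q ihp ihq =>
    obtain ⟨C, hC⟩ := ihp hp.1
    obtain ⟨D, hD⟩ := ihq hp.2
    refine ⟨C + D + 1, fun O x => ?_⟩
    obtain ⟨h1, s, hs, r1⟩ := hC O x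
    obtain ⟨h2, t, ht, r2⟩ := hD O x
    have h3 := x.size_pos
    refine ⟨?_, _, ?_, Run.both r1 r2⟩
    · simp only [Prog.eval, Data.size]; nlinarith
    · nlinarith
  | ite c p q ihc ihp ihq =>
    obtain ⟨B, hB⟩ := ihc hp.1
    obtain ⟨C, hC⟩ := ihp hp.2.1
    obtain ⟨D, hD⟩ := ihq hp.2.2
    refine ⟨B + C + D + 1, fun O x => ?_⟩
    obtain ⟨h0, u, hu, r0⟩ := hB O x
    obtain ⟨h1, s, hs, r1⟩ := hC O x
    obtain ⟨h2, t, ht, r2⟩ := hD O x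
    have h3 := x.size_pos
    by_cases h : c.eval x = .rat 0
    · simp only [Prog.eval, h, if_true]
      rw [h] at r0
      exact ⟨by nlinarith, _, by nlinarith, Run.iteFalse r0 r2⟩
    · simp only [Prog.eval, h, if_false]
      exact ⟨by nlinarith, _, by nlinarith, Run.iteTrue r0 h r1⟩
  | _ => exact hp.elim

/-- A run pays for the data it reads and writes, so a time bound is also a length bound. This is how
the lengths of intermediate results are controlled throughout. -/
theorem Run.size_le {O : Data → Data → Prop} {p : Prog} {x y : Data} {t : ℕ} (h : Run O p x y t) :
    x.size ≤ t ∧ y.size ≤ t := by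
  induction h <;> (try simp only [Data.size] at *) <;> omega

/-! ### Polynomial bounds -/

/-- `f` is polynomially bounded in terms of `m`. -/
def PB {ι : Type*} (m f : ι → ℕ) : Prop := ∃ C, ∀ i, f i ≤ (m i + 2) ^ C

namespace PB

variable {ι κ : Type*} {m f g : ι → ℕ}

theorem mono (hg : PB m g) (h : ∀ i, f i ≤ g i) : PB m f :=
  hg.imp fun _ hC i => (h i).trans (hC i)

theorem self : PB m m := ⟨1, fun i => by simp⟩

/-- The base `m i + 2` is at least 2, so constants and constant factors are absorbed by the
exponent, even where `m` vanishes. -/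
theorem const (c : ℕ) : PB m fun _ => c :=
  ⟨c, fun i => c.lt_two_pow_self.le.trans (Nat.pow_le_pow_left (by omega) _)⟩

theorem add (hf : PB m f) (hg : PB m g) : PB m fun i => f i + g i := by
  obtain ⟨C, hC⟩ := hf
  obtain ⟨D, hD⟩ := hg
  refine ⟨C + D + 1, fun i => ?_⟩
  have h1 : (m i + 2) ^ C ≤ (m i + 2) ^ (C + D) := Nat.pow_le_pow_right (by omega) (by omega)
  have h2 : (m i + 2) ^ D ≤ (m i + 2) ^ (C + D) := Nat.pow_le_pow_right (by omega) (by omega)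
  have := hC i
  have := hD i
  rw [pow_succ]
  nlinarith

theorem mul (hf : PB m f) (hg : PB m g) : PB m fun i => f i * g i := by
  obtain ⟨C, hC⟩ := hf
  obtain ⟨D, hD⟩ := hg
  exact ⟨C + D, fun i => by rw [pow_add]; exact Nat.mul_le_mul (hC i) (hD i)⟩

theorem const_mul (c : ℕ) (hf : PB m f) : PB m fun i => c * f i := (const c).mul hf

theorem pow (hf : PB m f) (c : ℕ) : PB m fun i => f i ^ c := by
  obtain ⟨C, hC⟩ := hf
  exact ⟨C * c, fun i => by rw [pow_mul]; exact Nat.pow_le_pow_left (hC i) _⟩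

theorem trans (hf : PB g f) (hg : PB m g) : PB m f := by
  obtain ⟨C, hC⟩ := hf
  exact ((hg.add (const 2)).pow C).mono hC

theorem comp (e : κ → ι) (hf : PB m f) : PB (fun k => m (e k)) (fun k => f (e k)) :=
  hf.imp fun _ hC k => hC (e k)

/-- Change of index set: bounds for the states of a loop, indexed by an instance together with a
position in the loop, come from bounds for the instances. -/
theorem comp_le {m' g' : κ → ℕ} (hf : PB m f) (e : κ → ι) (h : ∀ k, g' k ≤ f (e k))
    (hm : ∀ k, m (e k) ≤ m' k := by exact fun _ => le_rfl) : PB m' g' := by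
  obtain ⟨C, hC⟩ := hf
  exact ⟨C, fun k => (h k).trans ((hC _).trans (Nat.pow_le_pow_left (by have := hm k; omega) _))⟩

end PB

/-! ### Polynomial time -/

/-- The program `p` transforms the data `a i` into `b i`, with oracle `O i`, in time polynomial in
`m i`. -/
def PT {ι : Type*} (m : ι → ℕ) (O : ι → Data → Data → Prop) (p : Prog) (a b : ι → Data) : Prop :=
  ∃ C, ∀ i, ∃ t ≤ (m i + 2) ^ C, Run (O i) p (a i) (b i) t

namespace PT

variable {ι κ : Type*} {m : ι → ℕ} {O : ι → Data → Data → Prop} {p q c : Prog} {a b d : ι → Data}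

theorem of_le {T : ι → ℕ} (hT : PB m T) (h : ∀ i, ∃ t ≤ T i, Run (O i) p (a i) (b i) t) :
    PT m O p a b := by
  obtain ⟨C, hC⟩ := hT
  exact ⟨C, fun i => let ⟨t, ht, hr⟩ := h i; ⟨t, ht.trans (hC i), hr⟩⟩

theorem exists_time (h : PT m O p a b) :
    ∃ T : ι → ℕ, PB m T ∧ ∀ i, ∃ t ≤ T i, Run (O i) p (a i) (b i) t := by
  obtain ⟨C, hC⟩ := h
  exact ⟨_, ⟨C, fun i => le_rfl⟩, hC⟩

theorem size_in (h : PT m O p a b) : PB m fun i => (a i).size := by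
  obtain ⟨C, hC⟩ := h
  exact ⟨C, fun i => let ⟨_, ht, hr⟩ := hC i; hr.size_le.1.trans ht⟩

theorem size_out (h : PT m O p a b) : PB m fun i => (b i).size := by
  obtain ⟨C, hC⟩ := h
  exact ⟨C, fun i => let ⟨_, ht, hr⟩ := hC i; hr.size_le.2.trans ht⟩

theorem congr {a' b' : ι → Data} (h : PT m O p a b) (ha : ∀ i, a' i = a i) (hb : ∀ i, b' i = b i) :
    PT m O p a' b' := by
  rw [funext ha, funext hb]; exact h

theorem comp (e : κ → ι) (h : PT m O p a b) :
    PT (fun k => m (e k)) (fun k => O (e k)) p (fun k => a (e k)) (fun k => b (e k)) :=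
  h.imp fun _ hC k => hC (e k)

theorem measure {m' : ι → ℕ} (h : PT m O p a b) (hm : PB m' m) : PT m' O p a b := by
  obtain ⟨T, hT, h⟩ := h.exists_time
  exact of_le (hT.trans hm) h

theorem straight (hp : p.Straight) (ha : PB m fun i => (a i).size) (hb : ∀ i, b i = p.eval (a i)) :
    PT m O p a b := by
  obtain ⟨C, hC⟩ := hp.run
  refine of_le ((PB.const C).mul ha) fun i => ?_
  rw [hb]
  exact (hC (O i) (a i)).2

theorem seq (hp : PT m O p a b) (hq : PT m O q b d) : PT m O (.seq p q) a d := by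
  obtain ⟨S, hS, hp⟩ := hp.exists_time
  obtain ⟨T, hT, hq⟩ := hq.exists_time
  refine of_le ((hS.add hT).add (PB.const 1)) fun i => ?_
  obtain ⟨s, hs, r1⟩ := hp i
  obtain ⟨t, ht, r2⟩ := hq i
  exact ⟨_, by omega, r1.seq r2⟩

theorem both (hp : PT m O p a b) (hq : PT m O q a d) :
    PT m O (.both p q) a (fun i => .pair (b i) (d i)) := by
  obtain ⟨S, hS, hp⟩ := hp.exists_time
  obtain ⟨T, hT, hq⟩ := hq.exists_time
  refine of_le ((hS.add hT).add (PB.const 1)) fun i => ?_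
  obtain ⟨s, hs, r1⟩ := hp i
  obtain ⟨t, ht, r2⟩ := hq i
  exact ⟨_, by omega, r1.both r2⟩

theorem query (ha : PB m fun i => (a i).size) (hb : PB m fun i => (b i).size)
    (h : ∀ i, O i (a i) (b i)) : PT m O .query a b :=
  of_le ((ha.add hb).add (PB.const 1)) fun i => ⟨_, le_rfl, .query (h i)⟩

end PT

/-! ### Running times of loops -/

theorem Run.while_of_le {O : Data → Data → Prop} {c p : Prog} {st cb : ℕ → Data} {T U : ℕ} :
    ∀ N : ℕ, (∀ k ≤ N, ∃ t ≤ T, Run O c (st k) (cb k) t) →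
      (∀ k < N, ∃ t ≤ U, Run O p (st k) (st (k + 1)) t) → (∀ k < N, cb k ≠ .rat 0) →
      cb N = .rat 0 → ∃ t ≤ (N + 1) * (T + U + 1), Run O (.while c p) (st 0) (st N) t := by
  intro N
  induction N generalizing st cb with
  | zero =>
    intro hc _ _ h0
    obtain ⟨t, ht, r⟩ := hc 0 le_rfl
    rw [h0] at r
    exact ⟨_, by omega, .whileStop r⟩
  | succ N ih =>
    intro hc hp h1 h0
    obtain ⟨t, ht, r⟩ := hc 0 (by omega)
    obtain ⟨u, hu, r'⟩ := hp 0 (by omega)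
    obtain ⟨v, hv, r''⟩ := ih (st := fun k => st (k + 1)) (cb := fun k => cb (k + 1))
      (fun k hk => hc _ (by omega)) (fun k hk => hp _ (by omega)) (fun k hk => h1 _ (by omega)) h0
    refine ⟨_, ?_, .whileStep r (h1 0 (by omega)) r' r''⟩
    calc t + u + v + 1 ≤ T + U + (N + 1) * (T + U + 1) + 1 := by omega
      _ = (N + 1 + 1) * (T + U + 1) := by ring

namespace PT

variable {ι κ : Type*} {m : ι → ℕ} {O : ι → Data → Data → Prop} {p q c : Prog} {a b d : ι → Data}

/-- Test and body must be polynomial uniformly over all pairs of an instance and a round, measured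
by the instance and not by the current state. This rules out lengths that compound from round to
round. -/
theorem loop (st cb : ι → ℕ → Data) {N : ι → ℕ} (hN : PB m N)
    (hc : PT (fun x : {x : ι × ℕ // x.2 ≤ N x.1} => m x.1.1) (fun x => O x.1.1) c
      (fun x => st x.1.1 x.1.2) (fun x => cb x.1.1 x.1.2))
    (hp : PT (fun x : {x : ι × ℕ // x.2 < N x.1} => m x.1.1) (fun x => O x.1.1) p
      (fun x => st x.1.1 x.1.2) (fun x => st x.1.1 (x.1.2 + 1)))
    (h1 : ∀ i, ∀ k < N i, cb i k ≠ .rat 0) (h0 : ∀ i, cb i (N i) = .rat 0) :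
    PT m O (.while c p) (fun i => st i 0) (fun i => st i (N i)) := by
  obtain ⟨C, hC⟩ := hc
  obtain ⟨D, hD⟩ := hp
  have hT : PB m fun i => (m i + 2) ^ C := ⟨C, fun i => le_rfl⟩
  have hU : PB m fun i => (m i + 2) ^ D := ⟨D, fun i => le_rfl⟩
  refine of_le ((hN.add (PB.const 1)).mul ((hT.add hU).add (PB.const 1))) fun i => ?_
  exact Run.while_of_le (N i) (fun k hk => hC ⟨(i, k), hk⟩) (fun k hk => hD ⟨(i, k), hk⟩) (h1 i)
    (h0 i)

end PT

end HyperMotif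

namespace HyperMotif

/-! ### Basic list programs -/

abbrev Prog.self : Prog := .basic .id
abbrev Prog.hd : Prog := .basic .fst
abbrev Prog.tl : Prog := .basic .snd
abbrev Prog.lit (d : Data) : Prog := .basic (.const d)

/-- On input `(e, (b, l))`, fold `p` over the list `l`, starting with `b`; the program `p` is
applied to `(e, (b, a))`. -/
def Prog.fold (p : Prog) : Prog :=
  (Prog.while (tl.seq (tl.seq (.basic .isPair)))
    (hd.both (((hd.both ((tl.seq hd).both (tl.seq (tl.seq hd)))).seq p).both
      (tl.seq (tl.seq tl))))).seq (tl.seq hd)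

/-- On input `(a, b)`, the reversal of the list `a` followed by the list `b`. -/
def Prog.revAppend : Prog :=
  ((lit (.rat 0)).both (tl.both hd)).seq (fold ((tl.seq tl).both (tl.seq hd)))

/-- On input `(e, l)`, concatenate the lists that `p` computes from `(e, a)` for `a` in `l`. -/
def Prog.flatMap (p : Prog) : Prog :=
  ((hd.both ((lit (.rat 0)).both tl)).seq
    (fold ((((hd.both (tl.seq tl)).seq p).both (tl.seq hd)).seq revAppend))).seq
      ((self.both (lit (.rat 0))).seq revAppend)

/-- On input `(e, l)`, the list of the data that `p` computes from `(e, a)` for `a` in `l`. -/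
def Prog.map (p : Prog) : Prog :=
  flatMap (p.both (lit (.rat 0)))

/-- On input `(u, l)`, drop from `l` as many entries as the list `u` has. -/
def Prog.drop : Prog :=
  (Prog.while (hd.seq (.basic .isPair)) ((hd.seq tl).both (tl.seq tl))).seq tl

theorem Data.size_ofList (l : List Data) :
    (Data.ofList l).size = (l.map fun x => x.size + 1).sum + 2 := by
  induction l with
  | nil => simp [Data.ofList, Data.size]
  | cons a l ih => simp only [Data.ofList, Data.size, ih, List.map_cons, List.sum_cons]; omega

@[simp] theorem Data.ofList_nil : Data.ofList [] = .rat 0 := rfl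
@[simp] theorem Data.ofList_cons (a : Data) (l : List Data) :
    Data.ofList (a :: l) = .pair a (.ofList l) := rfl

@[simp] theorem Instr.eval_isPair_ofList (l : List Data) :
    Instr.isPair.eval (.ofList l) = .rat (if 0 < l.length then 1 else 0) := by
  cases l <;> simp

@[simp] theorem Instr.eval_snd_ofList (l : List Data) :
    Instr.snd.eval (.ofList l) = .ofList l.tail := by
  cases l <;> simp

@[simp] theorem Data.size_rat_zero : (Data.rat 0).size = 2 := by simp [Data.size]

theorem Data.length_le_size_ofList (l : List Data) : l.length ≤ (Data.ofList l).size := by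
  induction l with
  | nil => simp
  | cons a l ih => simp only [Data.ofList, Data.size, List.length_cons]; omega

theorem Data.size_le_size_ofList {l : List Data} {x : Data} (h : x ∈ l) :
    x.size ≤ (Data.ofList l).size := by
  rw [Data.size_ofList]
  have := List.single_le_sum (l := l.map fun x => x.size + 1) (by simp) _ (List.mem_map_of_mem h)
  omega

theorem Data.size_ofList_sublist {l l' : List Data} (h : l.Sublist l') :
    (Data.ofList l).size ≤ (Data.ofList l').size := by
  rw [Data.size_ofList, Data.size_ofList]
  have := (h.map fun x => x.size + 1).sum_le_sum (by simp)
  omega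

theorem Data.size_ofList_append (l l' : List Data) :
    (Data.ofList (l ++ l')).size ≤ (Data.ofList l).size + (Data.ofList l').size := by
  simp only [Data.size_ofList, List.map_append, List.sum_append]
  omega

theorem Data.size_ofList_reverse (l : List Data) :
    (Data.ofList l.reverse).size = (Data.ofList l).size := by
  simp [Data.size_ofList]

theorem Data.size_ofList_le {l : List Data} {B : ℕ} (h : ∀ x ∈ l, x.size ≤ B) :
    (Data.ofList l).size ≤ l.length * (B + 1) + 2 := by
  rw [Data.size_ofList]
  have := List.sum_le_card_nsmul (l.map fun x => x.size + 1) (B + 1) (by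
    simpa using h)
  simpa using this

/-! ### Running times of the list programs -/

namespace PT

variable {ι κ α β : Type*} {m : ι → ℕ} {O : ι → Data → Data → Prop} {p q c : Prog}
  {a b d : ι → Data}

/-- The step is only required to be polynomial on accumulators that occur: the index `(i, u, a)`
stands for the moment when the prefix `u` of `l i` has been folded and `a` comes next. -/
theorem fold {env : ι → Data} {l : ι → List α} {ea : α → Data} {eb : β → Data}
    {step : ι → β → α → β} {b₀ : ι → β} (henv : PB m fun i => (env i).size)
    (hl : PB m fun i => (Data.ofList ((l i).map ea)).size) (h₀ : PB m fun i => (eb (b₀ i)).size)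
    (hp : PT (fun x : {x : ι × List α × α // x.2.1 ++ [x.2.2] <+: l x.1} => m x.1.1)
      (fun x => O x.1.1) p
      (fun x => .pair (env x.1.1)
        (.pair (eb (x.1.2.1.foldl (step x.1.1) (b₀ x.1.1))) (ea x.1.2.2)))
      (fun x => eb (step x.1.1 (x.1.2.1.foldl (step x.1.1) (b₀ x.1.1)) x.1.2.2))) :
    PT m O (.fold p) (fun i => .pair (env i) (.pair (eb (b₀ i)) (.ofList ((l i).map ea))))
      (fun i => eb ((l i).foldl (step i) (b₀ i))) := by
  let st : ι → ℕ → Data := fun i k => .pair (env i)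
    (.pair (eb (((l i).take k).foldl (step i) (b₀ i))) (.ofList (((l i).drop k).map ea)))
  have hst : PB (fun x : ι × ℕ => m x.1) fun x => (st x.1 x.2).size := by
    obtain ⟨C, hC⟩ := hp.size_out
    -- Every accumulator but the first is the output of a step, so its length is bounded by the time
    -- of that step.
    have hacc : PB (fun x : ι × ℕ => m x.1) fun x =>
        (eb (((l x.1).take x.2).foldl (step x.1) (b₀ x.1))).size := by
      refine ((h₀.add ⟨C, fun i => le_rfl⟩).comp Prod.fst).mono ?_
      rintro ⟨i, k⟩
      rcases Nat.lt_or_ge 0 (min k (l i).length) with h | h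
      · obtain ⟨k', hk'⟩ : ∃ k', min k (l i).length = k' + 1 := ⟨_, (Nat.succ_pred_eq_of_pos h).symm⟩
        have hk : k' < (l i).length := by omega
        have h1 : (l i).take k = (l i).take k' ++ [(l i)[k']] := by
          rw [List.take_append_getElem, ← hk', List.take_eq_take_iff]; simp
        have := hC ⟨(i, (l i).take k', (l i)[k']), by
          rw [List.take_append_getElem]; exact List.take_prefix _ _⟩
        simp only [h1, List.foldl_append, List.foldl_cons, List.foldl_nil] at this ⊢
        exact this.trans (Nat.le_add_left _ _)
      · have : (l i).take k = [] := by
          rw [List.take_eq_nil_iff]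
          rcases Nat.eq_zero_or_pos k with h' | h'
          · exact .inl h'
          · exact .inr (List.eq_nil_of_length_eq_zero (by omega))
        simp only [this, List.foldl_nil]
        omega
    refine ((((henv.comp Prod.fst).add (hacc.add (hl.comp Prod.fst))).add (PB.const 2))).mono ?_
    rintro ⟨i, k⟩
    have := Data.size_ofList_sublist (((l i).drop_sublist k).map ea)
    simp only [st, Data.size]
    omega
  have hN : PB m fun i => (l i).length := hl.mono fun i => by
    simpa using Data.length_le_size_ofList ((l i).map ea)
  have key := PT.loop (m := m) (O := O) (N := fun i => (l i).length)
    (c := Prog.tl.seq (Prog.tl.seq (.basic .isPair)))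
    (p := Prog.hd.both (((Prog.hd.both ((Prog.tl.seq .hd).both
      (Prog.tl.seq (Prog.tl.seq .hd)))).seq p).both (Prog.tl.seq (Prog.tl.seq .tl)))) st
    (fun i k => .rat (if k < (l i).length then 1 else 0)) hN ?_ ?_ ?_ ?_
  · refine seq (key.congr (fun i => ?_) (fun i => rfl)) ?_
    · simp [st]
    · refine straight (by simp)
        (hst.comp_le (fun i => (i, (l i).length)) fun i => le_rfl) fun i => ?_
      simp [st, Prog.eval]
  · refine straight (by simp) (hst.comp_le (fun x => x.1) fun i => le_rfl) ?_
    rintro ⟨⟨i, k⟩, hk⟩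
    simp [st, -List.map_drop]
  · have hsz := (hst.comp fun x : {x : ι × ℕ // x.2 < (l x.1).length} => x.1)
    have hp' := hp.comp fun x : {x : ι × ℕ // x.2 < (l x.1).length} =>
      ⟨(x.1.1, (l x.1.1).take x.1.2, (l x.1.1)[x.1.2]'x.2), by
        rw [List.take_append_getElem]; exact List.take_prefix _ _⟩
    refine congr (both (straight (b := fun x => env x.1.1) trivial hsz fun _ => rfl)
      (both (seq (straight (by simp) hsz ?_) hp')
        (straight (b := fun x => .ofList (((l x.1.1).drop (x.1.2 + 1)).map ea))
          (by simp) hsz ?_))) (fun _ => rfl) ?_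
    · rintro ⟨⟨i, k⟩, hk⟩
      simp only [Prog.eval, st]
      rw [List.drop_eq_getElem_cons hk]; rfl
    · rintro ⟨⟨i, k⟩, hk⟩
      simp only [Prog.eval, st]
      rw [List.drop_eq_getElem_cons hk]; rfl
    · rintro ⟨⟨i, k⟩, hk⟩
      simp only [st]
      rw [← List.take_append_getElem (show k < (l i).length from hk), List.foldl_append]; rfl
  · intro i k hk
    simp [hk]
  · intro i
    simp

theorem revAppend {u v : ι → List Data} (hu : PB m fun i => (Data.ofList (u i)).size)
    (hv : PB m fun i => (Data.ofList (v i)).size) :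
    PT m O .revAppend (fun i => .pair (.ofList (u i)) (.ofList (v i)))
      (fun i => .ofList ((u i).reverse ++ v i)) := by
  have foldl_eq (u v : List Data) : u.foldl (fun b a => a :: b) v = u.reverse ++ v := by
    induction u generalizing v with
    | nil => rfl
    | cons a u ih => simp [ih]
  refine seq (b := fun i => .pair (.rat 0) (.pair (.ofList (v i)) (.ofList (u i))))
    (straight (by simp)
      (((hu.add hv).add (PB.const 1)).mono fun i => by simp [Data.size]) fun i => by
        simp ) ?_
  refine congr (fold (env := fun _ => .rat 0) (l := u) (ea := id) (eb := Data.ofList)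
    (step := fun _ b a => a :: b) (b₀ := v) (PB.const _) (by simpa using hu) hv ?_)
    (fun i => by simp) (fun i => by simp [foldl_eq])
  refine straight (by simp) ?_ ?_
  · refine (((hu.add hv).add (PB.const 10)).add hu).comp_le (fun x => x.1.1) ?_
    rintro ⟨⟨i, w, a⟩, h⟩
    simp only [foldl_eq, Data.size, id]
    have h1 := Data.size_ofList_append w.reverse (v i)
    have h2 := Data.size_ofList_sublist ((List.sublist_append_left w [a]).trans h.sublist)
    have h3 : a.size ≤ _ := Data.size_le_size_ofList (h.sublist.subset (by simp : a ∈ w ++ [a]))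
    rw [Data.size_ofList_reverse] at h1
    have : (0 : ℚ).num.natAbs.size + (0 : ℚ).den.size = 1 := by simp
    simp only at h1 h2 h3
    omega
  · rintro ⟨⟨i, w, a⟩, h⟩
    simp [Prog.eval, Data.ofList]

/-- Each piece is prepended in reversed order, so the accumulator is the reversal of the
concatenation so far; one reversal at the end repairs the order. -/
theorem flatMap {env : ι → Data} {l : ι → List α} {ea : α → Data} {F : ι → α → List Data}
    (henv : PB m fun i => (env i).size) (hl : PB m fun i => (Data.ofList ((l i).map ea)).size)
    (hp : PT (fun x : {x : ι × α // x.2 ∈ l x.1} => m x.1.1) (fun x => O x.1.1) p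
      (fun x => .pair (env x.1.1) (ea x.1.2)) (fun x => .ofList (F x.1.1 x.1.2))) :
    PT m O (.flatMap p) (fun i => .pair (env i) (.ofList ((l i).map ea)))
      (fun i => .ofList ((l i).flatMap (F i))) := by
  have foldl_eq (i : ι) (u : List α) : u.foldl (fun b a => (F i a).reverse ++ b) [] =
      (u.flatMap (F i)).reverse := by
    induction u using List.reverseRecOn with
    | nil => rfl
    | append_singleton u a ih => simp [ih]
  have hlen : PB m fun i => (l i).length := hl.mono fun i => by
    simpa using Data.length_le_size_ofList ((l i).map ea)
  obtain ⟨C, hC⟩ := hp.size_out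
  have hF : PB (fun x : {x : ι × List α // x.2 <+: l x.1} => m x.1.1) fun x =>
      (Data.ofList ((x.1.2.flatMap (F x.1.1)))).size := by
    refine ((hlen.mul ⟨C, fun i => le_rfl⟩).add (PB.const 2)).comp_le (fun x => x.1.1) ?_
    rintro ⟨⟨i, u⟩, hu⟩
    have h1 : (Data.ofList (u.flatMap (F i))).size ≤ u.length * (m i + 2) ^ C + 2 := by
      have : ∀ u : List α, u ⊆ l i →
          (Data.ofList (u.flatMap (F i))).size ≤ u.length * (m i + 2) ^ C + 2 := by
        intro u hu
        induction u with
        | nil => simp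
        | cons a u ih =>
          have h2 := hC ⟨(i, a), hu List.mem_cons_self⟩
          have h3 := ih fun x hx => hu (List.mem_cons_of_mem _ hx)
          simp only [Data.size_ofList, List.flatMap_cons, List.map_append, List.sum_append,
            List.length_cons, add_mul] at *
          omega
      exact this u hu.subset
    have h2 := hu.length_le
    exact h1.trans (Nat.add_le_add_right (Nat.mul_le_mul_right _ h2) _)
  refine seq (b := fun i => .ofList (((l i).flatMap (F i)).reverse)) (seq
    (b := fun i => .pair (env i) (.pair (.rat 0) (.ofList ((l i).map ea))))
    (straight (by simp)
      (((henv.add hl).add (PB.const 1)).mono fun i => by simp [Data.size]) fun i => by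
        simp ) ?_)
    (seq (b := fun i => .pair (.ofList (((l i).flatMap (F i)).reverse)) (.ofList []))
      (straight (by simp) ?_ fun i => by
        simp [Prog.eval, Data.ofList]) ?_)
  · refine congr (fold (env := env) (l := l) (ea := ea) (eb := Data.ofList)
      (step := fun i b a => (F i a).reverse ++ b) (b₀ := fun _ => []) henv hl (PB.const _) ?_)
      (fun i => by simp [Data.ofList]) (fun i => by simp [foldl_eq])
    have h1 := hF.comp (κ := {x : ι × List α × α // x.2.1 ++ [x.2.2] <+: l x.1})
      fun x => ⟨(x.1.1, x.1.2.1), (List.prefix_append _ _).trans x.2⟩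
    have h2 := hp.comp (κ := {x : ι × List α × α // x.2.1 ++ [x.2.2] <+: l x.1})
      fun x => ⟨(x.1.1, x.1.2.2), x.2.subset (by simp)⟩
    have h3 : PB (fun x : {x : ι × List α × α // x.2.1 ++ [x.2.2] <+: l x.1} => m x.1.1) fun x =>
        (Data.pair (env x.1.1) (.pair (.ofList
          (x.1.2.1.foldl (fun b a => (F x.1.1 a).reverse ++ b) [])) (ea x.1.2.2))).size := by
      refine ((((henv.add hl).comp_le (fun x => x.1.1) fun _ => le_rfl).add h1).add (PB.const 2)).mono ?_
      rintro ⟨⟨i, u, a⟩, h⟩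
      have h3 : (ea a).size ≤ _ := Data.size_le_size_ofList
        (List.mem_map_of_mem (f := ea) (h.subset (by simp : a ∈ u ++ [a])))
      simp only [foldl_eq, Data.size, Data.size_ofList_reverse] at *
      omega
    refine seq (both (seq (straight (by simp) h3 ?_) h2)
      (straight (b := fun x => .ofList
          (x.1.2.1.foldl (fun b a => (F x.1.1 a).reverse ++ b) []))
        (by simp) h3 ?_)) (revAppend h2.size_out ?_)
    · intro x; simp 
    · intro x; simp 
    · refine h1.mono fun x => ?_
      rw [foldl_eq, Data.size_ofList_reverse]
  · refine hF.comp_le (fun i => ⟨(i, l i), List.prefix_rfl⟩) fun i => ?_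
    rw [Data.size_ofList_reverse]
  · refine congr (revAppend ?_ (PB.const _)) (fun i => rfl) (fun i => by simp)
    refine hF.comp_le (fun i => ⟨(i, l i), List.prefix_rfl⟩) fun i => ?_
    rw [Data.size_ofList_reverse]

theorem map {env : ι → Data} {l : ι → List α} {ea : α → Data} {F : ι → α → Data}
    (henv : PB m fun i => (env i).size) (hl : PB m fun i => (Data.ofList ((l i).map ea)).size)
    (hp : PT (fun x : {x : ι × α // x.2 ∈ l x.1} => m x.1.1) (fun x => O x.1.1) p
      (fun x => .pair (env x.1.1) (ea x.1.2)) (fun x => F x.1.1 x.1.2)) :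
    PT m O (.map p) (fun i => .pair (env i) (.ofList ((l i).map ea)))
      (fun i => .ofList ((l i).map (F i))) := by
  refine congr (flatMap (F := fun i a => [F i a]) henv hl
    (both hp (straight (b := fun _ => .rat 0) trivial hp.size_in fun _ => rfl)))
    (fun _ => rfl) (fun i => ?_)
  rw [← List.map_eq_flatMap]

/-- The list `u` is a unary counter. Running past the end of `l` is harmless because the tail of the
leaf `0`, which codes the empty list, is again `0`. -/
theorem drop {u l : ι → List Data} (hu : PB m fun i => (Data.ofList (u i)).size)
    (hl : PB m fun i => (Data.ofList (l i)).size) :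
    PT m O .drop (fun i => .pair (.ofList (u i)) (.ofList (l i)))
      (fun i => .ofList ((l i).drop (u i).length)) := by
  have hsz : PB (fun x : ι × ℕ => m x.1) fun x =>
      (Data.pair (.ofList ((u x.1).drop x.2)) (.ofList ((l x.1).drop x.2))).size := by
    refine (((hu.add hl).add (PB.const 1)).comp Prod.fst).mono fun x => ?_
    have h1 := Data.size_ofList_sublist ((u x.1).drop_sublist x.2)
    have h2 := Data.size_ofList_sublist ((l x.1).drop_sublist x.2)
    simp only [Data.size]
    omega
  have key := PT.loop (m := m) (O := O) (N := fun i => (u i).length)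
    (c := Prog.hd.seq (.basic .isPair)) (p := (Prog.hd.seq .tl).both (Prog.tl.seq .tl))
    (fun i k => .pair (.ofList ((u i).drop k)) (.ofList ((l i).drop k)))
    (fun i k => .rat (if k < (u i).length then 1 else 0))
    (hu.mono fun i => Data.length_le_size_ofList _) ?_ ?_ ?_ ?_
  · refine seq (key.congr (fun i => by simp) fun i => rfl) ?_
    exact straight trivial (hsz.comp_le (fun i => (i, (u i).length)) fun _ => le_rfl) fun i => rfl
  · refine straight (by simp) (hsz.comp_le (fun x => x.1) fun _ => le_rfl) ?_
    rintro ⟨⟨i, k⟩, hk⟩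
    simp only 
    rcases Nat.lt_or_ge k (u i).length with h | h
    · rw [List.drop_eq_getElem_cons h]; simp [h, Data.ofList]
    · rw [List.drop_eq_nil_of_le h]; simp [Data.ofList, h.not_gt]
  · refine straight (by simp) (hsz.comp_le (fun x => x.1) fun _ => le_rfl) ?_
    rintro ⟨⟨i, k⟩, hk⟩
    simp
  · intro i k hk; simp [hk]
  · intro i; simp

end PT

end HyperMotif

namespace HyperMotif

/-! ### Sizes of sums and of homomorphism counts -/

theorem den_sum_dvd (l : List ℚ) : l.sum.den ∣ (l.map Rat.den).prod := by
  induction l with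
  | nil => simp
  | cons a l ih =>
    simp only [List.sum_cons, List.map_cons, List.prod_cons]
    exact (Rat.add_den_dvd _ _).trans (Nat.mul_dvd_mul_left _ ih)

theorem abs_sum_le (l : List ℚ) : |l.sum| ≤ ((l.map fun q => q.num.natAbs).sum : ℕ) := by
  induction l with
  | nil => simp
  | cons a l ih =>
    simp only [List.sum_cons, List.map_cons, Nat.cast_add]
    refine (abs_add_le _ _).trans (add_le_add ?_ ih)
    have h1 : |a| = |(a.num : ℚ)| / a.den := by
      conv_lhs => rw [← Rat.num_div_den a, abs_div, Nat.abs_cast]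
    rw [h1, Nat.cast_natAbs, Int.cast_abs]
    exact div_le_self (abs_nonneg _) (by exact_mod_cast a.den_pos)

/-- Iterating `size_add_le` would lose a factor 2 per summand. Instead the whole sum is estimated at
once: its denominator divides the product of the denominators, and its absolute value is at most the
sum of the absolute numerators. -/
theorem size_sum_le (l : List ℚ) :
    (Data.rat l.sum).size ≤ 3 * (Data.ofList (l.map Data.rat)).size := by
  have hden : Nat.size l.sum.den ≤ (l.map fun q => Nat.size q.den).sum + 1 := by
    refine (Nat.size_le_size (Nat.le_of_dvd (List.prod_pos ?_) (den_sum_dvd l))).trans ?_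
    · simp [Rat.den_pos]
    · induction l with
      | nil => simp
      | cons a l ih =>
        have := Nat_size_mul_le a.den (l.map Rat.den).prod
        simp only [List.map_cons, List.prod_cons, List.sum_cons]
        omega
  have hnum : l.sum.num.natAbs ≤ (l.map fun q => q.num.natAbs).sum * l.sum.den := by
    have h := abs_sum_le l
    have h1 : |l.sum| = |(l.sum.num : ℚ)| / l.sum.den := by
      conv_lhs => rw [← Rat.num_div_den l.sum, abs_div, Nat.abs_cast]
    rw [h1, div_le_iff₀ (by exact_mod_cast l.sum.den_pos), ← Int.cast_abs, ← Nat.cast_natAbs] at h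
    exact_mod_cast h
  have hsum : Nat.size (l.map fun q => q.num.natAbs).sum ≤
      (l.map fun q => Nat.size q.num.natAbs).sum := by
    clear hden hnum
    induction l with
    | nil => simp
    | cons a l ih =>
      simp only [List.map_cons, List.sum_cons]
      exact (Nat_size_add_le _ _).trans (by omega)
  have h1 := (Nat.size_le_size hnum).trans (Nat_size_mul_le _ _)
  have h2 : (Data.ofList (l.map Data.rat)).size =
      (l.map fun q => Nat.size q.num.natAbs).sum + (l.map fun q => Nat.size q.den).sum +
        2 * l.length + 2 := by
    clear * -
    induction l with
    | nil => simp
    | cons a l ih =>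
      simp only [List.map_cons, Data.ofList_cons, Data.size, List.sum_cons, List.length_cons, ih]
      omega
  simp only [Data.size] at h2 ⊢
  omega

theorem Nat_size_pow_le (a b : ℕ) : Nat.size (a ^ b) ≤ b * Nat.size a + 1 := by
  induction b with
  | zero => simp
  | succ b ih =>
    rw [pow_succ]
    have := Nat_size_mul_le (a ^ b) a
    rw [Nat.succ_mul]
    omega

theorem HypergraphCode.le_size (c : HypergraphCode) : c.1 ≤ (Data.ofHypergraph c).size := by
  have := Data.length_le_size_ofList ((List.range c.1).map Data.ofNat)
  simp only [List.length_map, List.length_range] at this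
  simp only [Data.ofHypergraph, Data.size]
  omega

theorem homCount_le (c c' : HypergraphCode) :
    homCount c.toHypergraph c'.toHypergraph ≤ c'.1 ^ c.1 := by
  have h1 : Nat.card c.toHypergraph.vertexSet = c.1 := by
    change Nat.card {v | v < c.1} = c.1
    simp
  have h2 : Nat.card c'.toHypergraph.vertexSet = c'.1 := by
    change Nat.card {v | v < c'.1} = c'.1
    simp
  have := c.toHypergraph.finite_vertexSet.to_subtype
  have := c'.toHypergraph.finite_vertexSet.to_subtype
  calc homCount c.toHypergraph c'.toHypergraph
      ≤ Nat.card (c.toHypergraph.vertexSet → c'.toHypergraph.vertexSet) :=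
        Nat.card_le_card_of_injective _ Subtype.val_injective
    _ = c'.1 ^ c.1 := by rw [Nat.card_fun, h1, h2]

/-- A count of at most `n' ^ n` has about `n · log n'` binary digits, and a description is at least
as long as its number of vertices because it lists them. -/
theorem size_homCount_le (c c' : HypergraphCode) :
    (Data.rat (homCount c.toHypergraph c'.toHypergraph : ℚ)).size ≤
      (Data.ofHypergraph c).size * (Data.ofHypergraph c').size + 3 := by
  have h1 := Nat_size_le_self c'.1
  have h2 := (Nat.size_le_size (homCount_le c c')).trans (Nat_size_pow_le _ _)
  have h3 : c.1 * Nat.size c'.1 ≤ (Data.ofHypergraph c).size * (Data.ofHypergraph c').size :=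
    Nat.mul_le_mul c.le_size (h1.trans c'.le_size)
  have h4 := Data.size_ofNat (homCount c.toHypergraph c'.toHypergraph)
  rw [Data.ofNat] at h4
  omega

/-! ### Evaluating motif parameters given by codes -/

theorem zeta_add (γ δ : MotifFunction) (G : FiniteHypergraph) :
    zeta (γ + δ) G = zeta γ G + zeta δ G :=
  Finsupp.sum_add_index' (by simp) (by intros; ring)

theorem zeta_toMotif (d : MotifCode) (G : FiniteHypergraph) :
    zeta d.toMotif G = (d.map fun p => p.2 * (homCount p.1.toHypergraph G : ℚ)).sum := by
  induction d with
  | nil => simp [MotifCode.toMotif, zeta]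
  | cons p d ih =>
    have h : MotifCode.toMotif (p :: d) = Finsupp.single p.1.type p.2 + MotifCode.toMotif d := by
      simp [MotifCode.toMotif]
    rw [h, zeta_add, ih, List.map_cons, List.sum_cons]
    congr 1
    exact Finsupp.sum_single_index (by simp)

theorem toMotif_apply_of_notMem (d : MotifCode) (F : HypergraphType)
    (h : F ∉ d.map fun p => p.1.type) : d.toMotif F = 0 := by
  induction d with
  | nil => simp [MotifCode.toMotif]
  | cons p d ih =>
    rw [List.map_cons, List.mem_cons, not_or] at h
    have h' : MotifCode.toMotif (p :: d) = Finsupp.single p.1.type p.2 + MotifCode.toMotif d := by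
      simp [MotifCode.toMotif]
    rw [h', Finsupp.add_apply, ih h.2, Finsupp.single_eq_of_ne h.1, add_zero]

theorem toMotif_apply_of_mem {d : MotifCode} (hd : (d.map fun p => p.1.type).Nodup)
    {p : HypergraphCode × ℚ} (hp : p ∈ d) : d.toMotif p.1.type = p.2 := by
  induction d with
  | nil => simp at hp
  | cons p' d ih =>
    rw [List.map_cons, List.nodup_cons] at hd
    have h' : MotifCode.toMotif (p' :: d) = Finsupp.single p'.1.type p'.2 + MotifCode.toMotif d := by
      simp [MotifCode.toMotif]
    rw [h', Finsupp.add_apply]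
    rcases List.mem_cons.1 hp with rfl | hp
    · rw [toMotif_apply_of_notMem d _ hd.1, Finsupp.single_eq_same, add_zero]
    · have : p.1.type ≠ p'.1.type := fun h => hd.1 (h ▸ List.mem_map_of_mem (f := fun p => p.1.type) hp)
      rw [ih hd.2 hp, Finsupp.single_eq_of_ne this, zero_add]

theorem HypergraphCode.size_le_of_mem {d : MotifCode} {p : HypergraphCode × ℚ} (hp : p ∈ d) :
    (Data.ofHypergraph p.1).size + (Data.rat p.2).size ≤ (Data.ofMotif d).size := by
  have h1 : (Data.pair (Data.ofHypergraph p.1) (.rat p.2)).size ≤ (Data.ofMotif d).size :=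
    Data.size_le_size_ofList (List.mem_map_of_mem
      (f := fun p : HypergraphCode × ℚ => Data.pair (Data.ofHypergraph p.1) (.rat p.2)) hp)
  rw [Data.size] at h1
  omega

theorem size_zeta_sum_le (d : MotifCode) (G : HypergraphCode) :
    (Data.rat (d.map fun p => p.2 * (homCount p.1.toHypergraph G.toHypergraph : ℚ)).sum).size ≤
      3 * ((Data.ofMotif d).size * ((Data.ofMotif d).size +
        (Data.ofMotif d).size * (Data.ofHypergraph G).size + 4) + 2) := by
  have hlen : d.length ≤ (Data.ofMotif d).size := by
    simpa [Data.ofMotif] using Data.length_le_size_ofList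
      (d.map fun p => .pair (Data.ofHypergraph p.1) (.rat p.2))
  refine (size_sum_le _).trans (Nat.mul_le_mul_left _ ?_)
  rw [List.map_map]
  refine (Data.size_ofList_le (B := (Data.ofMotif d).size +
        (Data.ofMotif d).size * (Data.ofHypergraph G).size + 3) ?_).trans ?_
  · intro x hx
    obtain ⟨p, hp, rfl⟩ := List.mem_map.1 hx
    have h1 := HypergraphCode.size_le_of_mem hp
    refine (size_mul_le _ _).trans ?_
    have h2 := size_homCount_le p.1 G
    have h3 : (Data.ofHypergraph p.1).size * (Data.ofHypergraph G).size ≤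
        (Data.ofMotif d).size * (Data.ofHypergraph G).size := Nat.mul_le_mul_right _ (by omega)
    omega
  · rw [List.length_map]
    exact Nat.add_le_add_right (Nat.mul_le_mul_right _ hlen) _

theorem size_ofMotif_sublist {d d' : MotifCode} (h : d.Sublist d') :
    (Data.ofMotif d).size ≤ (Data.ofMotif d').size :=
  Data.size_ofList_sublist (h.map _)

theorem List.foldl_add_eq_sum {α : Type*} (f : α → ℚ) (l : List α) (b : ℚ) :
    l.foldl (fun b a => b + f a) b = b + (l.map f).sum := by
  induction l generalizing b with
  | nil => simp
  | cons a l ih => simp [ih, add_assoc]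

/-! ### Reducing motif parameters to homomorphism counts -/

/-- On input `(G, (b, (F, a)))`, ask for `#Hom(F, G)` and add `a` times the answer to `b`. -/
def Prog.addTerm : Prog :=
  ((tl.seq hd).both
    (((tl.seq (tl.seq tl)).both (((tl.seq (tl.seq hd)).both hd).seq query)).seq (.basic .mul))).seq
      (.basic .add)

/-- On input `(γ, G)`, compute `ζ_γ(G)` with an oracle for homomorphism counts. -/
def Prog.evalMotif : Prog :=
  (tl.both ((lit (.rat 0)).both hd)).seq (fold addTerm)

/-- The oracle answer `v` is left arbitrary because the program serves twice: with homomorphism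
counts in `evalMotif`, and with values of `ζ_γ` on products in `addProduct`. -/
theorem PT.addTerm {ι : Type*} {m : ι → ℕ} {O : ι → Data → Data → Prop} {F G : ι → Data}
    {a b v : ι → ℚ}
    (hin : PB m fun i => (Data.pair (G i) (.pair (.rat (b i)) (.pair (F i) (.rat (a i))))).size)
    (hv : PB m fun i => (Data.rat (v i)).size)
    (hO : ∀ i, O i (.pair (F i) (G i)) (.rat (v i))) :
    PT m O .addTerm (fun i => .pair (G i) (.pair (.rat (b i)) (.pair (F i) (.rat (a i)))))
      (fun i => .rat (b i + a i * v i)) := by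
  have hq := seq (straight (O := O) (p := (Prog.tl.seq (Prog.tl.seq .hd)).both .hd)
    (b := fun i => .pair (F i) (G i)) (by simp) hin fun i => by simp)
    (query (hin.mono fun i => by simp only [Data.size]; omega) hv hO)
  have h1 := both (straight (O := O) (p := Prog.tl.seq (Prog.tl.seq .tl))
    (b := fun i => .rat (a i)) (by simp) hin fun i => by simp) hq
  have h2 := h1.seq (straight (p := .basic .mul) (b := fun i => .rat (a i * v i)) (by simp)
    h1.size_out fun i => by simp)
  have h3 := both (straight (O := O) (p := Prog.tl.seq .hd)
    (b := fun i => .rat (b i)) (by simp) hin fun i => by simp) h2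
  exact h3.seq (straight (by simp) h3.size_out fun i => by simp)

set_option maxHeartbeats 400000 in
theorem PT.evalMotif {ι : Type*} {m : ι → ℕ} {O : ι → Data → Data → Prop} {d : ι → MotifCode}
    {G : ι → HypergraphCode} (hd : PB m fun i => (Data.ofMotif (d i)).size)
    (hG : PB m fun i => (Data.ofHypergraph (G i)).size)
    (hO : ∀ i, ∀ p ∈ d i, O i (.pair (Data.ofHypergraph p.1) (Data.ofHypergraph (G i)))
      (.rat (homCount p.1.toHypergraph (G i).toHypergraph : ℚ))) :
    PT m O .evalMotif (fun i => .pair (Data.ofMotif (d i)) (Data.ofHypergraph (G i)))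
      (fun i => .rat (zeta (d i).toMotif (G i).toHypergraph)) := by
  refine seq (b := fun i => .pair (Data.ofHypergraph (G i)) (.pair (.rat 0) (Data.ofMotif (d i))))
    (straight (by simp) (((hd.add hG).add (PB.const 1)).mono fun i => by simp [Data.size])
      fun i => by simp) ?_
  have hfold (i : ι) (u : MotifCode) :
      u.foldl (fun b p => b + p.2 * (homCount p.1.toHypergraph (G i).toHypergraph : ℚ)) 0 =
      (u.map fun p => p.2 * (homCount p.1.toHypergraph (G i).toHypergraph : ℚ)).sum := by
    rw [List.foldl_add_eq_sum, zero_add]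
  refine congr (fold (env := fun i => Data.ofHypergraph (G i)) (l := d)
    (ea := fun p => .pair (Data.ofHypergraph p.1) (.rat p.2)) (eb := Data.rat)
    (step := fun i b p => b + p.2 * (homCount p.1.toHypergraph (G i).toHypergraph : ℚ))
    (b₀ := fun _ => 0) hG hd (PB.const _) ?_) (fun i => rfl)
      (fun i => by rw [zeta_toMotif, hfold])
  have hB := (((hd.mul ((hd.add (hd.mul hG)).add (PB.const 4))).add (PB.const 2)).const_mul 3)
  have hmem (x : {x : ι × MotifCode × HypergraphCode × ℚ // x.2.1 ++ [x.2.2] <+: d x.1}) :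
      x.1.2.2 ∈ d x.1.1 := x.2.subset (by simp)
  simp only [hfold]
  refine addTerm (F := fun x => Data.ofHypergraph x.1.2.2.1)
    (G := fun x => Data.ofHypergraph (G x.1.1)) (a := fun x => x.1.2.2.2)
    (b := fun x => (x.1.2.1.map fun p =>
      p.2 * (homCount p.1.toHypergraph (G x.1.1).toHypergraph : ℚ)).sum)
    (v := fun x => (homCount x.1.2.2.1.toHypergraph (G x.1.1).toHypergraph : ℚ))
    ?_ ?_ fun x => hO _ _ (hmem x)
  · refine ((hB.add (hd.add hG)).add (PB.const 5)).comp_le (fun x => x.1.1) fun x => ?_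
    have h1 := HypergraphCode.size_le_of_mem (hmem x)
    have h2 := size_zeta_sum_le x.1.2.1 (G x.1.1)
    have h3 := size_ofMotif_sublist ((List.sublist_append_left _ [x.1.2.2]).trans x.2.sublist)
    have h4 := h2.trans (Nat.mul_le_mul_left 3 (Nat.add_le_add_right (Nat.mul_le_mul h3
      (Nat.add_le_add_right (Nat.add_le_add h3 (Nat.mul_le_mul_right _ h3)) 4)) 2))
    simp only [Data.size_pair]
    omega
  · refine ((hd.mul hG).add (PB.const 3)).comp_le (fun x => x.1.1) fun x => ?_
    have := HypergraphCode.size_le_of_mem (hmem x)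
    exact (size_homCount_le _ _).trans (Nat.add_le_add_right (Nat.mul_le_mul_right _ (by omega)) 3)

/-- An encoding has length at least 1, so `size + 2 ≤ 3 * size`; the power of 3 moves into the
parameter-dependent factor. -/
theorem IsParamReduction.of_PT {P Q : ParamProblem} {M : Prog} {f g : ℕ → ℕ}
    (h : ∃ C, ∀ x : P.Inst, ∃ t ≤ f (P.param x) * ((P.enc x).size + 2) ^ C,
      Run (Q.oracle (g (P.param x))) M (P.enc x) (.rat (P.value x)) t) :
    ∃ C, IsParamReduction P Q M (fun n => f n * 3 ^ C) g C := by
  obtain ⟨C, hC⟩ := h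
  refine ⟨C, fun x => ?_⟩
  obtain ⟨t, ht, r⟩ := hC x
  refine ⟨t, ht.trans ?_, r⟩
  rw [mul_assoc, ← mul_pow]
  have := (P.enc x).size_pos
  exact Nat.mul_le_mul_left _ (Nat.pow_le_pow_left (by omega) _)

/-- A hypergraph listed in a description has at most as many vertices as the description is long, so
`g = id` bounds the queries, and the time is polynomial outright. -/
theorem hyperME_fptReducible (Γ : Set MotifFunction) :
    FPTReducible (hyperME Γ) (homProblem (supports Γ)) := by
  have h : PT (fun x : (hyperME Γ).Inst => ((hyperME Γ).enc x).size)
      (fun x => (homProblem (supports Γ)).oracle ((hyperME Γ).param x)) .evalMotif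
      (hyperME Γ).enc (fun x => .rat ((hyperME Γ).value x)) := by
    refine PT.evalMotif (d := fun x : (hyperME Γ).Inst => x.1.1)
      (G := fun x : (hyperME Γ).Inst => x.1.2) ?_ ?_ ?_
    · exact PB.self.mono fun x => by simp only [hyperME, Data.size]; omega
    · exact PB.self.mono fun x => by simp only [hyperME, Data.size]; omega
    · rintro ⟨⟨d, G⟩, hd, hγ, hG⟩ p hp
      refine ⟨⟨(p.1, G), (hd.1 p hp).1, ⟨d.toMotif, hγ, ?_⟩, hG⟩, ?_, rfl, rfl⟩
      -- A listed hypergraph really lies in the support because a valid description has nonzero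
      -- coefficients and no repeated types; otherwise the query might not be admissible.
      · rw [Finsupp.mem_support_iff, toMotif_apply_of_mem hd.2 hp]
        exact (hd.1 p hp).2
      · have := HypergraphCode.size_le_of_mem (d := d) hp
        have := p.1.le_size
        change p.1.1 ≤ (Data.ofMotif d).size
        omega
  obtain ⟨C, hC⟩ := h
  obtain ⟨D, hD⟩ := IsParamReduction.of_PT (f := fun _ => 1) (g := id) (M := .evalMotif)
    ⟨C, fun x => by simpa using hC x⟩
  exact ⟨_, _, _, D, by simpa using Computable.const _, Computable.id, hD⟩

end HyperMotif

namespace HyperMotif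

/-! ### Products with a fixed hypergraph, computed in polynomial time -/

/-- A description of a fixed second factor `K` of a product: the number of vertices of `K` and, for
each `r`, the list of those subsets of `[r] × V(K)` that are the edges over an edge with `r`
vertices of the first factor. -/
abbrev Gadget : Type := ℕ × List (List (List (ℕ × ℕ)))

/-- The edge over the edge `e` that is given by a subset of `[r] × V(K)`. -/
def substEdge (n : ℕ) (e : List ℕ) (P : List (ℕ × ℕ)) : List ℕ :=
  P.map fun x => e.getD x.1 0 * n + x.2

/-- The product of `G` and the hypergraph described by a gadget. -/
def Gadget.prod (g : Gadget) (G : HypergraphCode) : HypergraphCode :=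
  (G.1 * g.1, G.2.flatMap fun e => (g.2.getD e.length []).map (substEdge g.1 e))

namespace Data

/-- The position in the edge is written in unary so that `Prog.drop` can use it as a counter for
looking up the vertex there. -/
def ofPoint (x : ℕ × ℕ) : Data := .pair (ofList (List.replicate x.1 (.rat 0))) (ofNat x.2)

def ofPattern (P : List (ℕ × ℕ)) : Data := ofList (P.map ofPoint)

def ofPatterns (l : List (List (ℕ × ℕ))) : Data := ofList (l.map ofPattern)

/-- The list of the vertices is stored next to their number so that the vertices over a given one
are obtained by a map, without generating a range. -/
def ofGadget (g : Gadget) : Data :=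
  .pair (.pair (ofNat g.1) (ofList ((List.range g.1).map ofNat))) (ofList (g.2.map ofPatterns))

def ofEdge (e : List ℕ) : Data := ofList (e.map ofNat)

end Data

namespace Prog

/-- On input `((e, n), (i, v))`, compute `e_i * n + v`. -/
def point : Prog :=
  ((((((tl.seq hd).both (hd.seq hd)).seq drop).seq hd).both (hd.seq tl)).seq (.basic .mul)).both
    (tl.seq tl) |>.seq (.basic .add)

/-- On input `((n, T), e)`, the list of the edges over `e`. -/
def edgesOver : Prog :=
  ((tl.both (hd.seq hd)).both (((tl.both (hd.seq tl)).seq drop).seq hd)).seq (map (map point))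

/-- On input `((n, range n), u)`, the list of the vertices over `u`. -/
def verticesOver : Prog :=
  (((tl.both (hd.seq hd)).seq (.basic .mul)).both (hd.seq tl)).seq (map (.basic .add))

/-- On input `(G, g)` with a gadget `g`, compute the product. -/
def product : Prog :=
  (((tl.seq hd).both (hd.seq hd)).seq (flatMap verticesOver)).both
    (((((tl.seq hd).seq hd).both (tl.seq tl)).both (hd.seq tl)).seq (flatMap edgesOver))

end Prog

/-- Looking up an entry means dropping and taking the head. Beyond the end the head of the leaf `0`
is `0`, which has to code the default value `a`. -/
theorem Instr.eval_fst_ofList_drop_map {α : Type*} (f : α → Data) (l : List α) (a : α)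
    (ha : f a = .rat 0) (i : ℕ) :
    Instr.fst.eval (.ofList ((l.map f).drop i)) = f (l.getD i a) := by
  rw [List.getD_eq_getElem?_getD, ← List.map_drop]
  rcases Nat.lt_or_ge i l.length with h | h
  · rw [List.drop_eq_getElem_cons h, List.map_cons, List.getElem?_eq_getElem h]; rfl
  · rw [List.drop_eq_nil_of_le h]; simp [h, ha]

theorem range_mul_eq_flatMap (a b : ℕ) :
    List.range (a * b) = (List.range a).flatMap fun u => (List.range b).map fun v => u * b + v := by
  induction a with
  | zero => simp
  | succ a ih => rw [Nat.succ_mul, List.range_add, ih, List.range_succ, List.flatMap_append]; simp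

/-! ### Running time of the product construction -/

namespace PT

variable {ι : Type*} {m : ι → ℕ} {O : ι → Data → Data → Prop}

theorem point {e : ι → List ℕ} {n : ι → ℕ} {x : ι → ℕ × ℕ}
    (h : PB m fun i => (Data.pair (.pair (.ofEdge (e i)) (.ofNat (n i))) (.ofPoint (x i))).size) :
    PT m O .point (fun i => .pair (.pair (.ofEdge (e i)) (.ofNat (n i))) (.ofPoint (x i)))
      (fun i => .ofNat ((e i).getD (x i).1 0 * n i + (x i).2)) := by
  have h1 := seq (straight (O := O) (p := (Prog.tl.seq .hd).both (Prog.hd.seq .hd))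
    (b := fun i => .pair (.ofList (List.replicate (x i).1 (.rat 0))) (.ofEdge (e i)))
    (by simp) h fun i => by simp [Data.ofPoint]) (drop (h.mono fun i => by
      simp only [Data.size_pair, Data.ofPoint]; omega) (h.mono fun i => by
      simp only [Data.size_pair, Data.ofEdge]; omega))
  have h2 := h1.seq (straight (p := .hd) (b := fun i => .ofNat ((e i).getD (x i).1 0)) (by simp)
    h1.size_out fun i => by
      simp [-List.getD_eq_getElem?_getD, -List.map_drop,
        Instr.eval_fst_ofList_drop_map Data.ofNat (e i) 0 (by simp [Data.ofNat])])
  have h3 := both h2 (straight (O := O) (p := Prog.hd.seq .tl)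
    (b := fun i => .ofNat (n i)) (by simp) h fun i => by simp)
  have h4 := h3.seq (straight (p := .basic .mul) (b := fun i => .ofNat ((e i).getD (x i).1 0 * n i))
    (by simp) h3.size_out fun i => by simp [Data.ofNat])
  have h5 := both h4 (straight (O := O) (p := Prog.tl.seq .tl)
    (b := fun i => .ofNat (x i).2) (by simp) h fun i => by simp [Data.ofPoint])
  exact h5.seq (straight (by simp) h5.size_out fun i => by simp [Data.ofNat])

theorem edgesOver {e : ι → List ℕ} {g : ι → Gadget}
    (h : PB m fun i => (Data.pair (.pair (.ofNat (g i).1) (.ofList ((g i).2.map Data.ofPatterns)))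
      (.ofEdge (e i))).size) :
    PT m O .edgesOver (fun i => .pair
        (.pair (.ofNat (g i).1) (.ofList ((g i).2.map Data.ofPatterns))) (.ofEdge (e i)))
      (fun i => .ofList ((((g i).2.getD (e i).length []).map (substEdge (g i).1 (e i))).map
        Data.ofEdge)) := by
  have h1 := seq (straight (O := O) (p := Prog.tl.both (Prog.hd.seq .tl))
    (b := fun i => .pair (.ofEdge (e i)) (.ofList ((g i).2.map Data.ofPatterns)))
    (by simp) h fun i => by simp) (drop (h.mono fun i => by
      simp only [Data.size_pair, Data.ofEdge]; omega) (h.mono fun i => by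
      simp only [Data.size_pair]; omega))
  have h2 := h1.seq (straight (p := .hd)
    (b := fun i => .ofPatterns ((g i).2.getD (e i).length [])) (by simp)
    h1.size_out fun i => by
      simp [-List.getD_eq_getElem?_getD, -List.map_drop,
        Instr.eval_fst_ofList_drop_map Data.ofPatterns (g i).2 [] (by simp [Data.ofPatterns])])
  have h3 := both (straight (O := O) (p := Prog.tl.both (Prog.hd.seq .hd))
    (b := fun i => .pair (.ofEdge (e i)) (.ofNat (g i).1)) (by simp) h fun i => by simp) h2
  have h4 := h3.size_out
  refine h3.seq (congr (map (env := fun i => .pair (.ofEdge (e i)) (.ofNat (g i).1))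
    (l := fun i => (g i).2.getD (e i).length []) (ea := Data.ofPattern)
    (F := fun i P => .ofEdge (substEdge (g i).1 (e i) P))
    (h4.mono fun i => by simp only [Data.size_pair]; omega)
    (h4.mono fun i => by simp only [Data.size_pair, Data.ofPatterns]; omega) ?_)
    (fun i => by rfl) fun i => by rw [List.map_map]; rfl)
  have h5 : PB (fun x : {x : ι × List (ℕ × ℕ) // x.2 ∈ (g x.1).2.getD (e x.1).length []} => m x.1.1)
      fun x => (Data.pair (.pair (.ofEdge (e x.1.1)) (.ofNat (g x.1.1).1))
        (.ofPattern x.1.2)).size := by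
    refine h4.comp_le (fun x => x.1.1) fun x => ?_
    have := Data.size_le_size_ofList (List.mem_map_of_mem (f := Data.ofPattern) x.2)
    simp only [Data.size_pair, Data.ofPatterns]
    omega
  refine congr (map (env := fun x => .pair (.ofEdge (e x.1.1)) (.ofNat (g x.1.1).1))
    (l := fun x => x.1.2) (ea := Data.ofPoint)
    (F := fun x y => .ofNat ((e x.1.1).getD y.1 0 * (g x.1.1).1 + y.2))
    (h5.mono fun x => by simp only [Data.size_pair]; omega)
    (h5.mono fun x => by simp only [Data.size_pair, Data.ofPattern]; omega) ?_)
    (fun x => by rfl) fun x => by simp only [Data.ofEdge, substEdge, List.map_map]; rfl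
  refine point (e := _) (n := _) (x := _) ?_
  refine h5.comp_le (fun x => x.1.1) fun x => ?_
  have := Data.size_le_size_ofList (List.mem_map_of_mem (f := Data.ofPoint) x.2)
  simp only [Data.size_pair, Data.ofPattern]
  omega

theorem verticesOver {u n : ι → ℕ}
    (h : PB m fun i => (Data.pair (.pair (.ofNat (n i)) (.ofList ((List.range (n i)).map Data.ofNat)))
      (.ofNat (u i))).size) :
    PT m O .verticesOver (fun i => .pair (.pair (.ofNat (n i))
        (.ofList ((List.range (n i)).map Data.ofNat))) (.ofNat (u i)))
      (fun i => .ofList (((List.range (n i)).map fun v => u i * n i + v).map Data.ofNat)) := by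
  have h1 := straight (O := O)
    (p := ((Prog.tl.both (Prog.hd.seq .hd)).seq (.basic .mul)).both (Prog.hd.seq .tl))
    (b := fun i => .pair (.ofNat (u i * n i)) (.ofList ((List.range (n i)).map Data.ofNat)))
    (by simp) h fun i => by simp [Data.ofNat]
  have h2 := h1.size_out
  refine h1.seq (congr (map (env := fun i => .ofNat (u i * n i)) (l := fun i => List.range (n i))
    (ea := Data.ofNat) (F := fun i v => .ofNat (u i * n i + v))
    (h2.mono fun i => by simp only [Data.size_pair]; omega)
    (h2.mono fun i => by simp only [Data.size_pair]; omega) ?_)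
    (fun i => rfl) fun i => by rw [List.map_map]; rfl)
  refine straight (by simp) ?_ fun x => by simp [Data.ofNat]
  refine h2.comp_le (fun x => x.1.1) fun x => ?_
  have := Data.size_le_size_ofList (List.mem_map_of_mem (f := Data.ofNat) x.2)
  simp only [Data.size_pair]
  omega

/-- The time is polynomial in `G` and the gadget together. The exponential dependence on `k` and on
the second factor is hidden in the length of the gadget, which is part of the input here. -/
theorem product {G : ι → HypergraphCode} {g : ι → Gadget}
    (h : PB m fun i => (Data.pair (.ofHypergraph (G i)) (.ofGadget (g i))).size) :
    PT m O .product (fun i => .pair (.ofHypergraph (G i)) (.ofGadget (g i)))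
      (fun i => .ofHypergraph ((g i).prod (G i))) := by
  refine congr (both (b := fun i => .ofList (((List.range (G i).1).flatMap fun u =>
        ((List.range (g i).1).map fun v => u * (g i).1 + v).map Data.ofNat)))
      (d := fun i => .ofList ((G i).2.flatMap fun e =>
        ((((g i).2.getD e.length []).map (substEdge (g i).1 e)).map Data.ofEdge)))
      ?_ ?_) (fun i => rfl) fun i => ?_
  · refine seq (straight (b := fun i => .pair (.pair (.ofNat (g i).1)
        (.ofList ((List.range (g i).1).map Data.ofNat)))
        (.ofList ((List.range (G i).1).map Data.ofNat))) (by simp) h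
        fun i => by simp [Data.ofGadget, Data.ofHypergraph]) ?_
    refine flatMap ?_ ?_ (verticesOver (u := fun x : {x : ι × ℕ // x.2 ∈ List.range (G x.1).1} => x.1.2)
      (n := fun x => (g x.1.1).1) ?_)
    · refine h.mono fun i => ?_
      simp only [Data.size_pair, Data.ofGadget]; omega
    · refine h.mono fun i => ?_
      simp only [Data.size_pair, Data.ofHypergraph]; omega
    · refine h.comp_le (fun x => x.1.1) fun x => ?_
      have := Data.size_le_size_ofList (List.mem_map_of_mem (f := Data.ofNat) x.2)
      simp only [Data.size_pair, Data.ofHypergraph, Data.ofGadget]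
      omega
  · refine seq (straight (b := fun i => .pair (.pair (.ofNat (g i).1)
        (.ofList ((g i).2.map Data.ofPatterns))) (.ofList ((G i).2.map Data.ofEdge))) (by simp) h
        fun i => by simp [Data.ofGadget, Data.ofHypergraph]; rfl) ?_
    refine flatMap ?_ ?_ (edgesOver (e := fun x : {x : ι × List ℕ // x.2 ∈ (G x.1).2} => x.1.2)
      (g := fun x => g x.1.1) ?_)
    · refine h.mono fun i => ?_
      simp only [Data.size_pair, Data.ofGadget]; omega
    · refine h.mono fun i => ?_
      simp only [Data.size_pair, Data.ofHypergraph]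
      change (Data.ofList ((G i).2.map fun l => Data.ofList (l.map Data.ofNat))).size ≤ _
      omega
    · refine h.comp_le (fun x => x.1.1) fun x => ?_
      have : _ ≤ (Data.ofList ((G x.1.1).2.map fun l => Data.ofList (l.map Data.ofNat))).size :=
        Data.size_le_size_ofList (List.mem_map_of_mem (f := Data.ofEdge) x.2)
      simp only [Data.size_pair, Data.ofHypergraph, Data.ofGadget]
      omega
  · simp only [Data.ofHypergraph, Gadget.prod, range_mul_eq_flatMap, List.map_flatMap]
    rfl

end PT

/-! ### Linear combinations of values on products -/

/-- A scale and a list of coefficients and gadgets. -/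
abbrev Scheme : Type := ℚ × List (ℚ × Gadget)

/-- The linear combination, given by a scheme, of the values of `ζ_γ` on products with `G`. -/
noncomputable def Scheme.value (S : Scheme) (d : MotifCode) (G : HypergraphCode) : ℚ :=
  (S.2.map fun w => w.1 * zeta d.toMotif (w.2.prod G).toHypergraph).sum / S.1

def Data.ofTerm (w : ℚ × Gadget) : Data := .pair (.ofGadget w.2) (.rat w.1)

def Data.ofScheme (S : Scheme) : Data := .pair (.rat S.1) (.ofList (S.2.map ofTerm))

/-- On input `((γ, G), (b, (g, a)))`, ask for the value of `ζ_γ` on the product of `G` and `g`, and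
add `a` times the answer to `b`. -/
def Prog.addProduct : Prog :=
  ((((hd.seq tl).both (tl.seq (tl.seq hd))).seq product).both ((tl.seq hd).both
    ((hd.seq hd).both (tl.seq (tl.seq tl))))).seq addTerm

/-- On input `(G, (γ, S))`, compute the value of the scheme `S`. -/
def Prog.evalScheme : Prog :=
  (((((tl.seq hd).both hd).both ((lit (.rat 0)).both (tl.seq (tl.seq tl)))).seq
    (fold addProduct)).both (tl.seq (tl.seq hd))).seq (.basic .div)

/-! ### Running time of evaluating a scheme -/

namespace PT

variable {ι : Type*} {m : ι → ℕ} {O : ι → Data → Data → Prop}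

theorem addProduct {d : ι → MotifCode} {G : ι → HypergraphCode} {b : ι → ℚ}
    {w : ι → ℚ × Gadget}
    (h : PB m fun i => (Data.pair (.pair (.ofMotif (d i)) (.ofHypergraph (G i)))
      (.pair (.rat (b i)) (.ofTerm (w i)))).size)
    (hO : ∀ i, O i (.pair (.ofMotif (d i)) (.ofHypergraph ((w i).2.prod (G i))))
      (.rat (zeta (d i).toMotif ((w i).2.prod (G i)).toHypergraph))) :
    PT m O .addProduct (fun i => .pair (.pair (.ofMotif (d i)) (.ofHypergraph (G i)))
      (.pair (.rat (b i)) (.ofTerm (w i))))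
      (fun i => .rat (b i + (w i).1 * zeta (d i).toMotif ((w i).2.prod (G i)).toHypergraph)) := by
  have h1 := seq (straight (O := O) (p := (Prog.hd.seq .tl).both (Prog.tl.seq (Prog.tl.seq .hd)))
    (b := fun i => .pair (.ofHypergraph (G i)) (.ofGadget (w i).2)) (by simp) h fun i => by
      simp [Data.ofTerm]) (product (h.mono fun i => by
        simp only [Data.size_pair, Data.ofTerm]; omega))
  have h2 := both h1 (straight (O := O) (p := (Prog.tl.seq .hd).both
    ((Prog.hd.seq .hd).both (Prog.tl.seq (Prog.tl.seq .tl))))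
    (b := fun i => .pair (.rat (b i)) (.pair (.ofMotif (d i)) (.rat (w i).1))) (by simp) h fun i => by
      simp [Data.ofTerm])
  refine h2.seq (addTerm (F := fun i => .ofMotif (d i)) (G := fun i => .ofHypergraph _)
    h2.size_out ?_ hO)
  have hd : PB m fun i => (Data.ofMotif (d i)).size := h.mono fun i => by
    simp only [Data.size_pair]; omega
  refine (((hd.mul ((hd.add (hd.mul h1.size_out)).add (PB.const 4))).add
    (PB.const 2)).const_mul 3).mono fun i => ?_
  rw [zeta_toMotif]
  exact size_zeta_sum_le _ _

theorem evalScheme {d : ι → MotifCode} {G : ι → HypergraphCode} {S : ι → Scheme}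
    (h : PB m fun i => (Data.pair (.ofHypergraph (G i))
      (.pair (.ofMotif (d i)) (.ofScheme (S i)))).size)
    (hO : ∀ i, ∀ w ∈ (S i).2, O i (.pair (.ofMotif (d i)) (.ofHypergraph (w.2.prod (G i))))
      (.rat (zeta (d i).toMotif (w.2.prod (G i)).toHypergraph))) :
    PT m O .evalScheme (fun i => .pair (.ofHypergraph (G i)) (.pair (.ofMotif (d i)) (.ofScheme (S i))))
      (fun i => .rat ((S i).value (d i) (G i))) := by
  have h1 := straight (O := O) (p := ((Prog.tl.seq .hd).both .hd).both
    ((Prog.lit (.rat 0)).both (Prog.tl.seq (Prog.tl.seq .tl))))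
    (b := fun i => .pair (.pair (.ofMotif (d i)) (.ofHypergraph (G i)))
      (.pair (.rat 0) (.ofList ((S i).2.map Data.ofTerm)))) (by simp) h
    fun i => by simp [Data.ofScheme]
  have h2 := straight (O := O) (p := Prog.tl.seq (Prog.tl.seq .hd)) (b := fun i => .rat (S i).1)
    (by simp) h fun i => by simp [Data.ofScheme]
  have hmem (x : {x : ι × List (ℚ × Gadget) × ℚ × Gadget // x.2.1 ++ [x.2.2] <+: (S x.1).2}) :
      x.1.2.2 ∈ (S x.1.1).2 := x.2.subset (by simp)
  have hfold (i : ι) (u : List (ℚ × Gadget)) :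
      u.foldl (fun b w => b + w.1 * zeta (d i).toMotif (w.2.prod (G i)).toHypergraph) 0 =
      (u.map fun w => w.1 * zeta (d i).toMotif (w.2.prod (G i)).toHypergraph).sum := by
    rw [List.foldl_add_eq_sum, zero_add]
  have hS : PB m fun i => (Data.ofList ((S i).2.map Data.ofTerm)).size :=
    h1.size_out.mono fun i => by simp only [Data.size_pair]; omega
  have hlen : PB m fun i => (S i).2.length := hS.mono fun i => by
    simpa using Data.length_le_size_ofList ((S i).2.map Data.ofTerm)
  -- Running `addProduct` with accumulator 0 shows that every single summand has polynomial length;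
  -- `size_sum_le` then bounds all partial sums.
  obtain ⟨C, hC⟩ : PB (fun x : {x : ι × ℚ × Gadget // x.2 ∈ (S x.1).2} => m x.1.1) fun x =>
      (Data.rat (0 + x.1.2.1 *
        zeta (d x.1.1).toMotif (x.1.2.2.prod (G x.1.1)).toHypergraph)).size := by
    refine (addProduct (O := fun x : {x : ι × ℚ × Gadget // x.2 ∈ (S x.1).2} => O x.1.1)
      (d := fun x => d x.1.1) (G := fun x => G x.1.1)
      (b := fun x => 0) (w := fun x => x.1.2)
      (h1.size_out.comp_le (fun x => x.1.1) fun x => ?_)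
      (fun x => hO x.1.1 x.1.2 x.2)).size_out
    have := Data.size_le_size_ofList (List.mem_map_of_mem (f := Data.ofTerm) x.2)
    simp only [Data.size_pair]
    omega
  have hsum : PB (fun x : {x : ι × List (ℚ × Gadget) × ℚ × Gadget //
      x.2.1 ++ [x.2.2] <+: (S x.1).2} => m x.1.1) fun x => (Data.rat (x.1.2.1.map fun w =>
        w.1 * zeta (d x.1.1).toMotif (w.2.prod (G x.1.1)).toHypergraph).sum).size := by
    refine (((hlen.mul (PB.add (f := fun i => (m i + 2) ^ C) ⟨C, fun _ => le_rfl⟩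
      (PB.const 1))).add (PB.const 2)).const_mul 3).comp_le (fun x => x.1.1) fun x => ?_
    refine (size_sum_le _).trans (Nat.mul_le_mul_left _ ?_)
    rw [List.map_map]
    refine (Data.size_ofList_le (B := (m x.1.1 + 2) ^ C) ?_).trans ?_
    · intro y hy
      obtain ⟨w, hw, rfl⟩ := List.mem_map.1 hy
      have := hC ⟨(x.1.1, w), x.2.subset (List.mem_append_left _ hw)⟩
      simpa using this
    · have := ((List.sublist_append_left x.1.2.1 [x.1.2.2]).trans x.2.sublist).length_le
      rw [List.length_map]
      exact Nat.add_le_add_right (Nat.mul_le_mul_right _ this) _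
  have h3 : PT m O (.fold .addProduct) (fun i => .pair (.pair (.ofMotif (d i)) (.ofHypergraph (G i)))
      (.pair (.rat 0) (.ofList ((S i).2.map Data.ofTerm))))
      (fun i => .rat ((S i).2.map fun w => w.1 * zeta (d i).toMotif (w.2.prod (G i)).toHypergraph).sum) := by
    refine congr (fold (env := fun i => .pair (.ofMotif (d i)) (.ofHypergraph (G i)))
      (l := fun i => (S i).2) (ea := Data.ofTerm) (eb := Data.rat)
      (step := fun i b w => b + w.1 * zeta (d i).toMotif (w.2.prod (G i)).toHypergraph)
      (b₀ := fun _ => 0) (h.mono fun i => by simp only [Data.size_pair]; omega) hS (PB.const _) ?_)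
      (fun i => rfl) (fun i => by rw [hfold])
    simp only [hfold]
    refine addProduct (O := fun x : {x : ι × List (ℚ × Gadget) × ℚ × Gadget //
      x.2.1 ++ [x.2.2] <+: (S x.1).2} => O x.1.1) (d := fun x => d x.1.1) (G := fun x => G x.1.1)
      (b := fun x => (x.1.2.1.map fun w =>
        w.1 * zeta (d x.1.1).toMotif (w.2.prod (G x.1.1)).toHypergraph).sum)
      (w := fun x => x.1.2.2) ?_ fun x => hO x.1.1 _ (hmem x)
    refine (hsum.add (h1.size_out.comp_le (fun x => x.1.1) fun _ => le_rfl)).mono fun x => ?_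
    have := Data.size_le_size_ofList (List.mem_map_of_mem (f := Data.ofTerm) (hmem x))
    simp only [Data.size_pair]
    omega
  have h4 := both (h1.seq h3) h2
  exact h4.seq (straight (by simp) h4.size_out fun i => by simp [Scheme.value])

end PT

end HyperMotif

namespace HyperMotif

/-! ### Arithmetic of natural numbers -/

namespace Prog

/-- On input `(a, b)`, the code of the pair of natural numbers. -/
def natPair : Prog :=
  ite (((tl.both hd)).seq (.basic .le))
    ((((hd.both hd).seq (.basic .mul)).both (hd.both tl |>.seq (.basic .add))).seq (.basic .add))
    ((((tl.both tl).seq (.basic .mul)).both hd).seq (.basic .add))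

def natSucc : Prog := (self.both (lit (.rat 1))).seq (.basic .add)

/-- On input `n`, the pair of `n` and the integer part of its square root. -/
def natSqrt : Prog :=
  (self.both (lit (.rat 0))).seq
    (.while (((((tl.seq natSucc).both (tl.seq natSucc)).seq (.basic .mul)).both hd).seq (.basic .le))
      (hd.both (tl.seq natSucc)))

/-- On input `n`, the pair of natural numbers with code `n`. -/
def natUnpair : Prog :=
  (natSqrt.seq (tl.both ((hd.both ((tl.both tl).seq (.basic .mul))).seq (.basic .sub)))).seq
    (ite (.basic .le) (hd.both ((tl.both hd).seq (.basic .sub))) (tl.both hd))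

end Prog

/-! ### Running times of the pairing function and its inverse -/

namespace PT

variable {ι : Type*} {m : ι → ℕ} {O : ι → Data → Data → Prop}

theorem natPair {a b : ι → ℕ} (h : PB m fun i => (Data.pair (.ofNat (a i)) (.ofNat (b i))).size) :
    PT m O .natPair (fun i => .pair (.ofNat (a i)) (.ofNat (b i)))
      (fun i => .ofNat (Nat.pair (a i) (b i))) := by
  refine straight (by simp [Prog.natPair]) h fun i => ?_
  simp only [Prog.natPair, Prog.eval, Data.ofNat, Instr.eval_snd_pair, Instr.eval_fst_pair,
    Instr.eval_le, Nat.cast_le, Instr.eval_mul, Instr.eval_add, Nat.pair]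
  by_cases h : a i < b i
  · simp [h, h.not_ge]
  · simp [h, not_lt.1 h, add_assoc]

/-- Counting up to the root takes `√n` rounds, so the time is polynomial in the value of `n` and not
in its length. This is affordable since arithmetic with codes is only done on data that depend on
the parameter side, never on `G`. -/
theorem natSqrt {n : ι → ℕ} (h : PB m n) :
    PT m O .natSqrt (fun i => .ofNat (n i))
      (fun i => .pair (.ofNat (n i)) (.ofNat (Nat.sqrt (n i)))) := by
  have hn : PB m fun i => (Data.ofNat (n i)).size :=
    (h.add (PB.const 2)).mono fun i => Data.size_ofNat_le _
  have hs : PB (fun x : {x : ι × ℕ // x.2 ≤ Nat.sqrt (n x.1)} => m x.1.1) fun x =>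
      (Data.pair (.ofNat (n x.1.1)) (.ofNat x.1.2)).size := by
    refine (((hn.add h).add (PB.const 3))).comp_le (fun x => x.1.1) fun x => ?_
    have h1 := Data.size_ofNat_le x.1.2
    have h2 := x.2.trans (Nat.sqrt_le_self _)
    simp only [Data.size_pair]
    omega
  refine seq (b := fun i => .pair (.ofNat (n i)) (.ofNat 0)) (straight (by simp) hn
    fun i => by simp [Data.ofNat]) ?_
  refine loop (fun i k => .pair (.ofNat (n i)) (.ofNat k))
    (fun i k => .rat (if k < Nat.sqrt (n i) then 1 else 0))
    (h.mono fun i => Nat.sqrt_le_self (n i)) ?_ ?_ ?_ ?_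
  · refine straight (by simp [Prog.natSucc]) hs fun x => ?_
    have : ((x.1.2 : ℚ) + 1) * (x.1.2 + 1) ≤ n x.1.1 ↔ x.1.2 < Nat.sqrt (n x.1.1) := by
      rw [Nat.lt_iff_add_one_le, Nat.le_sqrt]; norm_cast
    simp [Prog.natSucc, Data.ofNat, this]
  · refine straight (by simp [Prog.natSucc]) (hs.comp_le (fun x => ⟨x.1, x.2.le⟩) fun x => le_rfl)
      fun x => by simp [Prog.natSucc, Data.ofNat]
  · intro i k hk; simp [hk]
  · intro i; simp

theorem natUnpair {n : ι → ℕ} (h : PB m n) :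
    PT m O .natUnpair (fun i => .ofNat (n i))
      (fun i => .pair (.ofNat (n i).unpair.1) (.ofNat (n i).unpair.2)) := by
  have h1 := natSqrt (O := O) h
  have h2 := h1.seq (straight (p := .both .tl ((Prog.hd.both ((Prog.tl.both .tl).seq
    (.basic .mul))).seq (.basic .sub))) (b := fun i => .pair (.ofNat (n i).sqrt)
      (.ofNat (n i - (n i).sqrt * (n i).sqrt))) (by simp) h1.size_out fun i => by
        have := Nat.sqrt_le (n i)
        simp [Data.ofNat, Nat.cast_sub this])
  refine h2.seq (straight (by simp) h2.size_out fun i => ?_)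
  rw [Nat.unpair]
  by_cases h : n i - (n i).sqrt * (n i).sqrt < (n i).sqrt
  · have h' : ¬ (((n i).sqrt : ℚ) ≤ ((n i - (n i).sqrt * (n i).sqrt : ℕ) : ℚ)) := by
      rw [Nat.cast_le]; omega
    simp [h, Data.ofNat, h', -Nat.cast_le]
  · have h' : (((n i).sqrt : ℚ) ≤ ((n i - (n i).sqrt * (n i).sqrt : ℕ) : ℚ)) := by
      rw [Nat.cast_le]; omega
    simp only [Data.ofNat, Prog.eval, Instr.eval_le, h', if_true, h, if_false, Instr.eval_fst_pair,
      Instr.eval_snd_pair, Instr.eval_sub]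
    rw [Nat.cast_sub (by omega)]
    simp [h]

end PT

/-! ### Primitive recursive functions -/

/-- The program `p` transforms `a n` into `b n`, with any oracle, in time bounded by a primitive
recursive function of `n`. -/
def PrimrecTime (p : Prog) (a b : ℕ → Data) : Prop :=
  ∃ A : ℕ → ℕ, Primrec A ∧
    PT (fun x : (Data → Data → Prop) × ℕ => A x.2) Prod.fst p (fun x => a x.2) (fun x => b x.2)

theorem Primrec.sum_range {α : Type*} [Primcodable α] {F : α → ℕ → ℕ} {N : α → ℕ}
    (hF : Primrec₂ F) (hN : Primrec N) : Primrec fun n => ∑ i ∈ Finset.range (N n), F n i := by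
  refine (Primrec.nat_rec' (f := N) (g := fun _ => 0) (h := fun n p => p.2 + F n p.1) hN
    (.const 0) (Primrec.nat_add.comp₂ (Primrec.snd.comp₂ .right)
      (hF.comp₂ .left (Primrec.fst.comp₂ .right)))).of_eq fun n => ?_
  induction N n with
  | zero => rfl
  | succ k ih => simp only [ih, Finset.sum_range_succ]

theorem Primrec.nat_pow : Primrec₂ ((· ^ ·) : ℕ → ℕ → ℕ) := Primrec₂.unpaired'.1 Nat.Primrec.pow

namespace PrimrecTime

variable {p q : Prog} {a b d : ℕ → Data}

theorem seq (hp : PrimrecTime p a b) (hq : PrimrecTime q b d) : PrimrecTime (.seq p q) a d := by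
  obtain ⟨A, hA, hp⟩ := hp
  obtain ⟨B, hB, hq⟩ := hq
  exact ⟨fun n => A n + B n, Primrec.nat_add.comp hA hB,
    (hp.measure (PB.self.mono fun x => by simp)).seq (hq.measure (PB.self.mono fun x => by simp))⟩

theorem both (hp : PrimrecTime p a b) (hq : PrimrecTime q a d) :
    PrimrecTime (.both p q) a (fun n => .pair (b n) (d n)) := by
  obtain ⟨A, hA, hp⟩ := hp
  obtain ⟨B, hB, hq⟩ := hq
  exact ⟨fun n => A n + B n, Primrec.nat_add.comp hA hB,
    (hp.measure (PB.self.mono fun x => by simp)).both (hq.measure (PB.self.mono fun x => by simp))⟩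

theorem comp {f : ℕ → ℕ} (hp : PrimrecTime p a b) (hf : Primrec f) :
    PrimrecTime p (fun n => a (f n)) (fun n => b (f n)) := by
  obtain ⟨A, hA, hp⟩ := hp
  exact ⟨fun n => A (f n), hA.comp hf, hp.comp fun x : (Data → Data → Prop) × ℕ => (x.1, f x.2)⟩

end PrimrecTime

theorem PB.size_ofNat {ι : Type*} {m n : ι → ℕ} (h : PB m n) :
    PB m fun i => (Data.ofNat (n i)).size :=
  (h.add (PB.const 2)).mono fun _ => Data.size_ofNat_le _

theorem primrecTime_natPair {f g : ℕ → ℕ} (hf : Primrec f) (hg : Primrec g) :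
    PrimrecTime .natPair (fun n => .pair (.ofNat (f n)) (.ofNat (g n)))
      (fun n => .ofNat (Nat.pair (f n) (g n))) := by
  refine ⟨fun n => f n + g n, Primrec.nat_add.comp hf hg, PT.natPair ?_⟩
  refine (PB.self.add (PB.const 5)).mono fun x => ?_
  have := Data.size_ofNat_le (f x.2)
  have := Data.size_ofNat_le (g x.2)
  simp only [Data.size_pair]
  omega

/-- Every primitive recursive function is computed by a program in primitive recursive time. -/
theorem exists_primrecTime {f : ℕ → ℕ} (hf : Nat.Primrec f) :
    ∃ p, PrimrecTime p Data.ofNat (fun n => .ofNat (f n)) := by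
  have hself : PB (fun x : (Data → Data → Prop) × ℕ => x.2) fun x => (Data.ofNat x.2).size :=
    PB.self.size_ofNat
  induction hf with
  | zero => exact ⟨.lit (.rat 0), id, .id, .straight (by simp) hself fun x => by simp [Data.ofNat]⟩
  | succ =>
    exact ⟨.natSucc, id, .id, .straight (by simp [Prog.natSucc]) hself fun x => by
      simp [Prog.natSucc, Data.ofNat]⟩
  | left =>
    have h := PT.natUnpair (O := Prod.fst) (PB.self (m := fun x : (Data → Data → Prop) × ℕ => x.2))
    exact ⟨.seq .natUnpair .hd, id, .id, h.seq (.straight trivial h.size_out fun x => by simp)⟩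
  | right =>
    have h := PT.natUnpair (O := Prod.fst) (PB.self (m := fun x : (Data → Data → Prop) × ℕ => x.2))
    exact ⟨.seq .natUnpair .tl, id, .id, h.seq (.straight trivial h.size_out fun x => by simp)⟩
  | pair hf hg ihf ihg =>
    obtain ⟨p, hp⟩ := ihf
    obtain ⟨q, hq⟩ := ihg
    exact ⟨_, (hp.both hq).seq (primrecTime_natPair (Primrec.nat_iff.2 hf) (Primrec.nat_iff.2 hg))⟩
  | comp hf hg ihf ihg =>
    obtain ⟨p, hp⟩ := ihf
    obtain ⟨q, hq⟩ := ihg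
    exact ⟨_, hq.seq (hp.comp (Primrec.nat_iff.2 hg))⟩
  | @prec f g hf hg ihf ihg =>
    obtain ⟨p, A, hA, hp⟩ := ihf
    obtain ⟨q, B, hB, hq⟩ := ihg
    -- `R n y` is the value after `y` rounds of the recursion on the packed argument `n = (z,
    -- y_max)`; the state of the loop is `(z, (y_max, (y, R n y)))`.
    let R : ℕ → ℕ → ℕ := fun n y =>
      Nat.rec (f n.unpair.1) (fun y IH => g (Nat.pair n.unpair.1 (Nat.pair y IH))) y
    have hz : Primrec fun n : ℕ => n.unpair.1 := Primrec.fst.comp .unpair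
    have hR : Primrec₂ R := by
      refine Primrec.nat_rec (f := fun n : ℕ => f n.unpair.1)
        (g := fun (n : ℕ) p => g (Nat.pair n.unpair.1 (Nat.pair p.1 p.2))) ((Primrec.nat_iff.2 hf).comp hz) ?_
      exact (Primrec.nat_iff.2 hg).comp (Primrec₂.natPair.comp (hz.comp .fst)
        (Primrec₂.natPair.comp (Primrec.fst.comp .snd) (Primrec.snd.comp .snd)))
    let S : ℕ → ℕ → ℕ := fun n y => R n y + B (Nat.pair n.unpair.1 (Nat.pair y (R n y)))
    have hS : Primrec₂ S := Primrec.nat_add.comp hR (hB.comp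
        (Primrec₂.natPair.comp (hz.comp .fst) (Primrec₂.natPair.comp .snd hR)))
    -- The measure dominates the argument, the time of the base case, and the value and time of
    -- every round. Summing up to `n` suffices because the second component of `n` is at most `n`.
    let M : ℕ → ℕ := fun n => n + A n.unpair.1 + ∑ y ∈ Finset.range (n + 1), S n y
    have hM : Primrec M := Primrec.nat_add.comp (Primrec.nat_add.comp .id (hA.comp hz))
      (Primrec.sum_range hS Primrec.succ)
    have hSM {n y : ℕ} (hy : y ≤ n) : S n y ≤ M n := by
      have := Finset.single_le_sum (f := S n) (fun _ _ => Nat.zero_le _)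
        (Finset.mem_range.2 (show y < n + 1 by omega))
      simp only [M]
      omega
    let Orc := Data → Data → Prop
    let st : Orc × ℕ → ℕ → Data := fun x y =>
      .pair (.ofNat x.2.unpair.1) (.pair (.ofNat x.2.unpair.2) (.pair (.ofNat y) (.ofNat (R x.2 y))))
    have hst : PB (fun x : {x : (Orc × ℕ) × ℕ // x.2 ≤ x.1.2.unpair.2} => M x.1.1.2)
        fun x => (st x.1.1 x.1.2).size := by
      refine ((PB.self.const_mul 10).add (PB.const 20)).mono fun x => ?_
      have h1 := Nat.unpair_left_le x.1.1.2
      have h2 := Nat.unpair_right_le x.1.1.2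
      have h3 := hSM (x.2.trans h2)
      have h4 := Data.size_ofNat_le x.1.1.2.unpair.1
      have h5 := Data.size_ofNat_le x.1.1.2.unpair.2
      have h6 := Data.size_ofNat_le x.1.2
      have h7 := Data.size_ofNat_le (R x.1.1.2 x.1.2)
      have h8 := x.2
      have h9 : x.1.1.2 ≤ M x.1.1.2 := by simp only [M]; omega
      simp only [S] at h3
      simp only [st, Data.size_pair]
      omega
    have hlt (x : {x : (Orc × ℕ) × ℕ // x.2 < x.1.2.unpair.2}) : x.1.2 ≤ x.1.1.2.unpair.2 := x.2.le
    have hst' : PB (fun x : {x : (Orc × ℕ) × ℕ // x.2 < x.1.2.unpair.2} => M x.1.1.2)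
        fun x => (st x.1.1 x.1.2).size := hst.comp_le (fun x => ⟨x.1, hlt x⟩) fun x => le_rfl
    have hself' : PB (fun x : Orc × ℕ => M x.2) fun x => x.2 :=
      PB.self.mono fun x => by simp only [M]; omega
    have h1 := PT.natUnpair (O := Prod.fst) hself'
    have h2 := h1.size_out
    have h3 : PT (fun x : Orc × ℕ => M x.2) Prod.fst (.seq .hd p)
        (fun x => .pair (.ofNat x.2.unpair.1) (.ofNat x.2.unpair.2)) (fun x => .ofNat (R x.2 0)) :=
      PT.seq (.straight (p := .hd) (b := fun x => .ofNat x.2.unpair.1) (by simp) h2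
        fun x => by simp) ((hp.comp fun x : Orc × ℕ => (x.1, x.2.unpair.1)).measure
          (PB.self.mono fun x => by simp only [M]; omega))
    have h4 := h1.seq (.both (.straight (p := .hd) (b := fun x => .ofNat x.2.unpair.1) (by simp) h2
      fun x => by simp) (.both (.straight (p := .tl) (b := fun x => .ofNat x.2.unpair.2) (by simp) h2
      fun x => by simp) (.both (.straight (p := .lit (.rat 0)) (b := fun x => .ofNat 0) (by simp) h2
      fun x => by simp [Data.ofNat]) h3)))
    have h5 : PT (fun x : {x : (Orc × ℕ) × ℕ // x.2 < x.1.2.unpair.2} => M x.1.1.2)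
        (fun x => x.1.1.1) (((Prog.hd.both (Prog.tl.seq (Prog.tl.seq .natPair))).seq .natPair).seq q)
        (fun x => st x.1.1 x.1.2) (fun x => .ofNat (R x.1.1.2 (x.1.2 + 1))) := by
      have h6 : PT (fun x : {x : (Orc × ℕ) × ℕ // x.2 < x.1.2.unpair.2} => M x.1.1.2)
        (fun x => x.1.1.1) (Prog.hd.both (Prog.tl.seq (Prog.tl.seq .natPair)))
        (fun x => st x.1.1 x.1.2) (fun x => .pair (.ofNat x.1.1.2.unpair.1)
          (.ofNat (Nat.pair x.1.2 (R x.1.1.2 x.1.2)))) := by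
        refine .both (.straight (by simp) hst' fun x => by simp [st]) (PT.seq (.straight
          (b := fun x => .pair (.ofNat x.1.1.2.unpair.2) (.pair (.ofNat x.1.2)
            (.ofNat (R x.1.1.2 x.1.2)))) (by simp) hst' fun x => by simp [st]) (PT.seq (.straight
          (b := fun x => .pair (.ofNat x.1.2) (.ofNat (R x.1.1.2 x.1.2))) (by simp)
            (hst'.mono fun x => ?_) fun x => by simp) (PT.natPair (hst'.mono fun x => ?_))))
        all_goals
          simp only [st, Data.size_pair]
          omega
      refine PT.seq (h6.seq (PT.natPair h6.size_out)) ((hq.comp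
        fun x : {x : (Orc × ℕ) × ℕ // x.2 < x.1.2.unpair.2} => (x.1.1.1,
          Nat.pair x.1.1.2.unpair.1 (Nat.pair x.1.2 (R x.1.1.2 x.1.2)))).measure
            (PB.self.mono fun x => ?_))
      have := hSM ((hlt x).trans (Nat.unpair_right_le _))
      exact (Nat.le_add_left _ _).trans this
    have h6 := PT.loop (m := fun x : Orc × ℕ => M x.2) (O := Prod.fst) (N := fun x => x.2.unpair.2)
      (c := ((Prog.tl.seq (Prog.tl.seq (Prog.hd.seq .natSucc))).both (Prog.tl.seq .hd)).seq
        (.basic .le)) (p := Prog.hd.both ((Prog.tl.seq .hd).both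
          ((Prog.tl.seq (Prog.tl.seq (Prog.hd.seq .natSucc))).both _))) st
      (fun x k => .rat (if k < x.2.unpair.2 then 1 else 0))
      (hself'.mono fun x => Nat.unpair_right_le _) ?_
      (.both (.straight (b := fun x => .ofNat x.1.1.2.unpair.1) (by simp) hst'
          fun x => by simp [st])
        (.both (.straight (b := fun x => .ofNat x.1.1.2.unpair.2) (by simp) hst'
          fun x => by simp [st])
        (.both (.straight (b := fun x => .ofNat (x.1.2 + 1)) (by simp [Prog.natSucc]) hst'
          fun x => by simp [st, Prog.natSucc, Data.ofNat]) h5)))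
      (by intro x k hk; simp [hk]) (by simp)
    · have h7 := h4.seq h6
      exact ⟨_, M, hM, h7.seq (.straight (p := Prog.tl.seq (Prog.tl.seq .tl)) (by simp) h7.size_out
        fun x => by simp [st, R])⟩
    · refine .straight (by simp [Prog.natSucc]) hst fun x => ?_
      have : ((x.1.2 : ℚ) + 1 ≤ x.1.1.2.unpair.2) ↔ x.1.2 < x.1.1.2.unpair.2 := by
        rw [Nat.lt_iff_add_one_le]; norm_cast
      simp [Prog.natSucc, Data.ofNat, st, this]

end HyperMotif

namespace HyperMotif

open Encodable

/-! ### Coding hypergraphs by natural numbers -/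

namespace Prog

/-- The length of a list. -/
def length : Prog := ((lit (.rat 0)).both ((lit (.rat 0)).both self)).seq (fold ((tl.seq hd).seq natSucc))

/-- The code of a list, where `p` computes the codes of its entries. -/
def encodeList (p : Prog) : Prog :=
  (((self.both (lit (.rat 0))).seq revAppend).seq
    ((lit (.rat 0)).both ((lit (.rat 0)).both self))).seq
    (fold (((((tl.seq tl).seq p).both (tl.seq hd)).seq natPair).seq natSucc))

/-- The code of a hypergraph. -/
def encodeHypergraph : Prog :=
  ((hd.seq length).both (tl.seq (encodeList (encodeList self)))).seq natPair

/-- On input `n`, search for the least `k` such that the value computed by `p` on the code of the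
pair `(n, k)` is zero. -/
def search (p : Prog) : Prog :=
  ((self.both (lit (.rat 0))).seq (.while (natPair.seq p) (hd.both (tl.seq natSucc)))).seq tl

end Prog

theorem encode_le_of_suffix {α : Type*} [Encodable α] {u l : List α} (h : u <:+ l) :
    encode u ≤ encode l := by
  induction l with
  | nil => rw [List.suffix_nil.1 h]
  | cons a l ih =>
    rcases List.suffix_cons_iff.1 h with rfl | h
    · rfl
    · rw [encode_list_cons]
      exact (ih h).trans ((Nat.right_le_pair _ _).trans (Nat.le_succ _))

theorem encode_le_of_mem {α : Type*} [Encodable α] {a : α} {l : List α} (h : a ∈ l) :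
    encode a ≤ encode l := by
  induction l with
  | nil => simp at h
  | cons b l ih =>
    rw [encode_list_cons]
    rcases List.mem_cons.1 h with rfl | h
    · exact (Nat.left_le_pair _ _).trans (Nat.le_succ _)
    · exact (ih h).trans ((Nat.right_le_pair _ _).trans (Nat.le_succ _))

/-! ### Running times of coding and of unbounded search -/

namespace PT

variable {ι α : Type*} {m : ι → ℕ} {O : ι → Data → Data → Prop} {p : Prog}

theorem natSucc {n : ι → ℕ} (h : PB m fun i => (Data.ofNat (n i)).size) :
    PT m O .natSucc (fun i => .ofNat (n i)) (fun i => .ofNat (n i + 1)) :=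
  straight (by simp [Prog.natSucc]) h fun i => by simp [Prog.natSucc, Data.ofNat]

theorem length {l : ι → List Data} (h : PB m fun i => (Data.ofList (l i)).size) :
    PT m O .length (fun i => .ofList (l i)) (fun i => .ofNat (l i).length) := by
  have hfold (u : List Data) (k : ℕ) : u.foldl (fun b _ => b + 1) k = k + u.length := by
    induction u generalizing k with
    | nil => rfl
    | cons a u ih => rw [List.foldl_cons, ih, List.length_cons]; omega
  refine seq (b := fun i => .pair (.rat 0) (.pair (.ofNat 0) (.ofList (l i)))) (straight (by simp) h
    fun i => by simp [Data.ofNat]) ?_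
  refine congr (fold (env := fun _ => .rat 0) (l := l) (ea := id) (eb := Data.ofNat)
    (step := fun _ b _ => b + 1) (b₀ := fun _ => 0) (PB.const _) (by simpa using h)
    (PB.const _) ?_) (fun i => by simp) (fun i => by rw [hfold, zero_add])
  simp only [hfold]
  refine straight (by simp [Prog.natSucc]) ?_ fun x => by simp [Prog.natSucc, Data.ofNat]
  refine ((h.const_mul 2).add (PB.const 10)).comp_le (fun x => x.1.1) fun x => ?_
  have h1 : x.1.2.1.length ≤ _ :=
    ((List.sublist_append_left x.1.2.1 [x.1.2.2]).trans x.2.sublist).length_le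
  have h2 := Data.length_le_size_ofList (l x.1.1)
  have h3 := Data.size_ofNat_le (0 + x.1.2.1.length)
  have h4 : x.1.2.2.size ≤ _ := Data.size_le_size_ofList (x.2.subset (by simp))
  simp only [Data.size_pair, Data.size_rat_zero, id]
  omega

/-- Nested pairing makes codes grow very fast with the length of the list, so the code itself is
required to be bounded in terms of the measure. Only the pattern hypergraph is ever coded this way.
-/
theorem encodeList [Encodable α] {l : ι → List α} {ea : α → Data}
    (hm : PB m fun i => encode (l i)) (hl : PB m fun i => (Data.ofList ((l i).map ea)).size)
    (hp : PT (fun x : {x : ι × α // x.2 ∈ l x.1} => m x.1.1) (fun x => O x.1.1) p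
      (fun x => ea x.1.2) (fun x => .ofNat (encode x.1.2))) :
    PT m O (.encodeList p) (fun i => .ofList ((l i).map ea)) (fun i => .ofNat (encode (l i))) := by
  have hfold (u : List α) : u.foldl (fun b a => Nat.succ (Nat.pair (encode a) b)) 0 =
      encode u.reverse := by
    induction u using List.reverseRecOn with
    | nil => rfl
    | append_singleton u a ih => simp [ih]
  have h1 := (straight (O := O) (p := Prog.self.both (.lit (.rat 0)))
    (b := fun i => .pair (.ofList ((l i).map ea)) (.ofList [])) (by simp) hl fun i => by simp).seq
    (revAppend hl (PB.const _))
  have h2 := h1.seq (straight (p := (Prog.lit (.rat 0)).both ((Prog.lit (.rat 0)).both .self))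
    (b := fun i => .pair (.rat 0) (.pair (.ofNat 0) (.ofList ((l i).reverse.map ea)))) (by simp)
    h1.size_out fun i => by simp [Data.ofNat])
  have hl' : PB m fun i => (Data.ofList ((l i).reverse.map ea)).size :=
    hl.mono fun i => by rw [List.map_reverse, Data.size_ofList_reverse]
  refine h2.seq (congr (fold (env := fun _ => .rat 0) (l := fun i => (l i).reverse) (ea := ea)
    (eb := Data.ofNat) (step := fun _ b a => Nat.succ (Nat.pair (encode a) b)) (b₀ := fun _ => 0)
    (PB.const _) hl' (PB.const _) ?_) (fun i => by simp)
    (fun i => by rw [hfold, List.reverse_reverse]))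
  have hmem (x : {x : ι × List α × α // x.2.1 ++ [x.2.2] <+: (l x.1).reverse}) :
      x.1.2.2 ∈ l x.1.1 := List.mem_reverse.1 (x.2.subset (by simp))
  have hsuf (x : {x : ι × List α × α // x.2.1 ++ [x.2.2] <+: (l x.1).reverse}) :
      x.1.2.1.reverse <:+ l x.1.1 := by
    rw [← List.reverse_prefix, List.reverse_reverse]
    exact (List.prefix_append _ _).trans x.2
  simp only [hfold]
  have hin : PB (fun x : {x : ι × List α × α // x.2.1 ++ [x.2.2] <+: (l x.1).reverse} => m x.1.1)
      fun x => (Data.pair (.rat 0) (.pair (.ofNat (encode x.1.2.1.reverse)) (ea x.1.2.2))).size := by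
    refine ((hm.add hl).add (PB.const 10)).comp_le (fun x => x.1.1) fun x => ?_
    have h3 := Data.size_ofNat_le (encode x.1.2.1.reverse)
    have h4 := encode_le_of_suffix (hsuf x)
    have h5 := Data.size_le_size_ofList (List.mem_map_of_mem (f := ea) (hmem x))
    simp only [Data.size_pair, Data.size_rat_zero]
    omega
  have h3 := (straight (O := fun x => O x.1.1) (p := Prog.tl.seq .tl) (b := fun x => ea x.1.2.2)
    (by simp) hin fun x => by simp).seq
    (hp.comp fun x : {x : ι × List α × α // x.2.1 ++ [x.2.2] <+: (l x.1).reverse} =>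
      ⟨(x.1.1, x.1.2.2), hmem x⟩)
  have h4 := h3.both (straight (O := fun x => O x.1.1) (p := Prog.tl.seq .hd)
    (b := fun x => .ofNat (encode x.1.2.1.reverse)) (by simp) hin fun x => by simp)
  have h5 := h4.seq (natPair h4.size_out)
  exact h5.seq (natSucc h5.size_out)

theorem encodeHypergraph {c : ι → HypergraphCode} (hm : PB m fun i => encode (c i))
    (hc : PB m fun i => (Data.ofHypergraph (c i)).size) :
    PT m O .encodeHypergraph (fun i => .ofHypergraph (c i)) (fun i => .ofNat (encode (c i))) := by
  have hm2 : PB m fun i => encode (c i).2 := hm.mono fun i => by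
    rw [encode_prod_val]; exact Nat.right_le_pair _ _
  have hc2 : PB m fun i => (Data.ofList ((c i).2.map Data.ofEdge)).size := hc.mono fun i => by
    simp only [Data.ofHypergraph, Data.size_pair]
    exact (Nat.le_add_left _ _).trans (Nat.le_succ _)
  have hc1 : PB m fun i => (Data.ofList ((List.range (c i).1).map Data.ofNat)).size :=
    hc.mono fun i => by
      simp only [Data.ofHypergraph, Data.size_pair]
      omega
  have h1 := (straight (O := O) (p := .hd)
    (b := fun i => .ofList ((List.range (c i).1).map Data.ofNat)) (by simp) hc
    fun i => by simp [Data.ofHypergraph]).seq (length hc1)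
  have h2 := (straight (O := O) (p := .tl)
    (b := fun i => .ofList ((c i).2.map Data.ofEdge)) (by simp) hc
    fun i => by simp [Data.ofHypergraph]; rfl).seq (encodeList (p := .encodeList .self) hm2 hc2 (by
      have hB : PB (fun x : {x : ι × List ℕ // x.2 ∈ (c x.1).2} => m x.1.1)
          fun x => (Data.ofEdge x.1.2).size :=
        hc2.comp_le (fun x => x.1.1) fun x =>
          Data.size_le_size_ofList (List.mem_map_of_mem (f := Data.ofEdge) x.2)
      refine encodeList (l := fun x : {x : ι × List ℕ // x.2 ∈ (c x.1).2} => x.1.2) (ea := Data.ofNat)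
        (hm2.comp_le (fun x => x.1.1) fun x => encode_le_of_mem x.2) hB ?_
      exact straight (by simp) (hB.comp_le (fun x => x.1.1) fun x =>
          Data.size_le_size_ofList (List.mem_map_of_mem (f := Data.ofNat) x.2)) fun x => by simp))
  have h3 := h1.both h2
  refine (h3.seq ((natPair (a := fun i => (c i).1) (b := fun i => encode (c i).2)
    (h3.size_out.mono fun i => ?_)).congr (fun i => by simp) fun i => rfl)).congr (fun i => rfl)
      fun i => ?_
  · simp
  · rw [encode_prod_val]; rfl

/-- Searching for a zero of a function that is computed in time `A`. -/
theorem search {f : ℕ → ℕ} {A : ℕ → ℕ}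
    (hp : PT (fun x : (Data → Data → Prop) × ℕ => A x.2) Prod.fst p (fun x => .ofNat x.2)
      (fun x => .ofNat (f x.2))) {n k : ι → ℕ} (hn : PB m n) (hk : PB m k)
    (hA : PB (fun x : {x : ι × ℕ // x.2 ≤ k x.1} => m x.1.1) fun x => A (Nat.pair (n x.1.1) x.1.2))
    (h0 : ∀ i, f (Nat.pair (n i) (k i)) = 0) (h1 : ∀ i, ∀ j < k i, f (Nat.pair (n i) j) ≠ 0) :
    PT m O (.search p) (fun i => .ofNat (n i)) (fun i => .ofNat (k i)) := by
  have hst : PB (fun x : {x : ι × ℕ // x.2 ≤ k x.1} => m x.1.1) fun x =>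
      (Data.pair (.ofNat (n x.1.1)) (.ofNat x.1.2)).size := by
    refine ((hn.add hk).add (PB.const 5)).comp_le (fun x => x.1.1) fun x => ?_
    have := Data.size_ofNat_le (n x.1.1)
    have := Data.size_ofNat_le x.1.2
    have := x.2
    simp only [Data.size_pair]
    omega
  refine seq (seq (b := fun i => .pair (.ofNat (n i)) (.ofNat 0)) (straight (by simp)
    hn.size_ofNat fun i => by simp [Data.ofNat]) (loop
      (fun i j => .pair (.ofNat (n i)) (.ofNat j)) (fun i j => .ofNat (f (Nat.pair (n i) j))) hk
      ((natPair hst).seq ((hp.comp fun x : {x : ι × ℕ // x.2 ≤ k x.1} =>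
        (O x.1.1, Nat.pair (n x.1.1) x.1.2)).measure hA)) ?_ ?_ ?_)) ?_
  · exact straight (by simp [Prog.natSucc]) (hst.comp_le (fun x => ⟨x.1, x.2.le⟩) fun x => le_rfl)
      fun x => by simp [Prog.natSucc, Data.ofNat]
  · intro i j hj
    simpa [Data.ofNat] using h1 i j hj
  · intro i
    simp [h0, Data.ofNat]
  · exact straight (by simp) (hst.comp_le (fun i => ⟨(i, k i), le_rfl⟩) fun i => le_rfl)
      fun i => by simp

end PT

/-! ### Building data from natural numbers

Lists of natural numbers are read as programs of a stack machine that builds data. -/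

namespace Prog

/-- On input `(n, s)`, the effect of the operation `n` on the stack `s`: combine or subtract or
divide the two topmost entries, or push `n - 3`. -/
def stackStep : Prog :=
  ite ((hd.both (lit (.rat 2))).seq (.basic .le))
    (ite ((hd.both (lit (.rat 0))).seq (.basic .le))
      (((tl.seq hd).both (tl.seq (tl.seq hd))).both (tl.seq (tl.seq tl)))
      (ite ((hd.both (lit (.rat 1))).seq (.basic .le))
        ((((tl.seq hd).both (tl.seq (tl.seq hd))).seq (.basic .sub)).both (tl.seq (tl.seq tl)))
        ((((tl.seq hd).both (tl.seq (tl.seq hd))).seq (.basic .div)).both (tl.seq (tl.seq tl)))))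
    (((hd.both (lit (.rat 3))).seq (.basic .sub)).both tl)

/-- Decode a list of operations and run the stack machine on it. -/
def build : Prog :=
  ((self.both (lit (.rat 0))).seq (.while hd
    ((((hd.both (lit (.rat 1))).seq (.basic .sub)).seq natUnpair |>.both tl).seq
      ((hd.seq tl).both (((hd.seq hd).both tl).seq stackStep))))).seq (tl.seq hd)

theorem straight_stackStep : stackStep.Straight := by simp [stackStep]

end Prog

/-- The effect of a list of operations on a stack. -/
noncomputable def stackRun (l : List ℕ) (s : Data) : Data :=
  l.foldl (fun s n => Prog.stackStep.eval (.pair (.ofNat n) s)) s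

@[simp] theorem stackRun_nil (s : Data) : stackRun [] s = s := rfl

theorem stackRun_append (l l' : List ℕ) (s : Data) :
    stackRun (l ++ l') s = stackRun l' (stackRun l s) := List.foldl_append

theorem stackRun_cons (n : ℕ) (l : List ℕ) (s : Data) :
    stackRun (n :: l) s = stackRun l (Prog.stackStep.eval (.pair (.ofNat n) s)) := rfl

@[simp] theorem stackRun_pair (a b s : Data) :
    stackRun [0] (.pair a (.pair b s)) = .pair (.pair a b) s := by
  simp [stackRun, Prog.stackStep, Data.ofNat]

@[simp] theorem stackRun_sub (a b : ℚ) (s : Data) :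
    stackRun [1] (.pair (.rat a) (.pair (.rat b) s)) = .pair (.rat (a - b)) s := by
  simp [stackRun, Prog.stackStep, Data.ofNat]

@[simp] theorem stackRun_div (a b : ℚ) (s : Data) :
    stackRun [2] (.pair (.rat a) (.pair (.rat b) s)) = .pair (.rat (a / b)) s := by
  simp [stackRun, Prog.stackStep, Data.ofNat]

@[simp] theorem stackRun_push (n : ℕ) (s : Data) :
    stackRun [n + 3] s = .pair (.ofNat n) s := by
  simp [stackRun, Prog.stackStep, Data.ofNat]

/-- This is the bridge from arithmetic to data: primitive recursive functions output only numbers,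
which are decoded to operation lists and executed. An operation multiplies the length of the stack
by at most a constant, once the pushed number is accounted for, so the time is at most singly
exponential in the code up to polynomial factors and has a primitive recursive bound. -/
theorem primrecTime_build :
    ∃ A : ℕ → ℕ, Primrec A ∧ PT (fun x : (Data → Data → Prop) × List ℕ => A (encode x.2)) Prod.fst
      .build (fun x => .ofNat (encode x.2)) (fun x => Instr.fst.eval (stackRun x.2 (.rat 0))) := by
  obtain ⟨C, hC⟩ := Prog.straight_stackStep.run
  let A : ℕ → ℕ := fun n => (C + 1) ^ n * (n + 7) + n
  have hA : Primrec A := Primrec.nat_add.comp (Primrec.nat_mul.comp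
    (Primrec.nat_pow.comp (.const _) .id) (Primrec.nat_add.comp .id (.const _))) .id
  -- The summand `n + 5` on the left absorbs the length of the operand pushed in the next round, so
  -- that the induction closes with the factor `C + 1`.
  have hsize (n : ℕ) (u : List ℕ) (hu : ∀ a ∈ u, a ≤ n) :
      (stackRun u (.rat 0)).size + n + 5 ≤ (C + 1) ^ u.length * (n + 7) := by
    induction u using List.reverseRecOn with
    | nil => simp; omega
    | append_singleton u a ih =>
      have h1 := ih fun b hb => hu b (by simp [hb])
      have h2 := (hC (fun _ _ => False) (.pair (.ofNat a) (stackRun u (.rat 0)))).1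
      have h3 := Data.size_ofNat_le a
      have h4 := hu a (by simp)
      rw [stackRun_append, stackRun_cons, stackRun_nil, List.length_append, List.length_singleton,
        pow_succ]
      have h5 : (Data.pair (.ofNat a) (stackRun u (.rat 0))).size ≤
          (stackRun u (.rat 0)).size + n + 5 := by
        simp only [Data.size_pair]; omega
      have h6 := h2.trans (Nat.mul_le_mul_left C h5)
      nlinarith
  let Orc := Data → Data → Prop
  refine ⟨A, hA, ?_⟩
  have hst : PB (fun x : {x : (Orc × List ℕ) × ℕ // x.2 ≤ x.1.2.length} => A (encode x.1.1.2))
      fun x => (Data.pair (.ofNat (encode (x.1.1.2.drop x.1.2)))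
        (stackRun (x.1.1.2.take x.1.2) (.rat 0))).size := by
    refine ((PB.self.const_mul 2).add (PB.const 5)).mono fun x => ?_
    have h1 := hsize (encode x.1.1.2) (x.1.1.2.take x.1.2) fun a ha =>
      encode_le_of_mem (List.mem_of_mem_take ha)
    have h2 : (C + 1) ^ (x.1.1.2.take x.1.2).length ≤ (C + 1) ^ encode x.1.1.2 :=
      Nat.pow_le_pow_right (by omega) ((List.length_take_le _ _).trans
        (x.2.trans (length_le_encode _)))
    have h3 := h1.trans (Nat.mul_le_mul_right _ h2)
    have h4 := Data.size_ofNat_le (encode (x.1.1.2.drop x.1.2))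
    have h5 := encode_le_of_suffix (x.1.1.2.drop_suffix x.1.2)
    simp only [Data.size_pair, A]
    omega
  have hst' : PB (fun x : {x : (Orc × List ℕ) × ℕ // x.2 < x.1.2.length} => A (encode x.1.1.2))
      fun x => (Data.pair (.ofNat (encode (x.1.1.2.drop x.1.2)))
        (stackRun (x.1.1.2.take x.1.2) (.rat 0))).size :=
    hst.comp_le (fun x => ⟨x.1, x.2.le⟩) fun x => le_rfl
  have hself : PB (fun x : Orc × List ℕ => A (encode x.2)) fun x => encode x.2 :=
    PB.self.mono fun x => by simp only [A]; omega
  have hdrop (x : {x : (Orc × List ℕ) × ℕ // x.2 < x.1.2.length}) :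
      encode (x.1.1.2.drop x.1.2) = Nat.pair (x.1.1.2[x.1.2]'x.2)
        (encode (x.1.1.2.drop (x.1.2 + 1))) + 1 := by
    rw [List.drop_eq_getElem_cons x.2, encode_list_cons]; rfl
  have key := PT.loop (m := fun x : Orc × List ℕ => A (encode x.2)) (O := Prod.fst)
    (N := fun x => x.2.length) (c := .hd)
    (p := ((((Prog.hd.both (.lit (.rat 1))).seq (.basic .sub)).seq .natUnpair).both .tl).seq
      ((Prog.hd.seq .tl).both (((Prog.hd.seq .hd).both .tl).seq .stackStep)))
    (fun x k => .pair (.ofNat (encode (x.2.drop k))) (stackRun (x.2.take k) (.rat 0)))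
    (fun x k => .ofNat (encode (x.2.drop k)))
    (hself.mono fun x => length_le_encode _) (.straight (by simp) hst fun x => by simp) ?_ ?_ ?_
  · refine PT.seq (PT.seq (b := fun x => .pair (.ofNat (encode x.2)) (.rat 0)) (.straight (by simp)
      hself.size_ofNat fun x => by simp) (key.congr (fun x => by simp) fun x => rfl)) ?_
    exact .straight (by simp) (hst.comp_le (fun x => ⟨(x, x.2.length), le_rfl⟩) fun x => le_rfl)
      fun x => by simp
  · have h1 := (PT.straight (O := fun x => x.1.1.1) (p := (Prog.hd.both (.lit (.rat 1))).seq (.basic .sub))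
      (b := fun x => .ofNat (Nat.pair (x.1.1.2[x.1.2]'x.2) (encode (x.1.1.2.drop (x.1.2 + 1)))))
      (by simp) hst' fun x => by simp [hdrop, Data.ofNat]).seq (PT.natUnpair (PB.self.mono fun x => ?_))
    · have h2 := h1.both (PT.straight (O := fun x => x.1.1.1) (p := .tl)
        (b := fun x => stackRun (x.1.1.2.take x.1.2) (.rat 0)) (by simp) hst' fun x => by simp)
      refine h2.seq (.straight (by simp [Prog.straight_stackStep]) h2.size_out fun x => ?_)
      have h3 : stackRun (x.1.1.2.take (x.1.2 + 1)) (.rat 0) = Prog.stackStep.eval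
          (.pair (.ofNat (x.1.1.2[x.1.2]'x.2)) (stackRun (x.1.1.2.take x.1.2) (.rat 0))) := by
        rw [← List.take_append_getElem x.2, stackRun_append]; rfl
      rw [h3]
      simp [-List.take_append_getElem]
    · have h2 := encode_le_of_suffix (x.1.1.2.drop_suffix x.1.2)
      have h3 := hdrop x
      have : encode x.1.1.2 ≤ A (encode x.1.1.2) := by simp only [A]; omega
      omega
  · intro x k hk
    rw [hdrop ⟨(x, k), hk⟩]
    simp only [Data.ofNat, ne_eq, Data.rat.injEq]
    norm_cast
  · intro x
    simp [Data.ofNat]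

end HyperMotif

namespace HyperMotif

/-! ### Homomorphism counts determine a hypergraph -/

instance (H : FiniteHypergraph) : Finite H.vertexSet := H.finite_vertexSet.to_subtype

theorem FiniteHypergraph.finite_edgeSet (H : FiniteHypergraph) : H.edgeSet.Finite :=
  H.finite_vertexSet.finite_subsets.subset fun _ he => H.subset_vertexSet_of_mem_edgeSet' he

theorem imageSet_injOn {H G : FiniteHypergraph} {φ : H.vertexSet → G.vertexSet}
    (hφ : Function.Injective φ) {S T : Set ℕ} (hS : S ⊆ H.vertexSet) (hT : T ⊆ H.vertexSet)
    (h : imageSet φ S = imageSet φ T) : S = T := by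
  have aux {S T : Set ℕ} (hS : S ⊆ H.vertexSet) (h : imageSet φ S = imageSet φ T) : S ⊆ T := by
    intro v hv
    have : (φ ⟨v, hS hv⟩ : ℕ) ∈ imageSet φ T := h ▸ ⟨⟨v, hS hv⟩, hv, rfl⟩
    obtain ⟨u, hu, huv⟩ := this
    rwa [hφ (Subtype.ext huv)] at hu
  exact (aux hS h).antisymm (aux hT h.symm)

/-- Two hypergraphs with surjective homomorphisms in both directions are isomorphic. -/
theorem equiv_of_surjective_homs {F F' : FiniteHypergraph} {φ : F.vertexSet → F'.vertexSet}
    {ψ : F'.vertexSet → F.vertexSet} (hφ : IsHom φ) (hψ : IsHom ψ) (hφs : Function.Surjective φ)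
    (hψs : Function.Surjective ψ) : F ≈ F' := by
  have hcard : Nat.card F.vertexSet = Nat.card F'.vertexSet :=
    le_antisymm (Nat.card_le_card_of_surjective ψ hψs) (Nat.card_le_card_of_surjective φ hφs)
  have hφb : Function.Bijective φ := (Nat.bijective_iff_surjective_and_card φ).2 ⟨hφs, hcard⟩
  have hψb : Function.Bijective ψ := (Nat.bijective_iff_surjective_and_card ψ).2 ⟨hψs, hcard.symm⟩
  have hsub : imageSet φ '' F.edgeSet ⊆ F'.edgeSet := by
    rintro _ ⟨e, he, rfl⟩
    exact hφ e he
  -- The other map injects the edges of `F'` into those of `F`. By counting, `φ` therefore reaches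
  -- every edge of `F'`, which makes its inverse a homomorphism too.
  have hle : F'.edgeSet.ncard ≤ (imageSet φ '' F.edgeSet).ncard := by
    rw [Set.InjOn.ncard_image fun S hS T hT h => imageSet_injOn hφb.1
      (F.subset_vertexSet_of_mem_edgeSet' hS) (F.subset_vertexSet_of_mem_edgeSet' hT) h]
    refine Set.ncard_le_ncard_of_injOn (imageSet ψ) (fun e he => hψ e he) ?_ F.finite_edgeSet
    exact fun S hS T hT h => imageSet_injOn hψb.1
      (F'.subset_vertexSet_of_mem_edgeSet' hS) (F'.subset_vertexSet_of_mem_edgeSet' hT) h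
  have heq := Set.eq_of_subset_of_ncard_le hsub hle F'.finite_edgeSet
  refine ⟨Equiv.ofBijective φ hφb, fun S hS => ⟨fun h => hφ S h, fun h => ?_⟩⟩
  rw [Equiv.coe_ofBijective, ← heq] at h
  obtain ⟨T, hT, hTS⟩ := h
  rw [← imageSet_injOn hφb.1 (F.subset_vertexSet_of_mem_edgeSet' hT) hS hTS]
  exact hT

/-- The induced sub-hypergraph on a set of vertices. -/
def FiniteHypergraph.induce (K : FiniteHypergraph) (W : Set ℕ) : FiniteHypergraph where
  vertexSet := K.vertexSet ∩ W
  edgeSet := {e ∈ K.edgeSet | e ⊆ W}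
  subset_vertexSet_of_mem_edgeSet' := fun _ he =>
    Set.subset_inter (K.subset_vertexSet_of_mem_edgeSet' he.1) he.2
  finite_vertexSet := K.finite_vertexSet.inter_of_left W
  nonempty_of_mem := fun e he => K.nonempty_of_mem e he.1

/-- The number of homomorphisms with a given image. -/
noncomputable def homCountOnto (F K : FiniteHypergraph) (W : Set ℕ) : ℕ :=
  Nat.card {φ : F.vertexSet → K.vertexSet // IsHom φ ∧ Set.range (fun v => (φ v : ℕ)) = W}

theorem homCount_induce (F K : FiniteHypergraph) (W : Set ℕ) :
    homCount F (K.induce W) = Nat.card {φ : F.vertexSet → K.vertexSet //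
      IsHom φ ∧ Set.range (fun v => (φ v : ℕ)) ⊆ W} := by
  have key (φ : F.vertexSet → K.vertexSet) (ψ : F.vertexSet → (K.induce W).vertexSet)
      (h : ∀ v, (φ v : ℕ) = ψ v) (e : Set ℕ) : imageSet φ e = imageSet ψ e := by
    ext w
    simp only [imageSet, Set.mem_ofPred_eq, h]
  refine Nat.card_congr
    { toFun := fun ψ => ⟨fun v => ⟨ψ.1 v, (ψ.1 v).2.1⟩, fun e he => ?_, ?_⟩
      invFun := fun φ => ⟨fun v => ⟨φ.1 v, (φ.1 v).2, φ.2.2 ⟨v, rfl⟩⟩, fun e he => ?_⟩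
      left_inv := fun ψ => rfl
      right_inv := fun φ => rfl }
  · rw [key _ ψ.1 fun v => rfl]
    exact (ψ.2 e he).1
  · rintro _ ⟨v, rfl⟩
    exact (ψ.1 v).2.2
  · rw [← key φ.1 _ fun v => rfl]
    refine ⟨φ.2.1 e he, ?_⟩
    rintro _ ⟨v, -, rfl⟩
    exact φ.2.2 ⟨v, rfl⟩

theorem homCount_induce_eq_sum (F K : FiniteHypergraph) (W : Finset ℕ) :
    homCount F (K.induce W) = ∑ U ∈ W.powerset, homCountOnto F K U := by
  classical
  rw [homCount_induce]
  have : Fintype F.vertexSet := Fintype.ofFinite _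
  have : Fintype K.vertexSet := Fintype.ofFinite _
  let img : (F.vertexSet → K.vertexSet) → Finset ℕ := fun φ => Finset.univ.image fun v => (φ v : ℕ)
  have himg (φ : F.vertexSet → K.vertexSet) : Set.range (fun v => (φ v : ℕ)) = img φ := by
    simp [img]
  simp only [homCountOnto, himg, Finset.coe_subset, Finset.coe_inj, Nat.card_eq_fintype_card,
    Fintype.card_subtype]
  rw [Finset.card_eq_sum_card_fiberwise (f := img) (t := W.powerset)]
  · refine Finset.sum_congr rfl fun U hU => ?_
    congr 1
    ext φ
    simp only [Finset.mem_filter, Finset.mem_univ, true_and]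
    constructor
    · rintro ⟨⟨h1, h2⟩, rfl⟩
      exact ⟨h1, rfl⟩
    · rintro ⟨h1, rfl⟩
      exact ⟨⟨h1, Finset.mem_powerset.1 hU⟩, rfl⟩
  · intro φ hφ
    simpa using (Finset.mem_filter.1 hφ).2.2

/-- Inclusion–exclusion in inductive form: the count into the sub-hypergraph induced by `W` is the
sum, over the subsets of `W`, of the counts with that image. All terms but the one for `W` agree by
induction. -/
theorem homCountOnto_eq {F F' : FiniteHypergraph}
    (h : ∀ K : FiniteHypergraph, homCount F K = homCount F' K) (K : FiniteHypergraph)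
    (W : Finset ℕ) : homCountOnto F K W = homCountOnto F' K W := by
  classical
  induction W using Finset.strongInduction with
  | H W ih =>
    have h1 := h (K.induce W)
    rw [homCount_induce_eq_sum, homCount_induce_eq_sum, ← Finset.insert_erase
      (Finset.mem_powerset_self W), Finset.sum_insert (Finset.notMem_erase _ _),
      Finset.sum_insert (Finset.notMem_erase _ _)] at h1
    have h2 : ∑ U ∈ W.powerset.erase W, homCountOnto F K U =
        ∑ U ∈ W.powerset.erase W, homCountOnto F' K U := by
      refine Finset.sum_congr rfl fun U hU => ih U ?_
      rw [Finset.mem_erase, Finset.mem_powerset] at hU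
      exact Finset.ssubset_iff_subset_ne.2 ⟨hU.2, hU.1⟩
    omega

/-- Lovász's argument: the identity of `F'` is a homomorphism onto `V(F')`, so by equality of the
counts with prescribed image there is one from `F` onto `V(F')`. By symmetry there are surjections
both ways, and finiteness yields an isomorphism. -/
theorem equiv_of_homCount_eq {F F' : FiniteHypergraph}
    (h : ∀ K : FiniteHypergraph, homCount F K = homCount F' K) : F ≈ F' := by
  have aux {F F' : FiniteHypergraph} (h : ∀ K : FiniteHypergraph, homCount F K = homCount F' K) :
      ∃ φ : F.vertexSet → F'.vertexSet, IsHom φ ∧ Function.Surjective φ := by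
    have h1 := homCountOnto_eq h F' F'.finite_vertexSet.toFinset
    rw [Set.Finite.coe_toFinset] at h1
    have h2 : 0 < homCountOnto F' F' F'.vertexSet := by
      refine Nat.card_pos_iff.2 ⟨⟨⟨id, (IsIso.refl F').isHom, ?_⟩⟩, inferInstance⟩
      simp
    rw [← h1] at h2
    obtain ⟨⟨φ, hφ, hW⟩⟩ := (Nat.card_pos_iff.1 h2).1
    refine ⟨φ, hφ, fun w => ?_⟩
    obtain ⟨v, hv⟩ := hW.ge w.2
    exact ⟨v, Subtype.ext hv⟩
  obtain ⟨φ, hφ, hφs⟩ := aux h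
  obtain ⟨ψ, hψ, hψs⟩ := aux fun K => (h K).symm
  exact equiv_of_surjective_homs hφ hψ hφs hψs

theorem homCount_congr_right (H : FiniteHypergraph) {G G' : FiniteHypergraph} (h : G ≈ G') :
    homCount H G = homCount H G' := by
  obtain ⟨σ, hσ⟩ := h
  refine Nat.card_congr
    { toFun := fun φ => ⟨σ ∘ φ.1, hσ.isHom.comp φ.2⟩
      invFun := fun φ => ⟨σ.symm ∘ φ.1, hσ.symm.isHom.comp φ.2⟩
      left_inv := fun φ => by ext v; simp
      right_inv := fun φ => by ext v; simp }

/-- Every hypergraph has a description. -/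
theorem exists_code (K : FiniteHypergraph) : ∃ c : HypergraphCode, c.Valid ∧ c.toHypergraph ≈ K := by
  classical
  obtain ⟨n, ⟨σ⟩⟩ := Finite.exists_equiv_fin K.vertexSet
  have : Fintype K.vertexSet := Fintype.ofFinite _
  let E : Finset (Finset (Fin n)) := Finset.univ.filter fun s =>
    {v | ∃ i ∈ s, (σ.symm i : ℕ) = v} ∈ K.edgeSet
  let L : List (List ℕ) := E.toList.map fun s => s.toList.map Fin.val
  have hL (l : List ℕ) (hl : l ∈ L) : ∃ s ∈ E, l = s.toList.map Fin.val := by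
    obtain ⟨s, hs, rfl⟩ := List.mem_map.1 hl
    exact ⟨s, Finset.mem_toList.1 hs, rfl⟩
  refine ⟨(n, L), ⟨fun l hl => ?_, ?_⟩, ?_⟩
  · obtain ⟨s, hs, rfl⟩ := hL l hl
    have hs' := (Finset.mem_filter.1 hs).2
    refine ⟨?_, s.nodup_toList.map Fin.val_injective, ?_⟩
    · obtain ⟨v, i, hi, -⟩ := K.nonempty_of_mem _ hs'
      intro h0
      simp only [List.map_eq_nil_iff, Finset.toList_eq_nil] at h0
      simp [h0] at hi
    · simp only [List.mem_map, forall_exists_index, and_imp]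
      rintro v i - rfl
      exact i.2
  · rw [List.pairwise_map]
    refine E.nodup_toList.imp fun {s t} hst h => hst ?_
    ext i
    simpa [Fin.val_inj] using h i
  · let τ : (HypergraphCode.toHypergraph (n, L)).vertexSet ≃ K.vertexSet :=
      (Equiv.mk (fun v => (⟨v.1, v.2⟩ : Fin n)) (fun i => ⟨i.1, i.2⟩) (fun v => rfl)
        (fun i => rfl)).trans σ.symm
    refine ⟨τ, fun S hS => ?_⟩
    let s : Finset (Fin n) := Finset.univ.filter fun i => (i : ℕ) ∈ S
    have h1 : imageSet τ S = {v | ∃ i ∈ s, (σ.symm i : ℕ) = v} := by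
      ext w
      constructor
      · rintro ⟨v, hv, rfl⟩
        exact ⟨⟨v.1, v.2⟩, by simpa [s] using hv, rfl⟩
      · rintro ⟨i, hi, rfl⟩
        exact ⟨⟨i.1, i.2⟩, by simpa [s] using hi, rfl⟩
    have h2 : S = {v | v ∈ s.toList.map Fin.val} := by
      ext v
      simp only [List.mem_map, Finset.mem_toList, Set.mem_ofPred_eq, s, Finset.mem_filter,
        Finset.mem_univ, true_and]
      constructor
      · intro hv
        exact ⟨⟨v, hS hv⟩, hv, rfl⟩
      · rintro ⟨i, hi, rfl⟩
        exact hi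
    rw [h1]
    constructor
    · rintro ⟨-, -, l, hl, hSl⟩
      obtain ⟨t, ht, rfl⟩ := hL l hl
      have : s = t := by
        ext i
        have h3 := hSl.symm.trans h2
        have := Set.ext_iff.1 h3 i
        simpa [Fin.val_inj] using this.symm
      rw [this]
      exact (Finset.mem_filter.1 ht).2
    · intro h
      refine ⟨?_, hS, s.toList.map Fin.val, List.mem_map.2 ⟨s, ?_, rfl⟩, h2⟩
      · obtain ⟨v, i, hi, -⟩ := K.nonempty_of_mem _ h
        exact ⟨i, by simpa [s] using hi⟩
      · exact Finset.mem_toList.2 (Finset.mem_filter.2 ⟨Finset.mem_univ _, h⟩)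

end HyperMotif

namespace HyperMotif

/-! ### Gadgets for products with a given hypergraph -/

/-- The subset of `[r] × [n]` whose characteristic vector is given by the binary digits of `x`. -/
def bitPoints (r n x : ℕ) : List (ℕ × ℕ) :=
  ((List.range (r * n)).filter fun j => x / 2 ^ j % 2 = 1).map fun j => (j / n, j % n)

/-- `P` projects onto `[r]` and onto an edge of `K`. -/
def IsPattern (K : HypergraphCode) (r : ℕ) (P : List (ℕ × ℕ)) : Prop :=
  (∀ i < r, ∃ y ∈ P, y.1 = i) ∧ ∃ f ∈ K.2, (∀ v ∈ f, ∃ y ∈ P, y.2 = v) ∧ ∀ y ∈ P, y.2 ∈ f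

instance (K : HypergraphCode) (r : ℕ) (P : List (ℕ × ℕ)) : Decidable (IsPattern K r P) := by
  unfold IsPattern; infer_instance

/-- The numbers below `2 ^ (r * K.1)` are the characteristic vectors of the subsets of `[r] × V(K)`,
each occurring once. The enumeration has no repetitions and is visibly primitive recursive. -/
def patterns (K : HypergraphCode) (r : ℕ) : List (List (ℕ × ℕ)) :=
  ((List.range (2 ^ (r * K.1))).map (bitPoints r K.1)).filter fun P => IsPattern K r P

/-- The gadget for products with `K`, where only edges with at most `k` vertices matter. -/
def gadget (k : ℕ) (K : HypergraphCode) : Gadget :=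
  (K.1, (List.range (k + 1)).map (patterns K))

theorem mem_bitPoints {r n x i v : ℕ} :
    (i, v) ∈ bitPoints r n x ↔ i < r ∧ v < n ∧ x / 2 ^ (i * n + v) % 2 = 1 := by
  simp only [bitPoints, List.mem_map, List.mem_filter, List.mem_range, decide_eq_true_eq,
    Prod.mk.injEq]
  constructor
  · rintro ⟨j, ⟨hj, hx⟩, rfl, rfl⟩
    have hn : 0 < n := Nat.pos_of_ne_zero (by rintro rfl; simp at hj)
    exact ⟨Nat.div_lt_of_lt_mul (by rwa [mul_comm]), Nat.mod_lt _ hn, by rwa [Nat.div_add_mod']⟩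
  · rintro ⟨hi, hv, hx⟩
    have hn : 0 < n := by omega
    refine ⟨i * n + v, ⟨?_, hx⟩, ?_, ?_⟩
    · calc i * n + v < (i + 1) * n := by rw [Nat.succ_mul]; omega
        _ ≤ r * n := Nat.mul_le_mul_right _ hi
    · rw [mul_comm, Nat.mul_add_div hn, Nat.div_eq_of_lt hv, add_zero]
    · rw [mul_comm, Nat.mul_add_mod, Nat.mod_eq_of_lt hv]

theorem nodup_bitPoints (r n x : ℕ) : (bitPoints r n x).Nodup := by
  refine (List.nodup_range.filter _).map fun i j h => ?_
  simp only [Prod.mk.injEq] at h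
  rw [← Nat.div_add_mod i n, h.1, h.2, Nat.div_add_mod]

theorem mem_gadget_prod {k : ℕ} {K G : HypergraphCode} {l : List ℕ} :
    l ∈ ((gadget k K).prod G).2 ↔ ∃ e ∈ G.2, e.length ≤ k ∧ ∃ x < 2 ^ (e.length * K.1),
      IsPattern K e.length (bitPoints e.length K.1 x) ∧
        substEdge K.1 e (bitPoints e.length K.1 x) = l := by
  simp only [Gadget.prod, gadget, List.mem_flatMap]
  refine exists_congr fun e => and_congr_right fun _ => ?_
  rw [List.getD_eq_getElem?_getD, List.getElem?_map]
  rcases Nat.lt_or_ge e.length (k + 1) with h | h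
  · rw [List.getElem?_range h]
    simp only [Option.map_some, Option.getD_some, patterns, List.mem_map, List.mem_filter,
      List.mem_range, decide_eq_true_eq]
    constructor
    · rintro ⟨_, ⟨⟨x, hx, rfl⟩, hP⟩, hl⟩
      exact ⟨by omega, x, hx, hP, hl⟩
    · rintro ⟨-, x, hx, hP, hl⟩
      exact ⟨_, ⟨⟨x, hx, rfl⟩, hP⟩, hl⟩
  · rw [List.getElem?_eq_none (by simpa using h)]
    simp only [Option.map_none, Option.getD_none, List.map_nil, List.not_mem_nil, false_iff]
    rintro ⟨h', -⟩
    omega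

theorem mem_substEdge {n x w : ℕ} {e : List ℕ} :
    w ∈ substEdge n e (bitPoints e.length n x) ↔ ∃ i, ∃ hi : i < e.length, ∃ v < n,
      x / 2 ^ (i * n + v) % 2 = 1 ∧ e[i] * n + v = w := by
  simp only [substEdge, List.mem_map, Prod.exists, mem_bitPoints]
  constructor
  · rintro ⟨i, v, ⟨hi, hv, hx⟩, hw⟩
    exact ⟨i, hi, v, hv, hx, by simpa [hi] using hw⟩
  · rintro ⟨i, hi, v, hv, hx, hw⟩
    exact ⟨i, v, ⟨hi, hv, hx⟩, by simpa [hi] using hw⟩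

theorem mul_add_eq_iff {n a b u v : ℕ} (hu : u < n) (hv : v < n) :
    a * n + u = b * n + v ↔ a = b ∧ u = v := by
  have hn : 0 < n := by omega
  constructor
  · intro h
    have h1 := congrArg (· / n) h
    have h2 := congrArg (· % n) h
    simp only [mul_comm _ n, Nat.mul_add_div hn, Nat.mul_add_mod, Nat.div_eq_of_lt hu,
      Nat.div_eq_of_lt hv, Nat.mod_eq_of_lt hu, Nat.mod_eq_of_lt hv, add_zero] at h1 h2
    exact ⟨h1, h2⟩
  · rintro ⟨rfl, rfl⟩
    rfl

theorem mem_substEdge_iff {n x i v : ℕ} {e : List ℕ} (he : e.Nodup) (hi : i < e.length)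
    (hv : v < n) : e[i] * n + v ∈ substEdge n e (bitPoints e.length n x) ↔
      x / 2 ^ (i * n + v) % 2 = 1 := by
  rw [mem_substEdge]
  constructor
  · rintro ⟨j, hj, u, hu, hx, h⟩
    obtain ⟨h1, rfl⟩ := (mul_add_eq_iff hu hv).1 h
    rw [he.getElem_inj_iff] at h1
    rwa [← h1]
  · intro h
    exact ⟨i, hi, v, hv, h, rfl⟩

/-- A vertex `(u, v)` of the product is the number `u * n + v`, so division by `n` projects to the
first factor. An edge of the product thereby determines the edge it lies over. -/
theorem exists_div_of_isPattern {K : HypergraphCode} {e : List ℕ} {x : ℕ}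
    (h : IsPattern K e.length (bitPoints e.length K.1 x)) (u : ℕ) :
    u ∈ e ↔ ∃ w ∈ substEdge K.1 e (bitPoints e.length K.1 x), w / K.1 = u := by
  constructor
  · intro hu
    obtain ⟨i, hi, rfl⟩ := List.mem_iff_getElem.1 hu
    obtain ⟨⟨j, v⟩, hy, rfl⟩ := h.1 i hi
    obtain ⟨-, hv, hx⟩ := mem_bitPoints.1 hy
    refine ⟨_, mem_substEdge.2 ⟨j, hi, v, hv, hx, rfl⟩, ?_⟩
    rw [mul_comm, Nat.mul_add_div (by omega), Nat.div_eq_of_lt hv, add_zero]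
  · rintro ⟨w, hw, rfl⟩
    obtain ⟨i, hi, v, hv, -, rfl⟩ := mem_substEdge.1 hw
    rw [mul_comm, Nat.mul_add_div (by omega), Nat.div_eq_of_lt hv, add_zero]
    exact List.getElem_mem hi

theorem eq_of_bits {N x y : ℕ} (hx : x < 2 ^ N) (hy : y < 2 ^ N)
    (h : ∀ j < N, x / 2 ^ j % 2 = 1 ↔ y / 2 ^ j % 2 = 1) : x = y := by
  refine Nat.eq_of_testBit_eq fun j => ?_
  rcases Nat.lt_or_ge j N with hj | hj
  · rw [Nat.testBit_eq_decide_div_mod_eq, Nat.testBit_eq_decide_div_mod_eq]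
    exact decide_eq_decide.2 (h j hj)
  · have := Nat.pow_le_pow_right (show 0 < 2 by omega) hj
    rw [Nat.testBit_lt_two_pow (by omega), Nat.testBit_lt_two_pow (by omega)]

theorem exists_bits (N : ℕ) (T : ℕ → Prop) : ∃ x < 2 ^ N, ∀ j < N, x / 2 ^ j % 2 = 1 ↔ T j := by
  classical
  refine ⟨Nat.ofBits fun j : Fin N => decide (T j), Nat.ofBits_lt_two_pow _, fun j hj => ?_⟩
  have := Nat.testBit_ofBits_lt (fun j : Fin N => decide (T j)) j hj
  rw [Nat.testBit_eq_decide_div_mod_eq] at this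
  simpa using decide_eq_decide.1 this

/-- Products are asked to the oracle, so they must be admissible inputs, without repeated edges.
Edges over the same `e` differ in a bit of their characteristic vectors; edges over different edges
of `G` differ in their projections. -/
theorem valid_gadget_prod (k : ℕ) (K : HypergraphCode) {G : HypergraphCode} (hG : G.Valid) :
    ((gadget k K).prod G).Valid := by
  have hpat (e : List ℕ) {P : List (ℕ × ℕ)} (hP : P ∈ (gadget k K).2.getD e.length []) :
      ∃ x < 2 ^ (e.length * K.1), IsPattern K e.length (bitPoints e.length K.1 x) ∧
        bitPoints e.length K.1 x = P := by
    rw [List.getD_eq_getElem?_getD, gadget, List.getElem?_map] at hP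
    rcases Nat.lt_or_ge e.length (k + 1) with h | h
    · rw [List.getElem?_range h] at hP
      simp only [Option.map_some, Option.getD_some, patterns, List.mem_map, List.mem_filter,
        List.mem_range, decide_eq_true_eq] at hP
      obtain ⟨⟨x, hx, rfl⟩, hP⟩ := hP
      exact ⟨x, hx, hP, rfl⟩
    · rw [List.getElem?_eq_none (by simpa using h)] at hP
      simp at hP
  refine ⟨fun l hl => ?_, ?_⟩
  · obtain ⟨e, he, -, x, hx, hP, rfl⟩ := mem_gadget_prod.1 hl
    obtain ⟨h1, h2, h3⟩ := hG.1 e he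
    refine ⟨?_, ?_, ?_⟩
    · obtain ⟨y, hy, -⟩ := hP.1 0 (List.length_pos_iff.2 h1)
      exact List.ne_nil_of_mem (List.mem_map_of_mem (f := fun y => e.getD y.1 0 * K.1 + y.2) hy)
    · refine (nodup_bitPoints _ _ _).map_on ?_
      rintro ⟨i, v⟩ hi ⟨j, u⟩ hj h
      obtain ⟨hi, hv, -⟩ := mem_bitPoints.1 hi
      obtain ⟨hj', hu, -⟩ := mem_bitPoints.1 hj
      obtain ⟨h4, rfl⟩ := (mul_add_eq_iff hv hu).1 h
      rw [List.getD_eq_getElem _ _ hi, List.getD_eq_getElem _ _ hj'] at h4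
      rw [h2.getElem_inj_iff] at h4
      rw [h4]
    · intro w hw
      obtain ⟨i, hi, v, hv, -, rfl⟩ := mem_substEdge.1 hw
      have := h3 _ (List.getElem_mem hi)
      change e[i] * K.1 + v < G.1 * K.1
      calc e[i] * K.1 + v < (e[i] + 1) * K.1 := by rw [Nat.succ_mul]; omega
        _ ≤ G.1 * K.1 := Nat.mul_le_mul_right _ this
  · rw [Gadget.prod, List.pairwise_flatMap]
    constructor
    · intro e he
      obtain ⟨-, h2, -⟩ := hG.1 e he
      rw [List.getD_eq_getElem?_getD, gadget, List.getElem?_map]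
      rcases Nat.lt_or_ge e.length (k + 1) with h | h
      · rw [List.getElem?_range h]
        simp only [Option.map_some, Option.getD_some, patterns]
        rw [List.pairwise_map]
        refine List.Pairwise.filter _ ?_
        rw [List.pairwise_map]
        refine List.nodup_range.imp_of_mem fun {x y} hx hy hxy h => hxy ?_
        refine eq_of_bits (List.mem_range.1 hx) (List.mem_range.1 hy) fun j hj => ?_
        have hn : 0 < K.1 := Nat.pos_of_ne_zero (by intro h; simp [h] at hj)
        have hi : j / K.1 < e.length := Nat.div_lt_of_lt_mul (by rwa [mul_comm])
        have := h (e[j / K.1] * K.1 + j % K.1)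
        rwa [mem_substEdge_iff h2 hi (Nat.mod_lt _ hn), mem_substEdge_iff h2 hi (Nat.mod_lt _ hn),
          Nat.div_add_mod'] at this
      · rw [List.getElem?_eq_none (by simpa using h)]
        simp
    · refine hG.2.imp fun {e e'} hee l hl l' hl' h => hee fun u => ?_
      obtain ⟨P, hP, rfl⟩ := List.mem_map.1 hl
      obtain ⟨P', hP', rfl⟩ := List.mem_map.1 hl'
      obtain ⟨x, -, hx, rfl⟩ := hpat e hP
      obtain ⟨x', -, hx', rfl⟩ := hpat e' hP'
      rw [exists_div_of_isPattern hx, exists_div_of_isPattern hx']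
      exact exists_congr fun w => and_congr_left fun _ => h w

/-- Apart from the cut at `k`, these are the edges of the categorical product: whether a set is an
edge can be tested on its two projections. Everything later about products uses only this
description. -/
theorem mem_edgeSet_gadget_prod {k : ℕ} {K G : HypergraphCode} (hG : G.Valid) {S : Set ℕ} :
    S ∈ ((gadget k K).prod G).toHypergraph.edgeSet ↔ S ⊆ {w | w < G.1 * K.1} ∧
      (∃ e ∈ G.2, e.length ≤ k ∧ (· / K.1) '' S = {v | v ∈ e}) ∧
        ∃ f ∈ K.2, (· % K.1) '' S = {v | v ∈ f} := by
  constructor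
  · rintro ⟨-, hS, l, hl, rfl⟩
    refine ⟨hS, ?_⟩
    obtain ⟨e, he, hk, x, hx, hP, rfl⟩ := mem_gadget_prod.1 hl
    refine ⟨⟨e, he, hk, ?_⟩, ?_⟩
    · ext u
      exact (exists_div_of_isPattern hP u).symm
    · obtain ⟨f, hf, h1, h2⟩ := hP.2
      refine ⟨f, hf, ?_⟩
      ext v
      constructor
      · rintro ⟨w, hw, rfl⟩
        obtain ⟨i, hi, v, hv, hx, rfl⟩ := mem_substEdge.1 hw
        have := h2 _ (mem_bitPoints.2 ⟨hi, hv, hx⟩)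
        simpa [Nat.mod_eq_of_lt hv] using this
      · intro hv
        obtain ⟨⟨i, v⟩, hy, rfl⟩ := h1 v hv
        obtain ⟨hi, hv, hx⟩ := mem_bitPoints.1 hy
        exact ⟨_, mem_substEdge.2 ⟨i, hi, v, hv, hx, rfl⟩, by simp [Nat.mod_eq_of_lt hv]⟩
  · rintro ⟨hS, ⟨e, he, hk, h1⟩, f, hf, h2⟩
    obtain ⟨hne, hnd, hlt⟩ := hG.1 e he
    -- The number `x` is the characteristic vector of `S`, with the vertices of the first factor
    -- replaced by their positions in the list `e`.
    obtain ⟨x, hx, hxT⟩ := exists_bits (e.length * K.1)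
      fun j => e.getD (j / K.1) 0 * K.1 + j % K.1 ∈ S
    have hn {w : ℕ} (hw : w ∈ S) : 0 < K.1 :=
      Nat.pos_of_ne_zero (by intro h; simpa [h] using hS hw)
    have hbit {i v : ℕ} (hi : i < e.length) (hv : v < K.1) :
        x / 2 ^ (i * K.1 + v) % 2 = 1 ↔ e[i] * K.1 + v ∈ S := by
      have h3 : i * K.1 + v < e.length * K.1 := by
        calc i * K.1 + v < (i + 1) * K.1 := by rw [Nat.succ_mul]; omega
          _ ≤ e.length * K.1 := Nat.mul_le_mul_right _ hi
      rw [hxT _ h3, mul_comm i, Nat.mul_add_div (by omega), Nat.div_eq_of_lt hv, add_zero,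
        Nat.mul_add_mod, Nat.mod_eq_of_lt hv]
      simp [hi]
    have hS' : S = {w | w ∈ substEdge K.1 e (bitPoints e.length K.1 x)} := by
      ext w
      constructor
      · intro hw
        have h3 : w / K.1 ∈ {v | v ∈ e} := h1 ▸ ⟨w, hw, rfl⟩
        obtain ⟨i, hi, hiw⟩ := List.mem_iff_getElem.1 h3
        have hv := Nat.mod_lt w (hn hw)
        have h4 : e[i] * K.1 + w % K.1 = w := by rw [hiw, Nat.div_add_mod']
        exact mem_substEdge.2 ⟨i, hi, _, hv, (hbit hi hv).2 (by rwa [h4]), h4⟩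
      · intro hw
        obtain ⟨i, hi, v, hv, hx, rfl⟩ := mem_substEdge.1 hw
        exact (hbit hi hv).1 hx
    refine ⟨?_, hS, substEdge K.1 e (bitPoints e.length K.1 x), mem_gadget_prod.2
      ⟨e, he, hk, x, hx, ⟨?_, f, hf, ?_, ?_⟩, rfl⟩, hS'⟩
    · obtain ⟨u, hu⟩ := List.exists_mem_of_ne_nil e hne
      have : u ∈ (· / K.1) '' S := by rw [h1]; exact hu
      obtain ⟨w, hw, -⟩ := this
      exact ⟨w, hw⟩
    · intro i hi
      have : e[i] ∈ (· / K.1) '' S := by rw [h1]; exact List.getElem_mem hi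
      obtain ⟨w, hw, hwi⟩ := this
      have hv := Nat.mod_lt w (hn hw)
      refine ⟨(i, w % K.1), mem_bitPoints.2 ⟨hi, hv, (hbit hi hv).2 ?_⟩, rfl⟩
      rw [← hwi]
      simpa [Nat.div_add_mod'] using hw
    · intro v hv
      have : v ∈ (· % K.1) '' S := by rw [h2]; exact hv
      obtain ⟨w, hw, rfl⟩ := this
      have h3 : w / K.1 ∈ {v | v ∈ e} := h1 ▸ ⟨w, hw, rfl⟩
      obtain ⟨i, hi, hiw⟩ := List.mem_iff_getElem.1 h3
      have hv := Nat.mod_lt w (hn hw)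
      refine ⟨(i, w % K.1), mem_bitPoints.2 ⟨hi, hv, (hbit hi hv).2 ?_⟩, rfl⟩
      rwa [hiw, Nat.div_add_mod']
    · rintro ⟨i, v⟩ hy
      obtain ⟨hi, hv, hx⟩ := mem_bitPoints.1 hy
      have : v ∈ (· % K.1) '' S := ⟨_, (hbit hi hv).1 hx, by simp [Nat.mod_eq_of_lt hv]⟩
      rw [h2] at this
      exact this

/-- Homomorphism counts are multiplicative. -/
theorem homCount_gadget_prod {k : ℕ} {F : FiniteHypergraph} (hF : Nat.card F.vertexSet ≤ k)
    (K : HypergraphCode) {G : HypergraphCode} (hG : G.Valid) :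
    homCount F ((gadget k K).prod G).toHypergraph =
      homCount F G.toHypergraph * homCount F K.toHypergraph := by
  rw [homCount, homCount, homCount, ← Nat.card_prod]
  have himage {H : FiniteHypergraph} (φ : F.vertexSet → ((gadget k K).prod G).toHypergraph.vertexSet)
      (ψ : F.vertexSet → H.vertexSet) (p : ℕ → ℕ) (h : ∀ v, p (φ v) = ψ v) (e : Set ℕ) :
      imageSet ψ e = p '' imageSet φ e := by
    ext w
    constructor
    · rintro ⟨v, hv, rfl⟩
      exact ⟨φ v, ⟨v, hv, rfl⟩, h v⟩
    · rintro ⟨_, ⟨v, hv, rfl⟩, rfl⟩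
      exact ⟨v, hv, (h v).symm⟩
  have hlt {w : ℕ} (hw : w < G.1 * K.1) : w / K.1 < G.1 ∧ w % K.1 < K.1 :=
    ⟨Nat.div_lt_of_lt_mul (by rwa [mul_comm]), Nat.mod_lt _ (Nat.pos_of_ne_zero (by
      intro h; simp [h] at hw))⟩
  have hcomb {a b : ℕ} (ha : a < G.1) (hb : b < K.1) : a * K.1 + b < G.1 * K.1 ∧
      (a * K.1 + b) / K.1 = a ∧ (a * K.1 + b) % K.1 = b := by
    refine ⟨?_, ?_, ?_⟩
    · calc a * K.1 + b < (a + 1) * K.1 := by rw [Nat.succ_mul]; omega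
        _ ≤ G.1 * K.1 := Nat.mul_le_mul_right _ ha
    · rw [mul_comm, Nat.mul_add_div (by omega), Nat.div_eq_of_lt hb, add_zero]
    · rw [mul_comm, Nat.mul_add_mod, Nat.mod_eq_of_lt hb]
  refine Nat.card_congr
    { toFun := fun φ => (⟨fun v => ⟨φ.1 v / K.1, (hlt (φ.1 v).2).1⟩, fun e he => ?_⟩,
        ⟨fun v => ⟨φ.1 v % K.1, (hlt (φ.1 v).2).2⟩, fun e he => ?_⟩)
      invFun := fun ψ => ⟨fun v => ⟨ψ.1.1 v * K.1 + ψ.2.1 v, (hcomb (ψ.1.1 v).2 (ψ.2.1 v).2).1⟩,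
        fun e he => ?_⟩
      left_inv := fun φ => ?_
      right_inv := fun ψ => ?_ }
  · obtain ⟨-, ⟨l, hl, -, h⟩, -⟩ := (mem_edgeSet_gadget_prod hG).1 (φ.2 e he)
    rw [himage φ.1 _ (· / K.1) fun v => rfl, h]
    obtain ⟨h1, -, h3⟩ := hG.1 l hl
    exact ⟨List.exists_mem_of_ne_nil l h1, h3, l, hl, rfl⟩
  · obtain ⟨hS, -, l, hl, h⟩ := (mem_edgeSet_gadget_prod hG).1 (φ.2 e he)
    rw [himage φ.1 _ (· % K.1) fun v => rfl]
    refine ⟨?_, ?_, l, hl, h⟩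
    · obtain ⟨v, hv⟩ := F.nonempty_of_mem e he
      exact ⟨_, _, ⟨⟨v, F.subset_vertexSet_of_mem_edgeSet' he hv⟩, hv, rfl⟩, rfl⟩
    · rintro _ ⟨w, hw, rfl⟩
      exact (hlt (hS hw)).2
  · rw [mem_edgeSet_gadget_prod hG]
    refine ⟨imageSet_subset _ _, ?_, ?_⟩
    · obtain ⟨-, -, l, hl, h⟩ := ψ.1.2 e he
      refine ⟨l, hl, ?_, ?_⟩
      -- The cut at `k` loses nothing here: the image of an edge of `F` has at most `|V(F)| ≤ k`
      -- elements.
      · have h1 : l.length = {v | v ∈ l}.ncard := by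
          rw [← List.toFinset_card_of_nodup (hG.1 l hl).2.1, ← Set.ncard_coe_finset]
          congr 1
          ext v
          simp
        have h2 : imageSet ψ.1.1 e ⊆ Set.range fun v => (ψ.1.1 v : ℕ) := by
          rintro _ ⟨v, -, rfl⟩
          exact ⟨v, rfl⟩
        rw [h1, ← h]
        refine (Set.ncard_le_ncard h2 (Set.finite_range _)).trans (le_trans ?_ hF)
        rw [← Set.image_univ, ← Set.ncard_univ]
        exact Set.ncard_image_le
      · rw [← himage _ ψ.1.1 (· / K.1) fun v => (hcomb (ψ.1.1 v).2 (ψ.2.1 v).2).2.1]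
        exact h
    · obtain ⟨-, -, l, hl, h⟩ := ψ.2.2 e he
      refine ⟨l, hl, ?_⟩
      rw [← himage _ ψ.2.1 (· % K.1) fun v => (hcomb (ψ.1.1 v).2 (ψ.2.1 v).2).2.2]
      exact h
  · ext v
    exact Nat.div_add_mod' _ _
  · ext v
    · exact (hcomb (ψ.1.1 v).2 (ψ.2.1 v).2).2.1
    · exact (hcomb (ψ.1.1 v).2 (ψ.2.1 v).2).2.2

end HyperMotif

namespace HyperMotif

/-! ### Separating hypergraphs by linear combinations of homomorphism counts -/

theorem card_vertexSet_toHypergraph (c : HypergraphCode) :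
    Nat.card c.toHypergraph.vertexSet = c.1 := by
  change ({v | v < c.1} : Set ℕ).ncard = c.1
  have h : ({v | v < c.1} : Set ℕ) = Finset.range c.1 := by ext; simp
  rw [h, Set.ncard_coe_finset, Finset.card_range]

/-- Iterated products realise words of the free monoid on codes. The empty word is realised by a
single vertex carrying its only possible edge, which receives exactly one homomorphism from each `F`
because edges are nonempty. -/
theorem exists_code_homCount_eq_prod (k : ℕ) (L : List HypergraphCode) :
    ∃ K : HypergraphCode, K.Valid ∧ ∀ F : FiniteHypergraph, Nat.card F.vertexSet ≤ k →
      homCount F K.toHypergraph = (L.map fun G => homCount F G.toHypergraph).prod := by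
  induction L with
  | nil =>
    refine ⟨(1, [[0]]), by simp [HypergraphCode.Valid], fun F _ => ?_⟩
    rw [homCount, List.map_nil, List.prod_nil, Nat.card_eq_one_iff_unique]
    have h0 : (0 : ℕ) ∈ (HypergraphCode.toHypergraph (1, [[0]])).vertexSet := Nat.zero_lt_one
    have h1 (v : (HypergraphCode.toHypergraph (1, [[0]])).vertexSet) : v = ⟨0, h0⟩ :=
      Subtype.ext (Nat.lt_one_iff.1 v.2)
    refine ⟨⟨fun φ ψ => Subtype.ext (funext fun v => by rw [h1 (φ.1 v), h1 (ψ.1 v)])⟩,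
      ⟨fun _ => ⟨0, h0⟩, fun e he => ?_⟩⟩
    obtain ⟨v, hv⟩ := F.nonempty_of_mem e he
    have h2 : imageSet (fun _ : F.vertexSet =>
        (⟨0, h0⟩ : (HypergraphCode.toHypergraph (1, [[0]])).vertexSet)) e = {0} := by
      ext w
      constructor
      · rintro ⟨_, -, rfl⟩
        rfl
      · rintro rfl
        exact ⟨⟨v, F.subset_vertexSet_of_mem_edgeSet' he hv⟩, hv, rfl⟩
    rw [h2]
    refine ⟨⟨0, rfl⟩, ?_, [0], by simp, by ext; simp⟩
    rintro _ rfl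
    exact h0
  | cons G L ih =>
    obtain ⟨K, hK, h⟩ := ih
    refine ⟨(gadget k G).prod K, valid_gadget_prod k G hK, fun F hF => ?_⟩
    rw [homCount_gadget_prod hF G hK, h F hF, List.map_cons, List.prod_cons, mul_comm]

/-- If the map sending `α` to the tuple of its pairings with the `v i` were not surjective, a
nonzero linear functional would vanish on its range; evaluated at the unit vectors, it is a linear
relation between the `v i`. -/
theorem exists_dual_of_linearIndependent {ι X : Type*} [Finite ι] {v : ι → X → ℚ}
    (hv : LinearIndependent ℚ v) (b : ι → ℚ) :
    ∃ α : X →₀ ℚ, ∀ i, (α.sum fun x a => a * v i x) = b i := by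
  classical
  have := Fintype.ofFinite ι
  let T : (X →₀ ℚ) →ₗ[ℚ] ι → ℚ := LinearMap.pi fun i => Finsupp.lsum ℚ fun x => LinearMap.mulRight ℚ (v i x)
  have hT : LinearMap.range T = ⊤ := by
    by_contra h
    obtain ⟨f, hf, hle⟩ := Submodule.exists_le_ker_of_lt_top _ (lt_top_iff_ne_top.2 h)
    refine hf (LinearMap.pi_ext' fun i => LinearMap.ext_ring ?_)
    have h0 := Fintype.linearIndependent_iff.1 hv (fun i => f (Pi.single i 1)) (by
      funext x
      have h1 : f (T (Finsupp.single x 1)) = 0 := hle ⟨_, rfl⟩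
      rw [LinearMap.pi_apply_eq_sum_univ f] at h1
      have h2 (i : ι) : (Pi.single i 1 : ι → ℚ) = fun j => if i = j then 1 else 0 := by
        ext j
        rw [Pi.single_apply]
        exact if_congr eq_comm rfl rfl
      simpa [T, h2, mul_comm] using h1) i
    simpa using h0
  obtain ⟨α, hα⟩ := LinearMap.range_eq_top.1 hT b
  refine ⟨α, fun i => ?_⟩
  rw [← hα]
  simp [T, Finsupp.sum]

/-- Dedekind's independence of characters, applied to homomorphism counts. A triple `(a, b, K)` in
`W` stands for the coefficient `a - b` of `K`, and `R` clears denominators: splitting positive and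
negative parts makes the condition an identity of natural numbers, which can be checked primitive
recursively. -/
theorem exists_separating {l : List HypergraphCode} (hl : (l.map HypergraphCode.type).Nodup)
    (c : HypergraphCode) {k : ℕ} (hk : ∀ F ∈ l, F.1 ≤ k) :
    ∃ (W : List (ℕ × ℕ × HypergraphCode)) (R : ℕ), 0 < R ∧ ∀ F ∈ l,
      (W.map fun w => w.1 * homCount F.toHypergraph w.2.2.toHypergraph).sum =
        (W.map fun w => w.2.1 * homCount F.toHypergraph w.2.2.toHypergraph).sum +
          if F = c then R else 0 := by
  classical
  -- The truncated product of codes need not satisfy the monoid laws on the nose. The free monoid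
  -- makes multiplicativity automatic, and its words are turned back into hypergraphs afterwards.
  let χ (F : HypergraphCode) : FreeMonoid HypergraphCode →* ℚ :=
    FreeMonoid.lift fun K => (homCount F.toHypergraph K.toHypergraph : ℚ)
  have hχ : Function.Injective fun F : {F // F ∈ l} => χ F.1 := by
    rintro ⟨F, hF⟩ ⟨F', hF'⟩ h
    refine Subtype.ext (List.inj_on_of_nodup_map hl hF hF' (Quotient.sound
      (equiv_of_homCount_eq fun K => ?_)))
    obtain ⟨K', -, hK'⟩ := exists_code K
    rw [← homCount_congr_right _ hK', ← homCount_congr_right _ hK']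
    have h1 := DFunLike.congr_fun h (FreeMonoid.of K')
    simpa [χ] using h1
  obtain ⟨α, hα⟩ := exists_dual_of_linearIndependent
    ((linearIndependent_monoidHom (FreeMonoid HypergraphCode) ℚ).comp _ hχ)
    fun F => if F.1 = c then 1 else 0
  choose P hP using fun x : FreeMonoid HypergraphCode => exists_code_homCount_eq_prod k x.toList
  obtain ⟨⟨R, hR⟩, hint⟩ := IsLocalization.exist_integer_multiples_of_finset (nonZeroDivisors ℤ)
    (α.support.image α)
  have hR0 : R ≠ 0 := nonZeroDivisors.ne_zero hR
  -- The denominators are cleared by `R * R` instead of `R` because the integer `R` may be negative.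
  have hz (x : FreeMonoid HypergraphCode) : ∃ z : ℤ, (z : ℚ) = R * R * α x := by
    by_cases hx : x ∈ α.support
    · obtain ⟨z, hz⟩ := hint _ (Finset.mem_image_of_mem α hx)
      refine ⟨R * z, ?_⟩
      have h1 : (z : ℚ) = R * α x := by simpa [zsmul_eq_mul] using hz
      rw [Int.cast_mul, h1, mul_assoc]
    · exact ⟨0, by simp [Finsupp.notMem_support_iff.1 hx]⟩
  choose z hz using hz
  refine ⟨α.support.toList.map fun x => ((z x).toNat, (-z x).toNat, P x), (R * R).natAbs,
    Int.natAbs_pos.2 (mul_ne_zero hR0 hR0), fun F hF => ?_⟩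
  have h1 (x : FreeMonoid HypergraphCode) :
      χ F x = (homCount F.toHypergraph (P x).toHypergraph : ℚ) := by
    rw [(hP x).2 F.toHypergraph ((card_vertexSet_toHypergraph F).trans_le (hk F hF)),
      Nat.cast_list_prod, List.map_map]
    exact FreeMonoid.lift_apply _ _
  have h2 := hα ⟨F, hF⟩
  have h3 : ((R * R).natAbs : ℚ) = R * R := by
    rw [← Int.cast_natCast, Int.natAbs_of_nonneg (mul_self_nonneg R), Int.cast_mul]
  have h4 (x : FreeMonoid HypergraphCode) :
      ((z x).toNat : ℚ) = ((-z x).toNat : ℚ) + R * R * α x := by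
    rw [← hz]
    have := Int.toNat_sub_toNat_neg (z x)
    have h5 : (((z x).toNat : ℤ) : ℚ) - (((-z x).toNat : ℤ) : ℚ) = z x := by exact_mod_cast this
    simp only [Int.cast_natCast] at h5
    linarith
  rw [List.map_map, List.map_map, Finset.sum_map_toList, Finset.sum_map_toList]
  apply Nat.cast_injective (R := ℚ)
  push_cast
  simp only [Function.comp_apply, h3, Nat.cast_mul, h4, add_mul, Finset.sum_add_distrib]
  congr 1
  have h5 : (if F = c then (R : ℚ) * R else 0) = R * R * if F = c then 1 else 0 := by simp
  rw [h5, ← h2, Finsupp.sum, Finset.mul_sum]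
  refine Finset.sum_congr rfl fun x _ => ?_
  rw [Function.comp_apply, h1]
  ring

/-! ### Recovering a homomorphism count from a motif parameter -/

/-- The rational number `(a - b) / c`. -/
def fraction (p : ℕ × ℕ × ℕ) : ℚ := ((p.1 : ℚ) - (p.2.1 : ℚ)) / (p.2.2 : ℚ)

def fractionMotif (l : List (HypergraphCode × ℕ × ℕ × ℕ)) : MotifCode :=
  l.map fun p => (p.1, fraction p.2)

/-- A combination of homomorphism counts to the hypergraphs in `W` that is `R` for `F` and vanishes
on the other hypergraphs in the list. -/
def IsSeparating (l : List HypergraphCode) (F : HypergraphCode)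
    (W : List (ℕ × ℕ × HypergraphCode)) (R : ℕ) : Prop :=
  0 < R ∧ ∀ F' ∈ l,
    (W.map fun w => w.1 * homCount F'.toHypergraph w.2.2.toHypergraph).sum =
      (W.map fun w => w.2.1 * homCount F'.toHypergraph w.2.2.toHypergraph).sum +
        if F' = F then R else 0

/-- The combination evaluates to `R` times the coefficient of `p` times the wanted count, and the
scale removes the first two factors. `R` is multiplied into the numerators so that the scale is
still the fraction of three natural numbers. -/
def separatingScheme (p : HypergraphCode × ℕ × ℕ × ℕ) (W : List (ℕ × ℕ × HypergraphCode))
    (R k : ℕ) : Scheme :=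
  (fraction (R * p.2.1, R * p.2.2.1, p.2.2.2),
    W.map fun w => ((w.1 : ℚ) - (w.2.1 : ℚ), gadget k w.2.2))

/-- By multiplicativity `ζ` on the products is a double sum. Summing over `W` first, the separation
property leaves only the entry `p`, with factor `R` times its nonzero coefficient. -/
theorem value_separatingScheme {l : List (HypergraphCode × ℕ × ℕ × ℕ)}
    (hl : (fractionMotif l).Valid) {p : HypergraphCode × ℕ × ℕ × ℕ} (hp : p ∈ l)
    {W : List (ℕ × ℕ × HypergraphCode)} {R k : ℕ} (hW : IsSeparating (l.map Prod.fst) p.1 W R)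
    (hk : ∀ p' ∈ l, p'.1.1 ≤ k) {G : HypergraphCode} (hG : G.Valid) :
    (separatingScheme p W R k).value (fractionMotif l) G =
      homCount p.1.toHypergraph G.toHypergraph := by
  have hp0 : fraction p.2 ≠ 0 := (hl.1 _ (List.mem_map_of_mem hp)).2
  have hR : (R : ℚ) ≠ 0 := Nat.cast_ne_zero.2 hW.1.ne'
  have hscale : fraction (R * p.2.1, R * p.2.2.1, p.2.2.2) = R * fraction p.2 := by
    simp only [fraction, Nat.cast_mul, ← mul_sub, mul_div_assoc]
  have hzeta (K : HypergraphCode) :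
      zeta (fractionMotif l).toMotif ((gadget k K).prod G).toHypergraph =
        (l.map fun p' => fraction p'.2 * homCount p'.1.toHypergraph G.toHypergraph *
          homCount p'.1.toHypergraph K.toHypergraph).sum := by
    rw [zeta_toMotif, fractionMotif, List.map_map]
    refine congrArg List.sum (List.map_congr_left fun p' hp' => ?_)
    rw [Function.comp_apply, homCount_gadget_prod ((card_vertexSet_toHypergraph _).trans_le
      (hk p' hp')) K hG, Nat.cast_mul, mul_assoc]
  have hswap (l : List (HypergraphCode × ℕ × ℕ × ℕ)) (f : ℕ × ℕ × HypergraphCode → ℚ)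
      (g : HypergraphCode × ℕ × ℕ × ℕ → ℚ)
      (h : HypergraphCode × ℕ × ℕ × ℕ → ℕ × ℕ × HypergraphCode → ℚ) :
      (W.map fun w => f w * (l.map fun p' => g p' * h p' w).sum).sum =
        (l.map fun p' => g p' * (W.map fun w => f w * h p' w).sum).sum := by
    induction l with
    | nil => simp
    | cons p' l ih =>
      simp only [List.map_cons, List.sum_cons, mul_add, List.sum_map_add, ih]
      rw [← List.sum_map_mul_left]
      congr 2
      exact List.map_congr_left fun w _ => by ring
  have hsep {p' : HypergraphCode × ℕ × ℕ × ℕ} (hp' : p' ∈ l) :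
      (W.map fun w => ((w.1 : ℚ) - (w.2.1 : ℚ)) *
        (homCount p'.1.toHypergraph w.2.2.toHypergraph : ℚ)).sum =
          if p'.1 = p.1 then (R : ℚ) else 0 := by
    have h := congrArg (Nat.cast (R := ℚ)) (hW.2 _ (List.mem_map_of_mem (f := Prod.fst) hp'))
    have hsub (W : List (ℕ × ℕ × HypergraphCode)) (f g : ℕ × ℕ × HypergraphCode → ℚ) :
        (W.map fun w => f w - g w).sum = (W.map f).sum - (W.map g).sum := by
      induction W with
      | nil => simp
      | cons w W ih => simp only [List.map_cons, List.sum_cons, ih]; ring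
    simp only [sub_mul]
    rw [hsub, sub_eq_iff_eq_add]
    simp only [Nat.cast_list_sum, List.map_map, Nat.cast_add, Function.comp_def, Nat.cast_mul,
      Nat.cast_ite, Nat.cast_zero] at h
    rw [h, add_comm]
  have hnodup : (l.map fun p' => p'.1.type).Nodup := by
    have := hl.2
    rwa [fractionMotif, List.map_map] at this
  rw [Scheme.value, separatingScheme, hscale, List.map_map, div_eq_iff (mul_ne_zero hR hp0)]
  simp only [Function.comp_def, hzeta]
  rw [hswap]
  rw [List.map_congr_left fun p' hp' => by rw [hsep hp']]
  -- Separation only compares codes; since the types in a valid description are distinct, `p` is the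
  -- only entry with its code and it occurs once.
  rw [List.sum_map_eq_nsmul_single p _ fun p' hp0' hp' => ?_]
  · have hcount {α : Type} [DecidableEq α] {l : List α} {a : α} (hl : l.Nodup) (ha : a ∈ l) :
        l.count a = 1 := List.count_eq_one_of_mem hl ha
    rw [hcount (List.Nodup.of_map _ hnodup) hp]
    simp
    ring
  · rw [if_neg, mul_zero]
    intro h
    exact hp0' (List.inj_on_of_nodup_map hnodup hp' hp (congrArg HypergraphCode.type h))

end HyperMotif

namespace HyperMotif

/-! ### Primitive recursive functions, compositionally -/

attribute [fun_prop] Primrec PrimrecPred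

attribute [fun_prop] Primrec.id Primrec.const Primrec.comp Primrec.fst Primrec.snd Primrec.pair
  PrimrecPred.and PrimrecPred.or PrimrecPred.not

section Primrec

variable {α β γ : Type*} [Primcodable α] [Primcodable β] [Primcodable γ]

@[fun_prop] theorem Primrec.fst_comp {f : α → β × γ} (hf : Primrec f) : Primrec fun a => (f a).1 :=
  Primrec.fst.comp hf

@[fun_prop] theorem Primrec.snd_comp {f : α → β × γ} (hf : Primrec f) : Primrec fun a => (f a).2 :=
  Primrec.snd.comp hf

@[fun_prop] theorem Primrec.add_comp {f g : α → ℕ} (hf : Primrec f) (hg : Primrec g) :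
    Primrec fun a => f a + g a := Primrec.nat_add.comp hf hg

@[fun_prop] theorem Primrec.mul_comp {f g : α → ℕ} (hf : Primrec f) (hg : Primrec g) :
    Primrec fun a => f a * g a := Primrec.nat_mul.comp hf hg

@[fun_prop] theorem Primrec.div_comp {f g : α → ℕ} (hf : Primrec f) (hg : Primrec g) :
    Primrec fun a => f a / g a := Primrec.nat_div.comp hf hg

@[fun_prop] theorem Primrec.mod_comp {f g : α → ℕ} (hf : Primrec f) (hg : Primrec g) :
    Primrec fun a => f a % g a := Primrec.nat_mod.comp hf hg

@[fun_prop] theorem Primrec.pow_comp {f g : α → ℕ} (hf : Primrec f) (hg : Primrec g) :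
    Primrec fun a => f a ^ g a := Primrec.nat_pow.comp hf hg

@[fun_prop] theorem Primrec.cons_comp {f : α → β} {g : α → List β} (hf : Primrec f)
    (hg : Primrec g) : Primrec fun a => f a :: g a := Primrec.list_cons.comp hf hg

@[fun_prop] theorem Primrec.append_comp {f g : α → List β} (hf : Primrec f) (hg : Primrec g) :
    Primrec fun a => f a ++ g a := Primrec.list_append.comp hf hg

@[fun_prop] theorem Primrec.reverse_comp {f : α → List β} (hf : Primrec f) :
    Primrec fun a => (f a).reverse := Primrec.list_reverse.comp hf

@[fun_prop] theorem Primrec.length_comp {f : α → List β} (hf : Primrec f) :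
    Primrec fun a => (f a).length := Primrec.list_length.comp hf

@[fun_prop] theorem Primrec.range_comp {f : α → ℕ} (hf : Primrec f) :
    Primrec fun a => List.range (f a) := Primrec.list_range.comp hf

@[fun_prop] theorem Primrec.map_comp {f : α → List β} {g : α → β → γ} (hf : Primrec f)
    (hg : Primrec fun p : α × β => g p.1 p.2) : Primrec fun a => (f a).map (g a) :=
  Primrec.list_map hf hg

@[fun_prop] theorem Primrec.flatMap_comp {f : α → List β} {g : α → β → List γ} (hf : Primrec f)
    (hg : Primrec fun p : α × β => g p.1 p.2) : Primrec fun a => (f a).flatMap (g a) :=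
  Primrec.list_flatMap hf hg

@[fun_prop] theorem Primrec.listSum_comp {f : α → List ℕ} (hf : Primrec f) :
    Primrec fun a => (f a).sum :=
  Primrec.list_foldr hf (Primrec.const 0)
    (Primrec.nat_add.comp₂ (Primrec.fst.comp₂ .right) (Primrec.snd.comp₂ .right))

@[fun_prop] theorem Primrec.ite_comp {c : α → Prop} [DecidablePred c] {f g : α → β}
    (hc : PrimrecPred c) (hf : Primrec f) (hg : Primrec g) :
    Primrec fun a => if c a then f a else g a := Primrec.ite hc hf hg

@[fun_prop] theorem PrimrecPred.le_comp {f g : α → ℕ} (hf : Primrec f) (hg : Primrec g) :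
    PrimrecPred fun a => f a ≤ g a := Primrec.nat_le.comp hf hg

@[fun_prop] theorem PrimrecPred.lt_comp {f g : α → ℕ} (hf : Primrec f) (hg : Primrec g) :
    PrimrecPred fun a => f a < g a := Primrec.nat_lt.comp hf hg

@[fun_prop] theorem PrimrecPred.eq_comp {f g : α → β} (hf : Primrec f) (hg : Primrec g) :
    PrimrecPred fun a => f a = g a := Primrec.eq.comp hf hg

@[fun_prop] theorem PrimrecPred.imp {p q : α → Prop} (hp : PrimrecPred p) (hq : PrimrecPred q) :
    PrimrecPred fun a => p a → q a :=
  (hp.not.or hq).of_eq fun _ => imp_iff_not_or.symm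

@[fun_prop] theorem PrimrecPred.forall_mem {L : α → List β} {R : α → β → Prop} (hL : Primrec L)
    (hR : PrimrecPred fun p : α × β => R p.1 p.2) : PrimrecPred fun a => ∀ b ∈ L a, R a b :=
  (PrimrecRel.forall_mem_list (R := fun b a => R a b)
    (hR.comp (Primrec.pair Primrec.snd Primrec.fst))).comp hL Primrec.id

@[fun_prop] theorem PrimrecPred.exists_mem {L : α → List β} {R : α → β → Prop} (hL : Primrec L)
    (hR : PrimrecPred fun p : α × β => R p.1 p.2) : PrimrecPred fun a => ∃ b ∈ L a, R a b :=
  (PrimrecRel.exists_mem_list (R := fun b a => R a b)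
    (hR.comp (Primrec.pair Primrec.snd Primrec.fst))).comp hL Primrec.id

@[fun_prop] theorem PrimrecPred.forall_lt_comp {n : α → ℕ} {R : α → ℕ → Prop} (hn : Primrec n)
    (hR : PrimrecPred fun p : α × ℕ => R p.1 p.2) : PrimrecPred fun a => ∀ i < n a, R a i :=
  (PrimrecPred.forall_mem (Primrec.list_range.comp hn) hR).of_eq fun a => by simp

@[fun_prop] theorem PrimrecPred.exists_lt_comp {n : α → ℕ} {R : α → ℕ → Prop} (hn : Primrec n)
    (hR : PrimrecPred fun p : α × ℕ => R p.1 p.2) : PrimrecPred fun a => ∃ i < n a, R a i :=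
  (PrimrecPred.exists_mem (Primrec.list_range.comp hn) hR).of_eq fun a => by simp

@[fun_prop] theorem PrimrecPred.mem_comp {f : α → β} {L : α → List β} (hf : Primrec f)
    (hL : Primrec L) : PrimrecPred fun a => f a ∈ L a :=
  (PrimrecPred.exists_mem (R := fun a b => b = f a) hL (by fun_prop)).of_eq fun a => by simp

@[fun_prop] theorem Primrec.filter_comp {L : α → List β} {R : α → β → Prop}
    [∀ a, DecidablePred (R a)] (hL : Primrec L) (hR : PrimrecPred fun p : α × β => R p.1 p.2) :
    Primrec fun a => (L a).filter fun b => R a b := by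
  have h : Primrec fun a => (L a).flatMap fun b => if R a b then [b] else [] := by fun_prop
  refine h.of_eq fun a => ?_
  induction L a with
  | nil => rfl
  | cons b l ih => by_cases hb : R a b <;> simp [hb, ih]

end Primrec

/-! ### Homomorphism counts and gadgets are primitive recursive -/

/-- The vertex map given by the digits of `x` in base `n`. -/
def digitMap (n x v : ℕ) : ℕ := x / n ^ v % n

/-- List entries that are empty or leave the vertex set are skipped, in accordance with
`toHypergraph`. The clause `v = v` expresses nonemptiness by a bounded quantifier. -/
def IsHomCode (c K : HypergraphCode) (x : ℕ) : Prop :=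
  ∀ e ∈ c.2, (∃ v ∈ e, v = v) → (∀ v ∈ e, v < c.1) → ∃ f ∈ K.2,
    (∀ v ∈ e, digitMap K.1 x v ∈ f) ∧ ∀ w ∈ f, ∃ v ∈ e, digitMap K.1 x v = w

instance (c K : HypergraphCode) : DecidablePred (IsHomCode c K) := fun x => by
  unfold IsHomCode; infer_instance

@[fun_prop] theorem Primrec.digitMap {α : Type*} [Primcodable α] {n x v : α → ℕ} (hn : Primrec n)
    (hx : Primrec x) (hv : Primrec v) : Primrec fun a => HyperMotif.digitMap (n a) (x a) (v a) := by
  unfold HyperMotif.digitMap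
  fun_prop

@[fun_prop] theorem primrecPred_isHomCode {α : Type*} [Primcodable α] {c K : α → HypergraphCode}
    {x : α → ℕ} (hc : Primrec c) (hK : Primrec K) (hx : Primrec x) :
    PrimrecPred fun a => IsHomCode (c a) (K a) (x a) := by
  unfold IsHomCode
  fun_prop

theorem isHom_iff_isHomCode {c K : HypergraphCode} {x : ℕ}
    {φ : c.toHypergraph.vertexSet → K.toHypergraph.vertexSet}
    (hφ : ∀ v, (φ v : ℕ) = digitMap K.1 x v) : IsHom φ ↔ IsHomCode c K x := by
  have himage {e : List ℕ} (he : ∀ v ∈ e, v < c.1) (w : ℕ) :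
      w ∈ imageSet φ {v | v ∈ e} ↔ ∃ v ∈ e, digitMap K.1 x v = w := by
    constructor
    · rintro ⟨v, hv, rfl⟩
      exact ⟨v, hv, (hφ v).symm⟩
    · rintro ⟨v, hv, rfl⟩
      exact ⟨⟨v, he v hv⟩, hv, hφ _⟩
  constructor
  · rintro h e he ⟨v, hv, -⟩ hlt
    obtain ⟨-, -, f, hf, hfe⟩ := h {v | v ∈ e} ⟨⟨v, hv⟩, fun v hv => hlt v hv, e, he, rfl⟩
    refine ⟨f, hf, fun v hv => ?_, fun w hw => ?_⟩
    · have := (himage hlt _).2 ⟨v, hv, rfl⟩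
      rwa [hfe] at this
    · have : w ∈ imageSet φ {v | v ∈ e} := by rwa [hfe]
      exact (himage hlt w).1 this
  · rintro h _ ⟨⟨v, hv⟩, hlt, e, he, rfl⟩
    obtain ⟨f, hf, h1, h2⟩ := h e he ⟨v, hv, rfl⟩ fun v hv => hlt hv
    refine ⟨⟨_, ⟨⟨v, hlt hv⟩, hv, rfl⟩⟩, imageSet_subset _ _, f, hf, ?_⟩
    ext w
    rw [himage fun v hv => hlt hv]
    constructor
    · rintro ⟨v, hv, rfl⟩
      exact h1 v hv
    · exact h2 w

/-- Maps between the vertex sets of codes, as numbers. -/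
def vertexMapEquiv (c K : HypergraphCode) :
    (c.toHypergraph.vertexSet → K.toHypergraph.vertexSet) ≃ Fin (K.1 ^ c.1) :=
  (Equiv.arrowCongr (Fin.equivSubtype (n := c.1)).symm (Fin.equivSubtype (n := K.1)).symm).trans
    finFunctionFinEquiv

theorem vertexMapEquiv_spec (c K : HypergraphCode)
    (φ : c.toHypergraph.vertexSet → K.toHypergraph.vertexSet) (v : c.toHypergraph.vertexSet) :
    (φ v : ℕ) = digitMap K.1 (vertexMapEquiv c K φ) v := by
  obtain ⟨x, rfl⟩ := (vertexMapEquiv c K).symm.surjective φ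
  rw [Equiv.apply_symm_apply]
  rfl

/-- Vertex maps correspond to the numbers below `K.1 ^ c.1` through their digits in base `K.1`.
Counting homomorphisms becomes a bounded count of a primitive recursive property. -/
theorem homCount_eq (c K : HypergraphCode) : homCount c.toHypergraph K.toHypergraph =
    ((List.range (K.1 ^ c.1)).filter fun x => IsHomCode c K x).length := by
  rw [homCount, Nat.card_congr ((vertexMapEquiv c K).subtypeEquiv
    (q := fun x : Fin _ => IsHomCode c K (x : ℕ))
      fun φ => isHom_iff_isHomCode (vertexMapEquiv_spec c K φ)), Nat.card_eq_fintype_card,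
    Fintype.card_subtype, ← List.toFinset_card_of_nodup (List.nodup_range.filter _)]
  refine Finset.card_bij (fun x _ => (x : ℕ)) ?_ (fun x _ y _ h => Fin.ext h) fun x hx => ?_
  · intro x hx
    simpa using hx
  · simp only [List.mem_toFinset, List.mem_filter, List.mem_range, decide_eq_true_eq] at hx
    exact ⟨⟨x, hx.1⟩, by simpa using hx.2, rfl⟩

@[fun_prop] theorem Primrec.homCount {α : Type*} [Primcodable α] {c K : α → HypergraphCode}
    (hc : Primrec c) (hK : Primrec K) :
    Primrec fun a => HyperMotif.homCount (c a).toHypergraph (K a).toHypergraph := by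
  simp only [homCount_eq]
  fun_prop

/-- Surjective homomorphisms in both directions suffice by `equiv_of_surjective_homs`, which makes
isomorphism a matter of two bounded searches. -/
theorem equiv_iff (c K : HypergraphCode) : c.toHypergraph ≈ K.toHypergraph ↔
    (∃ x < K.1 ^ c.1, IsHomCode c K x ∧ ∀ w < K.1, ∃ v < c.1, digitMap K.1 x v = w) ∧
      ∃ x < c.1 ^ K.1, IsHomCode K c x ∧ ∀ w < c.1, ∃ v < K.1, digitMap c.1 x v = w := by
  have aux (c K : HypergraphCode) :
      (∃ φ : c.toHypergraph.vertexSet → K.toHypergraph.vertexSet, IsHom φ ∧ φ.Surjective) ↔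
      ∃ x < K.1 ^ c.1, IsHomCode c K x ∧ ∀ w < K.1, ∃ v < c.1, digitMap K.1 x v = w := by
    have h1 {φ : c.toHypergraph.vertexSet → K.toHypergraph.vertexSet} {x : ℕ}
        (hφ : ∀ v, (φ v : ℕ) = digitMap K.1 x v) : φ.Surjective ↔
          ∀ w < K.1, ∃ v < c.1, digitMap K.1 x v = w := by
      constructor
      · intro h w hw
        obtain ⟨v, hv⟩ := h ⟨w, hw⟩
        exact ⟨v, v.2, by rw [← hφ, hv]⟩
      · rintro h ⟨w, hw⟩
        obtain ⟨v, hv, h⟩ := h w hw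
        exact ⟨⟨v, hv⟩, Subtype.ext (by rw [hφ, h])⟩
    constructor
    · rintro ⟨φ, hφ, hs⟩
      have hs' := vertexMapEquiv_spec c K φ
      exact ⟨_, (vertexMapEquiv c K φ).2, (isHom_iff_isHomCode hs').1 hφ, (h1 hs').1 hs⟩
    · rintro ⟨x, hx, hφ, hs⟩
      have hs' := vertexMapEquiv_spec c K ((vertexMapEquiv c K).symm ⟨x, hx⟩)
      rw [Equiv.apply_symm_apply] at hs'
      exact ⟨_, (isHom_iff_isHomCode hs').2 hφ, (h1 hs').2 hs⟩
  rw [← aux, ← aux]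
  constructor
  · rintro ⟨σ, hσ⟩
    exact ⟨⟨σ, hσ.isHom, σ.surjective⟩, ⟨σ.symm, hσ.symm.isHom, σ.symm.surjective⟩⟩
  · rintro ⟨⟨φ, hφ, hφs⟩, ψ, hψ, hψs⟩
    exact equiv_of_surjective_homs hφ hψ hφs hψs

@[fun_prop] theorem primrecPred_equiv {α : Type*} [Primcodable α] {c K : α → HypergraphCode}
    (hc : Primrec c) (hK : Primrec K) :
    PrimrecPred fun a => (c a).toHypergraph ≈ (K a).toHypergraph := by
  simp only [equiv_iff]
  fun_prop

@[fun_prop] theorem Primrec.gadget {α : Type*} [Primcodable α] {k : α → ℕ} {K : α → HypergraphCode}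
    (hk : Primrec k) (hK : Primrec K) : Primrec fun a => HyperMotif.gadget (k a) (K a) := by
  unfold HyperMotif.gadget patterns bitPoints IsPattern
  fun_prop

end HyperMotif

namespace HyperMotif

open Encodable

/-! ### Stack programs for data, primitive recursively -/

/-- A stack program that pushes `a x` can be computed from `x` primitive recursively. -/
def PrimrecData {α : Type*} [Primcodable α] (a : α → Data) : Prop :=
  ∃ f : α → List ℕ, Primrec f ∧ ∀ x s, stackRun (f x) s = .pair (a x) s

attribute [fun_prop] PrimrecData

section PrimrecData

variable {α β : Type*} [Primcodable α] [Primcodable β]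

@[fun_prop] theorem PrimrecData.comp {a : β → Data} {g : α → β} (ha : PrimrecData a)
    (hg : Primrec g) : PrimrecData fun x => a (g x) := by
  obtain ⟨f, hf, ha⟩ := ha
  exact ⟨fun x => f (g x), hf.comp hg, fun x s => ha _ s⟩

@[fun_prop] theorem PrimrecData.ofNat {n : α → ℕ} (hn : Primrec n) :
    PrimrecData fun x => .ofNat (n x) :=
  ⟨fun x => [n x + 3], by fun_prop, fun x s => by simp⟩

@[fun_prop] theorem PrimrecData.pair {a b : α → Data} (ha : PrimrecData a) (hb : PrimrecData b) :
    PrimrecData fun x => .pair (a x) (b x) := by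
  obtain ⟨f, hf, ha⟩ := ha
  obtain ⟨g, hg, hb⟩ := hb
  exact ⟨fun x => g x ++ f x ++ [0], by fun_prop, fun x s => by simp [stackRun_append, ha, hb]⟩

@[fun_prop] theorem PrimrecData.sub {n k : α → ℕ} (hn : Primrec n) (hk : Primrec k) :
    PrimrecData fun x => .rat ((n x : ℚ) - (k x : ℚ)) :=
  ⟨fun x => [k x + 3] ++ [n x + 3] ++ [1], by fun_prop, fun x s => by
    simp only [stackRun_append, stackRun_push, Data.ofNat, stackRun_sub]⟩

@[fun_prop] theorem PrimrecData.fraction {p : α → ℕ × ℕ × ℕ} (hp : Primrec p) :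
    PrimrecData fun x => .rat (fraction (p x)) :=
  ⟨fun x => [(p x).2.2 + 3] ++ [(p x).2.1 + 3] ++ [(p x).1 + 3] ++ [1] ++ [2], by fun_prop,
    fun x s => by
      simp only [stackRun_append, stackRun_push, Data.ofNat, stackRun_sub, stackRun_div]; rfl⟩

@[fun_prop] theorem PrimrecData.ofList_map {L : α → List β} {a : α → β → Data} (hL : Primrec L)
    (ha : PrimrecData fun p : α × β => a p.1 p.2) :
    PrimrecData fun x => .ofList ((L x).map (a x)) := by
  obtain ⟨f, hf, ha⟩ := ha
  -- The operation `0 + 3` pushes the leaf `0`, the empty list. The entries are then pushed from the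
  -- last to the first, each one being paired with the list below it.
  refine ⟨fun x => [0 + 3] ++ (L x).reverse.flatMap fun b => f (x, b) ++ [0], by fun_prop,
    fun x s => ?_⟩
  rw [stackRun_append, stackRun_push]
  beta_reduce
  induction L x with
  | nil => rfl
  | cons b l ih =>
    rw [List.reverse_cons, List.flatMap_append, stackRun_append, ih]
    simp [stackRun_append, ha]

@[fun_prop] theorem PrimrecData.ofHypergraph {c : α → HypergraphCode} (hc : Primrec c) :
    PrimrecData fun x => .ofHypergraph (c x) := by
  unfold Data.ofHypergraph
  fun_prop

@[fun_prop] theorem PrimrecData.ofGadget {g : α → Gadget} (hg : Primrec g) :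
    PrimrecData fun x => .ofGadget (g x) := by
  have hpoint : Data.ofPoint = fun y => .pair (.ofList ((List.range y.1).map fun _ => .ofNat 0))
      (.ofNat y.2) := by
    funext y
    simp [Data.ofPoint, Data.ofNat]
  have hpattern : PrimrecData fun P : List (ℕ × ℕ) => .ofList (P.map Data.ofPoint) := by
    rw [hpoint]
    fun_prop
  have hpatterns : PrimrecData fun l : List (List (ℕ × ℕ)) => .ofList (l.map Data.ofPattern) :=
    .ofList_map .id (hpattern.comp Primrec.snd)
  exact .pair (by fun_prop) (.ofList_map (by fun_prop) (hpatterns.comp Primrec.snd))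

@[fun_prop] theorem PrimrecData.ofMotif {l : α → List (HypergraphCode × ℕ × ℕ × ℕ)}
    (hl : Primrec l) : PrimrecData fun x => .ofMotif (fractionMotif (l x)) := by
  unfold Data.ofMotif fractionMotif
  simp only [List.map_map, Function.comp_def]
  fun_prop

@[fun_prop] theorem PrimrecData.ofScheme {p : α → HypergraphCode × ℕ × ℕ × ℕ}
    {W : α → List (ℕ × ℕ × HypergraphCode)} {R k : α → ℕ} (hp : Primrec p) (hW : Primrec W)
    (hR : Primrec R) (hk : Primrec k) :
    PrimrecData fun x => .ofScheme (separatingScheme (p x) (W x) (R x) (k x)) := by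
  unfold Data.ofScheme separatingScheme
  simp only [List.map_map, Function.comp_def]
  unfold Data.ofTerm
  fun_prop

end PrimrecData

/-! ### Witnesses -/

/-- Kleene's normal form: the second argument limits the evaluation of a partial recursive code, and
evaluation with a limit is primitive recursive. -/
theorem REPred.exists_primrecPred {α : Type*} [Primcodable α] {p : α → Prop} (hp : REPred p) :
    ∃ R : α → ℕ → Prop, (PrimrecPred fun x : α × ℕ => R x.1 x.2) ∧ ∀ a, p a ↔ ∃ s, R a s := by
  obtain ⟨A, hA⟩ := Nat.Partrec.Code.exists_code.1 hp
  refine ⟨fun a s => (A.evaln s (encode a)).isSome, ?_, fun a => ?_⟩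
  · exact Primrec.eq.comp (Primrec.option_isSome.comp (Nat.Partrec.Code.primrec_evaln.comp
      ((Primrec.snd.pair (.const A)).pair (Primrec.encode.comp .fst)))) (.const true)
  · have h : p a ↔ (A.eval (encode a)).Dom := by
      rw [hA]
      simp [encodek, Part.assert]
    simp only [h, Part.dom_iff_mem, Nat.Partrec.Code.evaln_complete, Option.isSome_iff_exists,
      Option.mem_def]
    exact exists_comm

/-- A description `l`, one of its entries `p`, a separating combination `W`, `R`, a bound on the
number of vertices of the hypergraphs in `l`, and a number of steps. -/
abbrev Witness : Type := List (HypergraphCode × ℕ × ℕ × ℕ) × (HypergraphCode × ℕ × ℕ × ℕ) ×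
  List (ℕ × ℕ × HypergraphCode) × ℕ × ℕ × ℕ

/-- `w` witnesses that the hypergraph `c` occurs in one of the lists that satisfy `∃ s, T l s`. -/
def IsWitness (T : List (HypergraphCode × ℕ × ℕ × ℕ) → ℕ → Prop) (c : HypergraphCode)
    (w : Witness) : Prop :=
  T w.1 w.2.2.2.2.2 ∧ w.2.1 ∈ w.1 ∧ w.2.1.1.toHypergraph ≈ c.toHypergraph ∧
    (∀ p ∈ w.1, p.1.1 ≤ w.2.2.2.2.1) ∧ IsSeparating (w.1.map Prod.fst) w.2.1.1 w.2.2.1 w.2.2.2.1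

-- Membership of the described function in `Γ` and validity of the description are not tested
-- directly; the step count in the witness certifies both through `T`.
@[fun_prop] theorem PrimrecPred.isWitness {α : Type*} [Primcodable α]
    {T : List (HypergraphCode × ℕ × ℕ × ℕ) → ℕ → Prop}
    (hT : PrimrecPred fun x : List (HypergraphCode × ℕ × ℕ × ℕ) × ℕ => T x.1 x.2)
    {c : α → HypergraphCode} {w : α → Witness} (hc : Primrec c) (hw : Primrec w) :
    PrimrecPred fun x => IsWitness T (c x) (w x) := by
  have h : PrimrecPred fun x => T (w x).1 (w x).2.2.2.2.2 :=
    hT.comp (f := fun x => ((w x).1, (w x).2.2.2.2.2)) (by fun_prop)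
  unfold IsWitness IsSeparating
  exact h.and (by fun_prop)

theorem exists_fractionMotif (γ : MotifFunction) :
    ∃ l, (fractionMotif l).Valid ∧ (fractionMotif l).toMotif = γ := by
  classical
  have hc (F : HypergraphType) : ∃ c : HypergraphCode, c.Valid ∧ c.type = F := by
    obtain ⟨H, rfl⟩ := Quotient.exists_rep F
    obtain ⟨c, hc, h⟩ := exists_code H
    exact ⟨c, hc, Quotient.sound h⟩
  choose c hc hcF using hc
  have hq (q : ℚ) : fraction (q.num.toNat, (-q.num).toNat, q.den) = q := by
    have h : ((q.num.toNat : ℤ) : ℚ) - (((-q.num).toNat : ℤ) : ℚ) = q.num := by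
      exact_mod_cast Int.toNat_sub_toNat_neg q.num
    rw [fraction, ← Int.cast_natCast, ← Int.cast_natCast (n := (-q.num).toNat), h, Rat.num_div_den]
  have hl : fractionMotif (γ.support.toList.map fun F =>
      (c F, (γ F).num.toNat, (-(γ F).num).toNat, (γ F).den)) =
        γ.support.toList.map fun F => (c F, γ F) := by
    simp only [fractionMotif, List.map_map, Function.comp_def, hq]
  refine ⟨γ.support.toList.map fun F => (c F, (γ F).num.toNat, (-(γ F).num).toNat, (γ F).den), ?_⟩
  rw [hl]
  refine ⟨⟨?_, ?_⟩, ?_⟩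
  · simp only [List.mem_map, Finset.mem_toList]
    rintro _ ⟨F, hF, rfl⟩
    exact ⟨hc F, Finsupp.mem_support_iff.1 hF⟩
  · simpa only [List.map_map, Function.comp_def, hcF, List.map_id'] using γ.support.nodup_toList
  · rw [MotifCode.toMotif, List.map_map, Finset.sum_map_toList]
    simp only [Function.comp_def, hcF]
    exact γ.sum_single

/-- This guarantees that the search ends: some member of `Γ` has the hypergraph in its support, its
description is eventually accepted, and its list of hypergraphs admits a separating combination. -/
theorem exists_isWitness {Γ : Set MotifFunction}
    {T : List (HypergraphCode × ℕ × ℕ × ℕ) → ℕ → Prop}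
    (hT : ∀ l, (fractionMotif l).Valid ∧ (fractionMotif l).toMotif ∈ Γ ↔ ∃ s, T l s)
    {c : HypergraphCode} (hc : c.type ∈ supports Γ) : ∃ w, IsWitness T c w := by
  obtain ⟨γ, hγ, hcγ⟩ := hc
  obtain ⟨l, hl, rfl⟩ := exists_fractionMotif γ
  obtain ⟨s, hs⟩ := (hT l).1 ⟨hl, hγ⟩
  have hmem : ∃ p ∈ l, p.1.type = c.type := by
    by_contra! h
    refine Finsupp.mem_support_iff.1 hcγ (toMotif_apply_of_notMem _ _ fun h' => ?_)
    simp only [fractionMotif, List.map_map, List.mem_map] at h'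
    obtain ⟨p, hp, h'⟩ := h'
    exact h p hp h'
  obtain ⟨p, hp, hpc⟩ := hmem
  have hk : ∀ p ∈ l, p.1.1 ≤ (l.map fun p => p.1.1).sum := fun p hp =>
    List.single_le_sum (fun _ _ => Nat.zero_le _) _ (List.mem_map_of_mem hp)
  obtain ⟨W, R, hR, hW⟩ := exists_separating (l := l.map Prod.fst)
    (by simpa [fractionMotif, List.map_map, Function.comp_def] using hl.2) p.1
    (k := (l.map fun p => p.1.1).sum) (by
      intro F hF
      obtain ⟨p, hp, rfl⟩ := List.mem_map.1 hF
      exact hk p hp)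
  exact ⟨(l, p, W, R, _, s), hs, hp, Quotient.exact hpc, hk, hR, hW⟩

end HyperMotif

namespace HyperMotif

open Encodable

/-! ### The reduction from counting homomorphisms -/

/-- The object with code `n`. -/
def decodeD (α : Type*) [Primcodable α] [Inhabited α] (n : ℕ) : α := (decode n).getD default

@[simp] theorem decodeD_encode {α : Type*} [Primcodable α] [Inhabited α] (a : α) :
    decodeD α (encode a) = a := by simp [decodeD]

@[fun_prop] theorem Primrec.decodeD {α β : Type*} [Primcodable α] [Primcodable β] [Inhabited β]
    {n : α → ℕ} (hn : Primrec n) : Primrec fun a => HyperMotif.decodeD β (n a) :=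
  Primrec.option_getD.comp (Primrec.decode.comp hn) (.const default)

@[fun_prop] theorem Primrec.natPair_comp {α : Type*} [Primcodable α] {f g : α → ℕ}
    (hf : Primrec f) (hg : Primrec g) : Primrec fun a => Nat.pair (f a) (g a) :=
  Primrec₂.natPair.comp hf hg

@[fun_prop] theorem Primrec.natUnpair_comp {α : Type*} [Primcodable α] {f : α → ℕ}
    (hf : Primrec f) : Primrec fun a => Nat.unpair (f a) := Primrec.unpair.comp hf

@[fun_prop] theorem Primrec.encode_comp {α β : Type*} [Primcodable α] [Primcodable β] {f : α → β}
    (hf : Primrec f) : Primrec fun a => encode (f a) := Primrec.encode.comp hf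

/-- The motif function and the scheme given by a witness. -/
def Witness.data (w : Witness) : Data :=
  .pair (.ofMotif (fractionMotif w.1)) (.ofScheme (separatingScheme w.2.1 w.2.2.1 w.2.2.2.1 w.2.2.2.2.1))

theorem primrecData_witness : PrimrecData Witness.data := by
  unfold Witness.data
  fun_prop

variable {T : List (HypergraphCode × ℕ × ℕ × ℕ) → ℕ → Prop}

/-- The search stops at the first witness, so `k` is a function of `c` and all costs of the search
depend on `c` alone. -/
def IsLeastWitness (T : List (HypergraphCode × ℕ × ℕ × ℕ) → ℕ → Prop) (c : HypergraphCode)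
    (k : ℕ) : Prop :=
  IsWitness T c (decodeD Witness k) ∧ ∀ j < k, ¬ IsWitness T c (decodeD Witness j)

/-- The program codes `c` as a number, searches for the least witness, computes a stack program for
the corresponding data and executes it. One primitive recursive `B` bounds these costs and also the
length of the data, which later bounds the parameter of the queries. -/
theorem exists_program_witness
    (hT : PrimrecPred fun x : List (HypergraphCode × ℕ × ℕ × ℕ) × ℕ => T x.1 x.2) :
    ∃ (p : Prog) (B : ℕ → ℕ), Primrec B ∧
      (∀ n k, (decodeD Witness k).data.size ≤ B (Nat.pair n k)) ∧
      PT (fun x : {x : (Data → Data → Prop) × HypergraphCode × ℕ // IsLeastWitness T x.2.1 x.2.2} =>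
        (Data.ofHypergraph x.1.2.1).size + B (Nat.pair (encode x.1.2.1) x.1.2.2)) (fun x => x.1.1) p
        (fun x => .ofHypergraph x.1.2.1) (fun x => (decodeD Witness x.1.2.2).data) := by
  classical
  obtain ⟨e, he, hdata⟩ := primrecData_witness
  let test (n : ℕ) : ℕ :=
    if IsWitness T (decodeD HypergraphCode n.unpair.1) (decodeD Witness n.unpair.2) then 0 else 1
  have htest : Primrec test := by fun_prop
  obtain ⟨pt, At, hAt, ht⟩ := exists_primrecTime (Primrec.nat_iff.1 htest)
  let out (k : ℕ) : ℕ := encode (e (decodeD Witness k))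
  have hout : Primrec out := by fun_prop
  obtain ⟨po, Ao, hAo, ho⟩ := exists_primrecTime (Primrec.nat_iff.1 hout)
  obtain ⟨Ab, hAb, hb⟩ := primrecTime_build
  obtain ⟨C, hC⟩ := hb.size_out
  -- For `x = (n, k)` the summands cover the code of the hypergraph, the index of the witness, all
  -- tests up to `k`, the computation of the stack program, its execution, and the length of its
  -- result.
  let B (x : ℕ) : ℕ := x.unpair.1 + x.unpair.2 +
    ((List.range (x.unpair.2 + 1)).map fun j => At (Nat.pair x.unpair.1 j)).sum +
    Ao x.unpair.2 + Ab (out x.unpair.2) + (Ab (out x.unpair.2) + 2) ^ C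
  have hB (n k : ℕ) : B (Nat.pair n k) = n + k +
      ((List.range (k + 1)).map fun j => At (Nat.pair n j)).sum +
      Ao k + Ab (out k) + (Ab (out k) + 2) ^ C := by simp only [B, Nat.unpair_pair]
  have hrun (k : ℕ) : Instr.fst.eval (stackRun (e (decodeD Witness k)) (.rat 0)) =
      (decodeD Witness k).data := by rw [hdata, Instr.eval_fst_pair]
  refine ⟨.seq .encodeHypergraph (.seq (.search pt) (.seq po .build)), B, by fun_prop, ?_, ?_⟩
  · intro n k
    have := hC (fun _ _ => False, e (decodeD Witness k))
    simp only [hrun] at this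
    refine this.trans ?_
    rw [hB]
    exact Nat.le_add_left _ _
  · have hm {ι : Type} {m f : ι → ℕ} (h : ∀ i, f i ≤ m i) : PB m f := PB.self.mono h
    refine (PT.encodeHypergraph (c := fun x : {x : (Data → Data → Prop) × HypergraphCode × ℕ //
      IsLeastWitness T x.2.1 x.2.2} => x.1.2.1) (hm fun x => ?_) (hm fun x => ?_)).seq
      ((PT.search (k := fun x => x.1.2.2) ht (hm fun x => ?_) (hm fun x => ?_)
        (hm fun x => ?_) (fun x => ?_) fun x j hj => ?_).seq
      (PT.seq ((ho.comp fun x : {x : (Data → Data → Prop) × HypergraphCode × ℕ //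
      IsLeastWitness T x.2.1 x.2.2} => (x.1.1, x.1.2.2)).measure (hm fun x => ?_))
        (PT.congr ((hb.comp fun x : {x : (Data → Data → Prop) × HypergraphCode × ℕ //
      IsLeastWitness T x.2.1 x.2.2} => (x.1.1, e (decodeD Witness x.1.2.2))).measure
          (hm fun x => ?_)) (fun x => rfl) fun x => (hrun _).symm)))
    · rw [hB]; omega
    · exact Nat.le_add_right _ _
    · rw [hB]; omega
    · rw [hB]; omega
    · have := List.single_le_sum (fun _ _ => Nat.zero_le _) _ (List.mem_map_of_mem
        (f := fun j => At (Nat.pair (encode x.1.1.1.2.1) j)) (List.mem_range.2 (Order.lt_add_one_iff.2 x.2)))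
      rw [hB]
      omega
    · simpa only [test, Nat.unpair_pair, decodeD_encode] using if_pos x.2.1
    · simpa only [test, Nat.unpair_pair, decodeD_encode, if_neg (x.2.2 j hj)] using one_ne_zero
    · change Ao x.1.2.2 ≤ _
      rw [hB]; omega
    · rw [hB]; simp only [out]; omega

end HyperMotif

/-! ### Bounds in terms of the number of vertices -/

namespace HyperMotif

open Encodable

theorem Nat_pair_le_pair {a b a' b' : ℕ} (ha : a ≤ a') (hb : b ≤ b') :
    Nat.pair a b ≤ Nat.pair a' b' :=
  (StrictMono.monotone (fun _ _ h => Nat.pair_lt_pair_left b h) ha).trans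
    (StrictMono.monotone (fun _ _ h => Nat.pair_lt_pair_right a' h) hb)

/-- A bound on the codes of the lists of length at most `k` with entries at most `b`. -/
def listBound (b k : ℕ) : ℕ := k.rec 0 fun _ r => Nat.pair b r + 1

theorem encode_le_listBound {α : Type*} [Encodable α] {b k : ℕ} {l : List α} (hl : l.length ≤ k)
    (hb : ∀ a ∈ l, encode a ≤ b) : encode l ≤ listBound b k := by
  induction k generalizing l with
  | zero => simp [List.length_eq_zero_iff.1 (Nat.le_zero.1 hl)]
  | succ k ih =>
    cases l with
    | nil => simp
    | cons a l =>
      rw [encode_list_cons]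
      exact Nat.succ_le_succ (Nat_pair_le_pair (hb a List.mem_cons_self)
        (ih (Nat.le_of_succ_le_succ hl) fun a ha => hb a (List.mem_cons_of_mem _ ha)))

@[fun_prop] theorem Primrec.listBound {α : Type*} [Primcodable α] {b k : α → ℕ} (hb : Primrec b)
    (hk : Primrec k) : Primrec fun x => HyperMotif.listBound (b x) (k x) :=
  Primrec.nat_rec' (g := fun _ => 0) (h := fun x p => Nat.pair (b x) p.2 + 1) hk (.const 0) (by
    unfold Primrec₂
    fun_prop)

/-- A valid code lists at most `2 ^ n` different edges, each without repetitions and hence with at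
most `n` entries. The parameter is the number of vertices and not the length of the description, so
a bound on the code by that number alone is needed to pass to a maximum over all inputs with the
same parameter. -/
theorem HypergraphCode.Valid.encode_le {c : HypergraphCode} (hc : c.Valid) :
    encode c ≤ Nat.pair c.1 (listBound (listBound c.1 c.1) (2 ^ c.1)) := by
  rw [encode_prod_val]
  refine Nat_pair_le_pair le_rfl (encode_le_listBound ?_ fun e he => ?_)
  · have h : (c.2.map List.toFinset).Nodup := by
      refine List.pairwise_map.2 (hc.2.imp fun {e e'} h h' => h fun v => ?_)
      rw [← List.mem_toFinset, h', List.mem_toFinset]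
    rw [← List.length_map (f := List.toFinset), ← List.toFinset_card_of_nodup h,
      ← Finset.card_range c.1, ← Finset.card_powerset]
    refine Finset.card_le_card fun s hs => ?_
    obtain ⟨e, he, rfl⟩ := List.mem_map.1 (List.mem_toFinset.1 hs)
    exact Finset.mem_powerset.2 fun v hv =>
      Finset.mem_range.2 ((hc.1 e he).2.2 v (List.mem_toFinset.1 hv))
  · obtain ⟨-, hnd, hlt⟩ := hc.1 e he
    refine encode_le_listBound ?_ fun v hv => (hlt v hv).le
    rw [← List.toFinset_card_of_nodup hnd]
    refine (Finset.card_le_card fun v hv => ?_).trans_eq (Finset.card_range c.1)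
    exact Finset.mem_range.2 (hlt v (List.mem_toFinset.1 hv))

theorem Computable.sum_range {F N : ℕ → ℕ} (hF : Computable F) (hN : Computable N) :
    Computable fun n => ∑ i ∈ Finset.range (N n), F i := by
  refine (Computable.nat_rec (f := N) (g := fun _ => 0) (h := fun _ p => p.2 + F p.1) hN
    (.const 0) (Primrec.nat_add.to_comp.comp (Computable.snd.comp .snd)
      (hF.comp (Computable.fst.comp .snd)))).of_eq fun n => ?_
  induction N n with
  | zero => rfl
  | succ k ih => simp only [ih, Finset.sum_range_succ]

variable {Γ : Set MotifFunction} {T : List (HypergraphCode × ℕ × ℕ × ℕ) → ℕ → Prop}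

/-! ### Assembling the reduction -/

theorem PT.evalWitness {ι : Type*} {m : ι → ℕ} {O : ι → Data → Data → Prop} {c G : ι → HypergraphCode}
    {w : ι → Witness} (h : PB m fun i => (Data.pair (.ofHypergraph (G i)) (w i).data).size)
    (hTΓ : ∀ l, (fractionMotif l).Valid ∧ (fractionMotif l).toMotif ∈ Γ ↔ ∃ s, T l s)
    (hw : ∀ i, IsWitness T (c i) (w i)) (hG : ∀ i, (G i).Valid)
    (hO : ∀ i, ∀ G : HypergraphCode, G.Valid →
      O i (.pair (.ofMotif (fractionMotif (w i).1)) (.ofHypergraph G))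
        (.rat (zeta (fractionMotif (w i).1).toMotif G.toHypergraph))) :
    PT m O .evalScheme (fun i => .pair (.ofHypergraph (G i)) (w i).data)
      (fun i => .rat (homCount (c i).toHypergraph (G i).toHypergraph : ℚ)) := by
  refine PT.congr (PT.evalScheme (G := G) (d := fun i => fractionMotif (w i).1)
    (S := fun i => separatingScheme (w i).2.1 (w i).2.2.1 (w i).2.2.2.1 (w i).2.2.2.2.1) h
      fun i v hv => ?_) (fun i => rfl) fun i => ?_
  · obtain ⟨u, -, rfl⟩ := List.mem_map.1 hv
    exact hO i _ (valid_gadget_prod _ _ (hG i))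
  · obtain ⟨hs, hmem, hequiv, hk, hW⟩ := hw i
    rw [value_separatingScheme ((hTΓ _).2 ⟨_, hs⟩).1 hmem hW hk (hG i), homCount_congr _ _ hequiv]

/-- The answers that are needed in order to count the homomorphisms from `c` to `G` by means of the
witness `k`. -/
def IsInput (T : List (HypergraphCode × ℕ × ℕ × ℕ) → ℕ → Prop)
    (x : (Data → Data → Prop) × (HypergraphCode × HypergraphCode) × ℕ) : Prop :=
  IsLeastWitness T x.2.1.1 x.2.2 ∧ x.2.1.2.Valid ∧ ∀ G : HypergraphCode, G.Valid →
    x.1 (.pair (.ofMotif (fractionMotif (decodeD Witness x.2.2).1)) (.ofHypergraph G))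
      (.rat (zeta (fractionMotif (decodeD Witness x.2.2).1).toMotif G.toHypergraph))

theorem exists_program_homCount
    (hT : PrimrecPred fun x : List (HypergraphCode × ℕ × ℕ × ℕ) × ℕ => T x.1 x.2)
    (hTΓ : ∀ l, (fractionMotif l).Valid ∧ (fractionMotif l).toMotif ∈ Γ ↔ ∃ s, T l s) :
    ∃ (M : Prog) (B : ℕ → ℕ), Primrec B ∧
      (∀ n k, (decodeD Witness k).data.size ≤ B (Nat.pair n k)) ∧
      PT (fun x : {x // IsInput T x} => (Data.pair (.ofHypergraph x.1.2.1.1)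
        (.ofHypergraph x.1.2.1.2)).size + B (Nat.pair (encode x.1.2.1.1) x.1.2.2)) (fun x => x.1.1) M
        (fun x => .pair (.ofHypergraph x.1.2.1.1) (.ofHypergraph x.1.2.1.2))
        (fun x => .rat (homCount x.1.2.1.1.toHypergraph x.1.2.1.2.toHypergraph : ℚ)) := by
  obtain ⟨p, B, hB, hsize, hp⟩ := exists_program_witness hT
  refine ⟨.seq (.both .tl (.seq .hd p)) .evalScheme, B, hB, hsize, ?_⟩
  have hin : PB (fun x : {x // IsInput T x} => (Data.pair (.ofHypergraph x.1.2.1.1)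
      (.ofHypergraph x.1.2.1.2)).size + B (Nat.pair (encode x.1.2.1.1) x.1.2.2))
      fun x => (Data.pair (.ofHypergraph x.1.2.1.1) (.ofHypergraph x.1.2.1.2)).size :=
    PB.self.mono fun x => Nat.le_add_right _ _
  have h1 := PT.straight (O := fun x : {x // IsInput T x} => x.1.1) (p := .tl)
    (b := fun x => .ofHypergraph x.1.2.1.2) (by simp) hin fun x => by simp
  have h2 := PT.straight (O := fun x : {x // IsInput T x} => x.1.1) (p := .hd)
    (b := fun x => .ofHypergraph x.1.2.1.1) (by simp) hin fun x => by simp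
  have h3 := h1.both (h2.seq ((hp.comp fun x : {x // IsInput T x} =>
    ⟨(x.1.1, x.1.2.1.1, x.1.2.2), x.2.1⟩).measure (PB.self.mono fun x => by
      simp only [Data.size_pair]; omega)))
  exact h3.seq (PT.evalWitness h3.size_out hTΓ (fun x => x.2.1.1) (fun x => x.2.2.1)
    fun x => x.2.2.2)

/-- The program comes from `T` and does not depend on the family `𝓗`; only the bounds do. This is
why the uniform and the computable version have one proof. -/
theorem exists_reduction_of_primrecPred
    (hT : PrimrecPred fun x : List (HypergraphCode × ℕ × ℕ × ℕ) × ℕ => T x.1 x.2)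
    (hTΓ : ∀ l, (fractionMotif l).Valid ∧ (fractionMotif l).toMotif ∈ Γ ↔ ∃ s, T l s)
    {𝓗 : Set HypergraphType} (h𝓗 : 𝓗 ⊆ supports Γ) :
    ∃ (M : Prog) (f g : ℕ → ℕ) (c : ℕ), IsParamReduction (homProblem 𝓗) (hyperME Γ) M f g c ∧
      (DecidableFamily 𝓗 → Computable f ∧ Computable g) := by
  classical
  obtain ⟨M, B, hB, hsize, C, hC⟩ := exists_program_homCount hT hTΓ
  -- Adding the case that `c` lies outside the family makes the least index `K c` defined for every
  -- code. If the family is decidable, `K` is computable by search; the program itself never uses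
  -- `K`.
  have hex (c : HypergraphCode) :
      ∃ k, ¬ (c.Valid ∧ c.type ∈ 𝓗) ∨ IsWitness T c (decodeD Witness k) := by
    by_cases hc : c.Valid ∧ c.type ∈ 𝓗
    · obtain ⟨w, hw⟩ := exists_isWitness hTΓ (h𝓗 hc.2)
      exact ⟨encode w, .inr (by rwa [decodeD_encode])⟩
    · exact ⟨0, .inl hc⟩
  let K (c : HypergraphCode) : ℕ := Nat.find (hex c)
  have hK {c : HypergraphCode} (hc : c.Valid ∧ c.type ∈ 𝓗) : IsLeastWitness T c (K c) :=
    ⟨(Nat.find_spec (hex c)).resolve_left (not_not.2 hc),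
      fun j hj h => Nat.find_min (hex c) hj (.inr h)⟩
  let F (j : ℕ) : ℕ := B (Nat.pair j (K (decodeD HypergraphCode j)))
  let N (n : ℕ) : ℕ := Nat.pair n (listBound (listBound n n) (2 ^ n)) + 1
  -- The numbers below `N n` include all valid codes with `n` vertices, and the sum replaces a
  -- maximum over them. Numbers that code something else merely add to the bound.
  let g (n : ℕ) : ℕ := ∑ j ∈ Finset.range (N n), F j
  have hg {c : HypergraphCode} (hc : c.Valid) : B (Nat.pair (encode c) (K c)) ≤ g c.1 := by
    have h := Finset.single_le_sum (f := F) (fun _ _ => Nat.zero_le _)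
      (Finset.mem_range.2 (Nat.lt_succ_of_le hc.encode_le))
    simpa only [F, decodeD_encode] using h
  obtain ⟨D, hD⟩ := IsParamReduction.of_PT (P := homProblem 𝓗) (Q := hyperME Γ) (M := M)
    (f := fun n => (g n + 1) ^ C) (g := g) ⟨C, fun x => by
      obtain ⟨⟨c, G⟩, hc, hc𝓗, hG⟩ := x
      have hw := hK ⟨hc, hc𝓗⟩
      obtain ⟨t, ht, hr⟩ := hC ⟨((hyperME Γ).oracle (g c.1), (c, G), K c), hw, hG, fun G' hG' => by
        obtain ⟨hd, hdΓ⟩ := (hTΓ _).2 ⟨_, hw.1.1⟩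
        refine ⟨⟨(_, G'), hd, hdΓ, hG'⟩, ?_, rfl, rfl⟩
        -- The parameter of a query is the length of the description of `γ`, which is a part of the
        -- data found; so `g` bounds queries as well as time.
        refine le_trans ?_ ((hsize (encode c) _).trans (hg hc))
        change (Data.ofMotif (fractionMotif (decodeD Witness (K c)).1)).size ≤ _
        rw [Witness.data, Data.size_pair]
        omega⟩
      refine ⟨t, ht.trans ?_, hr⟩
      rw [← mul_pow]
      refine Nat.pow_le_pow_left ?_ C
      change _ ≤ (g c.1 + 1) * ((Data.pair (.ofHypergraph c) (.ofHypergraph G)).size + 2)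
      have := hg hc
      dsimp only
      nlinarith⟩
  refine ⟨M, _, g, D, hD, fun hdec => ?_⟩
  have hKc : Computable K := by
    refine Computable.find (P := fun c k => ¬ (c.Valid ∧ c.type ∈ 𝓗) ∨
      IsWitness T c (decodeD Witness k)) ?_ hex
    have h1 : PrimrecPred fun x : HypergraphCode × ℕ => IsWitness T x.1 (decodeD Witness x.2) := by
      fun_prop
    refine ⟨inferInstance, ?_⟩
    exact (Primrec.or.to_comp.comp (Primrec.not.to_comp.comp (hdec.decide.comp .fst))
      h1.decide.to_comp).of_eq fun x => by simp
  have hgc : Computable g := by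
    have hN : Primrec N := by fun_prop
    have hF : Computable F := hB.to_comp.comp (Primrec₂.natPair.to_comp.comp .id
      (hKc.comp (Primrec.decodeD .id).to_comp))
    exact Computable.sum_range hF hN.to_comp
  refine ⟨?_, hgc⟩
  have h2 : Primrec fun x : ℕ => (x + 1) ^ C * 3 ^ D := by fun_prop
  exact h2.to_comp.comp hgc

theorem exists_reduction (hΓ : RecursivelyEnumerable Γ) {𝓗 : Set HypergraphType}
    (h𝓗 : 𝓗 ⊆ supports Γ) :
    ∃ (M : Prog) (f g : ℕ → ℕ) (c : ℕ), IsParamReduction (homProblem 𝓗) (hyperME Γ) M f g c ∧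
      (DecidableFamily 𝓗 → Computable f ∧ Computable g) := by
  obtain ⟨T, hT, hTΓ⟩ := REPred.exists_primrecPred hΓ
  exact exists_reduction_of_primrecPred hT hTΓ h𝓗

end HyperMotif
theorem mainTheorem3 (Γ : Set HyperMotif.MotifFunction)
    (hΓ : HyperMotif.RecursivelyEnumerable Γ) :
    HyperMotif.UniformlyFPTReducible
        (HyperMotif.homProblem (HyperMotif.supports Γ)) (HyperMotif.hyperME Γ) ∧
      (∀ 𝓗 : Set HyperMotif.HypergraphType,
        𝓗 ⊆ HyperMotif.supports Γ → HyperMotif.DecidableFamily 𝓗 →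
          HyperMotif.FPTReducible (HyperMotif.homProblem 𝓗) (HyperMotif.hyperME Γ)) ∧
      HyperMotif.FPTReducible
        (HyperMotif.hyperME Γ) (HyperMotif.homProblem (HyperMotif.supports Γ)) := by
  refine ⟨?_, fun 𝓗 h𝓗 hdec => ?_, HyperMotif.hyperME_fptReducible Γ⟩
  · obtain ⟨M, f, g, c, h, -⟩ := HyperMotif.exists_reduction hΓ subset_rfl
    exact ⟨M, f, g, c, h⟩
  · obtain ⟨M, f, g, c, h, hfg⟩ := HyperMotif.exists_reduction hΓ h𝓗
    exact ⟨M, f, g, c, (hfg hdec).1, (hfg hdec).2, h⟩
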